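/- **Setting.** Fix constants $a,b>0$ with $a\ne b$, $\tau\in(0,1)$, $c_\tau>0$ and a ridge parameter $\lambda>0$. Consider a sequence of models with $n$ revealed and $m$ unrevealed vertices, $n,m$ even, $N=n+m$, $n/N=\tau$, $m\to\infty$. The labels $\mathbf y_{\mathbb L}\in\{\pm1\}^n$ (revealed) and $\mathbf y_{\mathbb U}\in\{\pm1\}^m$ (unrevealed) are independent and uniform among vectors with entries summing to $0$; $\mathbf y=(\mathbf y_{\mathbb L},\mathbf y_{\mathbb U})$. Given $\mathbf y$, the following are independent: the symmetric adjacency matrix $\mathbf A\in\{0,1\}^{N\times N}$ with zero diagonal and independent edges, $\mathbb P(A_{ij}=1)=\alpha$ if $y_i=y_j$ and $\beta$ otherwise; $\boldsymbol\mu$, uniform on the unit sphere of $\mathbb R^d$; and $\mathbf Z\in\mathbb R^{N\times d}$ with i.i.d. $N(0,1)$ entries. The features are $\mathbf X=\theta\,\mathbf y\boldsymbol\mu^\top+\mathbf Z$, $\theta>0$. Assume $q_m\to\infty$ with $\liminf_{m\to\infty} q_m/\log m\ge 1$, $\alpha=a q_m/m\in[0,1]$, $\beta=b q_m/m\in[0,1]$,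 and that $c_\tau=\theta^4\,[q_m(\theta^2+(1-\tau)d/m)]^{-1}$ for all large $m$. Put $a_\tau=a/(1-\tau)$, $b_\tau=b/(1-\tau)$. For $\rho\in\mathbb R$ let $\mathbf A_\rho=\mathbf A+\rho \mathbf I_N$, let $\mathbf D_\rho$ be the diagonal matrix with all diagonal entries equal to the average degree $\frac1N\sum_{i,j}(\mathbf A_\rho)_{ij}$, and let $h(\mathbf X)=\frac1{\sqrt{Nq_m}}\mathbf D_\rho^{-1}\mathbf A_\rho\mathbf X$. Let $\mathbf S_{\mathbb L},\mathbf S_{\mathbb U}$ be the $0/1$ matrices selecting the revealed and the unrevealed coordinates, $\mathbf P_{\mathbb L}=\mathbf S_{\mathbb L}^\top\mathbf S_{\mathbb L}$, and $$\widehat{\mathbf y}_{\mathrm{LRR}}=\mathbf S_{\mathbb U}h(\mathbf X)\big(h(\mathbf X)^\top \mathbf P_{\mathbb L}h(\mathbf X)+\lambda \mathbf I_d\big)^{-1}h(\mathbf X)^\top \mathbf P_{\mathbb L}\mathbf y .$$ The mismatch ratio is $\psi_m(\mathbf u,\mathbf v)=\frac1m\min_{\sigma\in\{\pm1\}}|\{i\in[m]:u_i\ne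 \sigma v_i\}|$. "Exact recovery" means $\mathbb P(\psi_m(\mathbf y_{\mathbb U},\mathrm{sign}(\widehat{\mathbf y}_{\mathrm{LRR}}))=0)\to1$ as $m\to\infty$. For $A,B>0$, $C\ge0$ let $I(A,B,C)=\frac12[(\sqrt A-\sqrt B)^2+C]$, and for $A,B,C>0$, $\zeta,s\in\mathbb R$ with $A+B+2s\ne0$ let $J(A,B,C,\zeta,s)=\sup_{t\in\mathbb R}\{g_1(t)+g_2(t)\}$, where $$g_1(t)=-\frac{2ts\zeta\sqrt C}{A+B+2s}-\frac{2t^2s^2\zeta^2}{(A+B+2s)^2},$$ $$g_2(t)=-\frac A2\Big[\exp\Big(\frac{2t\zeta\sqrt C}{A+B+2s}\Big)-1\Big]-\frac B2\Big[\exp\Big(-\frac{2t\zeta\sqrt C}{A+B+2s}\Big)-1\Big].$$ **Theorem.** Assume in addition $|\rho|\lesssim q_m$, $\theta^2=(1+o(1))c_\tau q_m$ and $q_m\lesssim d\lesssim\sqrt{Nq_m}$. (a) If $\rho=0$ and $I(a_\tau,b_\tau,0)>1$, then exact recovery holds. (b) If $\rho=\frac{2c_\tau}{\log(a_\tau/b_\tau)}q_m$,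 where $a_\tau+b_\tau+\frac{4c_\tau}{\log(a_\tau/b_\tau)}\neq0$, and $I(a_\tau,b_\tau,c_\tau)>1$, then exact recovery holds. (c) For $s\in\mathbb R$ and $A,B,C>0$ with $A+B+2s\ne0$ put $\kappa=\sqrt C\,\frac{A-B+2s}{A+B+2s}$ and $\zeta=\zeta(A,B,C)=\frac{\kappa\tau}{\kappa^2\tau+\lambda}$. If $\rho=sq_m$ for a constant $s\in\mathbb R$ with $a_\tau+b_\tau+2s\ne0$, and $J(a_\tau,b_\tau,c_\tau,\zeta,s)>1$ with $\zeta=\zeta(a_\tau,b_\tau,c_\tau)$, then exact recovery holds. Moreover, for every $s\in\mathbb R$ and all $A,B,C>0$ with $A+B+2s\ne0$, $J(A,B,C,\zeta(A,B,C),s)\le I(A,B,C)$; consequently the region where $J>1$ is contained in the region where $I>1$. -/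

import Mathlib

open MeasureTheory ProbabilityTheory Filter Topology Asymptotics
open scoped Matrix

noncomputable section

namespace GraphRidge

/-- The vertex set: `n` vertices with revealed labels followed by `m` vertices with unrevealed
labels, `N = n + m`. -/
abbrev Vtx (n m : ℕ) : Type := Fin n ⊕ Fin m

/-! ### The semi-supervised contextual stochastic block model -/

/-- The uniform distribution on the label vectors `y ∈ {±1}^n` with `∑ i, y i = 0`. -/
def balancedLaw (n : ℕ) : Measure (Fin n → ℤ) :=
  uniformOn {y | (∀ i, y i = 1 ∨ y i = -1) ∧ ∑ i, y i = 0}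

/-- The label vector `y = [y_L, y_U]` on all vertices, with real entries. -/
def labels {n m : ℕ} (yL : Fin n → ℤ) (yU : Fin m → ℤ) : Vtx n m → ℝ :=
  Sum.elim (fun i => (yL i : ℝ)) (fun j => (yU j : ℝ))

open scoped Classical in
/-- Connection probability of an unordered pair: `α` within and `β` across the communities. -/
def edgeProb {V : Type*} (y : V → ℝ) (α β : unitInterval) : Sym2 V → unitInterval :=
  Sym2.lift ⟨fun i j => if y i = y j then α else β, fun i j => by simp only [eq_comm]⟩

open scoped Classical in
/-- The symmetric matrix with zero diagonal whose entry at `i ≠ j` is the coin of the pair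
`{i, j}` (coins at the diagonal pairs are ignored). -/
def adjOfCoins {V : Type*} (w : Sym2 V → ℝ) : V → V → ℝ :=
  fun i j => if i = j then 0 else w s(i, j)

/-- `SBM(y, α, β)`: the law of the adjacency matrix, with independent Bernoulli edges. -/
def sbmLaw {V : Type*} [Fintype V] [DecidableEq V] (y : V → ℝ) (α β : unitInterval) :
    Measure (V → V → ℝ) :=
  (Measure.pi fun e : Sym2 V => bernoulliMeasure (1 : ℝ) 0 (edgeProb y α β e)).map adjOfCoins

/-- The unit sphere `S^{d-1}` of `ℝ^d`. -/
abbrev USphere (d : ℕ) : Type := Metric.sphere (0 : EuclideanSpace ℝ (Fin d)) 1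

/-- The uniform distribution on `S^{d-1}`: the normalized surface measure. -/
def sphereLaw (d : ℕ) : Measure (USphere d) :=
  ((volume : Measure (EuclideanSpace ℝ (Fin d))).toSphere Set.univ)⁻¹ •
    (volume : Measure (EuclideanSpace ℝ (Fin d))).toSphere

/-- The law of `Z`, whose rows `z_i` are i.i.d. `N(0, I_d)`. -/
def noiseLaw (V : Type*) [Fintype V] (d : ℕ) : Measure (V → Fin d → ℝ) :=
  Measure.pi fun _ => Measure.pi fun _ => gaussianReal 0 1

/-- `X = θ y μᵀ + Z`. -/
def features {V : Type*} {d : ℕ} (θ : ℝ) (y : V → ℝ) (μ : USphere d) (Z : V → Fin d → ℝ) :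
    Matrix V (Fin d) ℝ :=
  Matrix.of fun i j => θ * y i * (μ : EuclideanSpace ℝ (Fin d)) j + Z i j

/-- A sample `((y_L, y_U), A, μ, Z)`. -/
abbrev Sample (n m d : ℕ) : Type :=
  ((Fin n → ℤ) × (Fin m → ℤ)) × (Vtx n m → Vtx n m → ℝ) × USphere d × (Vtx n m → Fin d → ℝ)

/-- The semi-supervised `CSBM`: `y_L` and `y_U` are independent and uniform on the balanced label
vectors; given them, `A ∼ SBM(y, α, β)`, `μ` uniform on the sphere and `Z` standard Gaussian are
independent. The features are `X = θ y μᵀ + Z`. -/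
def csbmLaw (n m d : ℕ) (α β : unitInterval) : Measure (Sample n m d) :=
  ((balancedLaw n).prod (balancedLaw m)).bind fun y =>
    (Measure.dirac y).prod
      ((sbmLaw (labels y.1 y.2) α β).prod ((sphereLaw d).prod (noiseLaw (Vtx n m) d)))

/-! ### Ridge regression on the linear graph convolution -/

/-- `A_ρ = A + ρ I_N`. -/
def selfLoop {V : Type*} [DecidableEq V] (A : V → V → ℝ) (ρ : ℝ) : Matrix V V ℝ :=
  Matrix.of A + ρ • (1 : Matrix V V ℝ)

/-- `D_ρ`: the diagonal matrix whose diagonal entries all equal the average degree of `A_ρ`. -/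
def avgDegree {V : Type*} [Fintype V] [DecidableEq V] (A : V → V → ℝ) (ρ : ℝ) : Matrix V V ℝ :=
  Matrix.diagonal fun _ => (1 / (Fintype.card V : ℝ)) * ∑ i, ∑ j, selfLoop A ρ i j

/-- `h(X) = (N q)^{-1/2} D_ρ⁻¹ A_ρ X`. -/
def conv {V : Type*} [Fintype V] [DecidableEq V] {d : ℕ} (A : V → V → ℝ) (ρ q : ℝ)
    (X : Matrix V (Fin d) ℝ) : Matrix V (Fin d) ℝ :=
  (1 / √((Fintype.card V : ℝ) * q)) • ((avgDegree A ρ)⁻¹ * selfLoop A ρ * X)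

/-- The sketching matrix `S_L`. -/
def sketchL (n m : ℕ) : Matrix (Fin n) (Vtx n m) ℝ :=
  Matrix.of fun i v => if v = Sum.inl i then 1 else 0

/-- The sketching matrix `S_U`. -/
def sketchU (n m : ℕ) : Matrix (Fin m) (Vtx n m) ℝ :=
  Matrix.of fun i v => if v = Sum.inr i then 1 else 0

/-- The ridge solution `β̂ = (Hᵀ P_L H + lam I_d)⁻¹ Hᵀ P_L y`, `P_L = S_Lᵀ S_L`. -/
def ridgeCoef {n m d : ℕ} (H : Matrix (Vtx n m) (Fin d) ℝ) (lam : ℝ) (y : Vtx n m → ℝ) :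
    Fin d → ℝ :=
  (Hᵀ * ((sketchL n m)ᵀ * sketchL n m) * H + lam • (1 : Matrix (Fin d) (Fin d) ℝ))⁻¹ *ᵥ
    (Hᵀ *ᵥ (((sketchL n m)ᵀ * sketchL n m) *ᵥ y))

/-- The estimator `ŷ_LRR = S_U h(X) β̂`. -/
def yLRR {n m d : ℕ} (θ q ρ lam : ℝ) (ω : Sample n m d) : Fin m → ℝ :=
  let y := labels ω.1.1 ω.1.2
  let H := conv ω.2.1 ρ q (features θ y ω.2.2.1 ω.2.2.2)
  sketchU n m *ᵥ (H *ᵥ ridgeCoef H lam y)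

open scoped Classical in
/-- The mismatch ratio `ψ_m(y, ŷ) = (1/m) min_{s = ±1} #{i : y_i ≠ s ŷ_i}`. -/
def mismatch {m : ℕ} (y yhat : Fin m → ℝ) : ℝ :=
  (1 / (m : ℝ)) * min ((Finset.univ.filter fun i => y i ≠ 1 * yhat i).card : ℝ)
    ((Finset.univ.filter fun i => y i ≠ (-1) * yhat i).card : ℝ)

/-- The probability that `ψ_m(y_U, sign ŷ_LRR) = 0`. -/
def exactProb (n m d : ℕ) (α β : unitInterval) (θ q ρ lam : ℝ) : ENNReal :=
  csbmLaw n m d α β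
    {ω | mismatch (fun i => (ω.1.2 i : ℝ)) (fun i => Real.sign (yLRR θ q ρ lam ω i)) = 0}

/-! ### Rate functions -/

/-- `I(a, b, c) = ((√a - √b)² + c) / 2`. -/
def rateI (a b c : ℝ) : ℝ := ((√a - √b) ^ 2 + c) / 2

/-- `g₁(t)`. -/
def g₁ (a b c ζ s t : ℝ) : ℝ :=
  -(2 * t * s * ζ * √c / (a + b + 2 * s)) - 2 * t ^ 2 * s ^ 2 * ζ ^ 2 / (a + b + 2 * s) ^ 2

/-- `g₂(t)`. -/
def g₂ (a b c ζ s t : ℝ) : ℝ :=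
  -(a / 2) * (Real.exp (2 * t * ζ * √c / (a + b + 2 * s)) - 1)
    - b / 2 * (Real.exp (-(2 * t * ζ * √c / (a + b + 2 * s))) - 1)

/-- `J(a, b, c, ζ, s) = sup_{t ∈ ℝ} (g₁(t) + g₂(t))`; the supremum is finite for
`a, b, c > 0` and `a + b + 2 s ≠ 0`. -/
def rateJ (a b c ζ s : ℝ) : ℝ := ⨆ t : ℝ, (g₁ a b c ζ s t + g₂ a b c ζ s t)

/-- `κ = √c (a - b + 2 s) / (a + b + 2 s)`. -/
def kappa (a b c s : ℝ) : ℝ := √c * ((a - b + 2 * s) / (a + b + 2 * s))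

/-- `ζ = κ τ / (κ² τ + lam)`. -/
def zeta (a b c τ lam s : ℝ) : ℝ :=
  kappa a b c s * τ / (kappa a b c s ^ 2 * τ + lam)

/-- The weight `s = 2 c / log (a / b)` of the optimal self-loop `ρ = s q`. -/
def sOpt (a b c : ℝ) : ℝ := 2 * c / Real.log (a / b)

end GraphRidge

end

/-!
**Reduction to one rate.** Up to the substitution `x = 2 t ζ √c / (a + b + 2 s)`, the function
`g₁ + g₂` is `-rowExponent a b c s x`. Completing squares gives `rateJ ≤ rateI`
(`rateJ_le_rateI`). At `x = log (b / a) / 2` the exponent takes the value `-rateI a b 0` if `s = 0`,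
and `-rateI a b c` for the optimal weight `s = 2 c / log (a / b)`, where both of its parts are
minimal at the same point; hence (a) and (b) are instances of (c) (`rateI_zero_le_rateJ`,
`rateI_le_rateJ_sOpt`).

**The prediction at a vertex is its score.** Fix balanced labels `y` and write `L` for the scalar
with `h(X) = L A_ρ X` (`convScale`). Since the degrees concentrate in mean square, the features
`h(X)` are close to the rank one matrix `κ / √N · y μᵀ` in the directions that enter the energy
estimate `IsRidge.norm_sub_le`, and the ridge solution is close to `√N ζ μ` in norm
(`norm_ridge_sub_limit_le`). The prediction at `i` is the inner product of the ridge solution with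
`L (θ (A_ρ y)_i μ + ∑ j, (A_ρ)_{ij} z_j)`. Closeness in norm is not enough here, because the noise
rows `z_j` have norm about `√d`. But the ridge solution changes little when one noise row `z_j` is
set to zero (`norm_ridge_sub_leave_one_out_le`), and the solution without `z_j` is independent of
`z_j`, so that its deviation from `√N ζ μ` is nearly orthogonal to `z_j`
(`measure_leave_one_out_le`). Thus, up to a relative error of order `η`, the signed prediction is
`√N ζ L` times the score `y_i (θ (A_ρ y)_i + (A_ρ Z μ)_i)`, for every vertex simultaneously
(`exists_prediction_error_const`).

**Large deviations of the score.** Given `A`, the noise part of the score is Gaussian with variance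
`∑ j, (A_ρ)_{ij} ^ 2`. Divided by `θ`, the score has at `x` a logarithmic moment generating function
that is at most about `q · rowExponent a b c s x` (`measure_score_le`,
`tendsto_chernoff_exponent`). If `J > 1`, the exponent is below `-1` at some `x`, and since
`N exp (-(1 + γ) q)` tends to zero by the growth condition on `q`, a union bound shows that all
scores lie strictly on one side of zero, by a margin of order `q θ` (`measure_not_isGood_le`). Then
no label is mismatched, up to the global sign (`IsGood.mismatch_eq_zero`). The bounds are uniform in
the labels, which are averaged at the end (`one_sub_le_exactProb`).
-/

namespace GraphRidge

/-! ### Rate functions -/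

/-- The limiting normalized logarithm of the moment generating function, at `x`, of the
signed score `y_i (A_ρ y)_i + ρ g / θ` of a vertex (`g` standard Gaussian), when `ρ = s q`. -/
noncomputable def rowExponent (A B C s x : ℝ) : ℝ :=
  s * x + s ^ 2 * x ^ 2 / (2 * C) + A / 2 * (Real.exp x - 1) + B / 2 * (Real.exp (-x) - 1)

lemma g₁_add_g₂ {A B C ζ s t : ℝ} (hC : 0 < C) :
    g₁ A B C ζ s t + g₂ A B C ζ s t =
      -rowExponent A B C s (2 * t * ζ * √C / (A + B + 2 * s)) := by
  have h : (2 * t * ζ * √C / (A + B + 2 * s)) ^ 2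
      = 4 * t ^ 2 * ζ ^ 2 * C / (A + B + 2 * s) ^ 2 := by
    rw [div_pow, mul_pow, mul_pow, mul_pow, Real.sq_sqrt hC.le]; ring
  have h2 : s ^ 2 * (4 * t ^ 2 * ζ ^ 2 * C / (A + B + 2 * s) ^ 2) / (2 * C)
      = 2 * t ^ 2 * s ^ 2 * ζ ^ 2 / (A + B + 2 * s) ^ 2 := by
    rw [mul_div_assoc', div_div, show s ^ 2 * (4 * t ^ 2 * ζ ^ 2 * C)
      = (2 * t ^ 2 * s ^ 2 * ζ ^ 2) * (2 * C) by ring, mul_div_mul_right _ _ (by positivity)]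
  unfold g₁ g₂ rowExponent
  rw [h, h2]
  ring

lemma neg_rowExponent_le_rateI {A B C : ℝ} (hA : 0 < A) (hB : 0 < B) (hC : 0 < C) (s x : ℝ) :
    -rowExponent A B C s x ≤ rateI A B C := by
  have h1 : 0 ≤ C / 2 + s * x + s ^ 2 * x ^ 2 / (2 * C) := by
    have : C / 2 + s * x + s ^ 2 * x ^ 2 / (2 * C) = (C + s * x) ^ 2 / (2 * C) := by
      field_simp; ring
    rw [this]; positivity
  have hA' := Real.sq_sqrt hA.le
  have hB' := Real.sq_sqrt hB.le
  have he : Real.exp x = Real.exp (x / 2) ^ 2 := by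
    rw [← Real.exp_nat_mul]; congr 1; push_cast; ring
  have he' : Real.exp (-x) = Real.exp (-(x / 2)) ^ 2 := by
    rw [← Real.exp_nat_mul]; congr 1; push_cast; ring
  have hm : Real.exp (x / 2) * Real.exp (-(x / 2)) = 1 := by rw [← Real.exp_add]; simp
  unfold rowExponent rateI
  rw [he, he']
  nlinarith [sq_nonneg (√A * Real.exp (x / 2) - √B * Real.exp (-(x / 2)))]

lemma rateJ_le_rateI {A B C ζ s : ℝ} (hA : 0 < A) (hB : 0 < B) (hC : 0 < C) :
    rateJ A B C ζ s ≤ rateI A B C :=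
  ciSup_le fun t => by rw [g₁_add_g₂ hC]; exact neg_rowExponent_le_rateI hA hB hC _ _

lemma neg_rowExponent_le_rateJ {A B C ζ s : ℝ} (hA : 0 < A) (hB : 0 < B) (hC : 0 < C)
    (hζ : ζ ≠ 0) (hs : A + B + 2 * s ≠ 0) (x : ℝ) :
    -rowExponent A B C s x ≤ rateJ A B C ζ s := by
  have hbdd : BddAbove (Set.range fun t : ℝ => g₁ A B C ζ s t + g₂ A B C ζ s t) := by
    refine ⟨rateI A B C, ?_⟩
    rintro _ ⟨t, rfl⟩
    simp only [g₁_add_g₂ hC]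
    exact neg_rowExponent_le_rateI hA hB hC _ _
  have hC' : √C ≠ 0 := (Real.sqrt_pos.2 hC).ne'
  have := le_ciSup hbdd (x * (A + B + 2 * s) / (2 * ζ * √C))
  rw [g₁_add_g₂ hC] at this
  have hx : 2 * (x * (A + B + 2 * s) / (2 * ζ * √C)) * ζ * √C / (A + B + 2 * s) = x := by
    field_simp
  rwa [hx] at this

lemma exists_rowExponent_lt {A B C ζ s : ℝ} (hC : 0 < C) (h : 1 < rateJ A B C ζ s) :
    ∃ x, rowExponent A B C s x < -1 := by
  obtain ⟨t, ht⟩ := exists_lt_of_lt_ciSup h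
  rw [g₁_add_g₂ hC] at ht
  exact ⟨_, by linarith⟩

/-- A point where the exponent is negative lies on the side opposite to the mean of the score. -/
lemma mul_lt_of_rowExponent_lt {A B C s x : ℝ} (hA : 0 < A) (hB : 0 < B) (hC : 0 < C)
    (h : rowExponent A B C s x < -1) : x * (A - B + 2 * s) < 0 := by
  have h1 := Real.add_one_le_exp x
  have h2 := Real.add_one_le_exp (-x)
  have h3 : 0 ≤ s ^ 2 * x ^ 2 / (2 * C) := by positivity
  unfold rowExponent at h
  nlinarith

/-- The exponent at the minimizer `x = log (B / A) / 2` of its graph part. -/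
lemma rowExponent_half_log {A B C s : ℝ} (hA : 0 < A) (hB : 0 < B) :
    rowExponent A B C s (Real.log (B / A) / 2) =
      s * (Real.log (B / A) / 2) + s ^ 2 * (Real.log (B / A) / 2) ^ 2 / (2 * C)
        - (√A - √B) ^ 2 / 2 := by
  have h1 : Real.exp (Real.log (B / A) / 2) = √B / √A := by
    rw [← Real.sqrt_div hB.le, ← Real.log_sqrt (by positivity), Real.exp_log (by positivity)]
  have h2 : Real.exp (-(Real.log (B / A) / 2)) = √A / √B := by
    rw [Real.exp_neg, h1, inv_div]
  have hA' := Real.sq_sqrt hA.le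
  have hB' := Real.sq_sqrt hB.le
  have hA0 := Real.sqrt_pos.2 hA
  have hB0 := Real.sqrt_pos.2 hB
  have h3 : A * (√B / √A) = √A * √B := by
    rw [mul_div_assoc', div_eq_iff hA0.ne']; linear_combination (-√B) * hA'
  have h4 : B * (√A / √B) = √A * √B := by
    rw [mul_div_assoc', div_eq_iff hB0.ne']; linear_combination (-√A) * hB'
  unfold rowExponent
  rw [h1, h2]
  linarith [sub_sq (√A) (√B)]

lemma zeta_ne_zero {A B C τ lam s : ℝ} (hC : 0 < C) (hτ : 0 < τ) (hlam : 0 < lam)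
    (h1 : A + B + 2 * s ≠ 0) (h2 : A - B + 2 * s ≠ 0) : zeta A B C τ lam s ≠ 0 := by
  have hk : kappa A B C s ≠ 0 :=
    mul_ne_zero (Real.sqrt_pos.2 hC).ne' (div_ne_zero h2 h1)
  exact div_ne_zero (mul_ne_zero hk hτ.ne') (by positivity)

/-- Without self-loops, `J` attains the value `I(A, B, 0)`. -/
lemma rateI_zero_le_rateJ {A B C τ lam : ℝ} (hA : 0 < A) (hB : 0 < B) (hC : 0 < C) (hAB : A ≠ B)
    (hτ : 0 < τ) (hlam : 0 < lam) :
    rateI A B 0 ≤ rateJ A B C (zeta A B C τ lam 0) 0 := by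
  have h1 : A + B + 2 * 0 ≠ 0 := by positivity
  have h2 : A - B + 2 * 0 ≠ 0 := by simpa [sub_eq_zero] using hAB
  refine le_trans (le_of_eq ?_)
    (neg_rowExponent_le_rateJ hA hB hC (zeta_ne_zero hC hτ hlam h1 h2) h1 (Real.log (B / A) / 2))
  rw [rowExponent_half_log hA hB, rateI]
  ring

/-- With the self-loop weight `sOpt`, both parts of the exponent are minimal at the same point,
so that `J` attains the value `I(A, B, C)`. -/
lemma rateI_le_rateJ_sOpt {A B C τ lam : ℝ} (hA : 0 < A) (hB : 0 < B) (hC : 0 < C) (hAB : A ≠ B)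
    (hτ : 0 < τ) (hlam : 0 < lam) (h1 : A + B + 2 * sOpt A B C ≠ 0) :
    rateI A B C ≤ rateJ A B C (zeta A B C τ lam (sOpt A B C)) (sOpt A B C) := by
  have hlog : Real.log (B / A) = -Real.log (A / B) := by rw [← Real.log_inv, inv_div]
  have hl0 : Real.log (A / B) ≠ 0 := by
    rcases lt_or_gt_of_ne hAB with h | h
    · exact (Real.log_neg (by positivity) ((div_lt_one hB).2 h)).ne
    · exact (Real.log_pos ((one_lt_div hB).2 h)).ne'
  have h2 : A - B + 2 * sOpt A B C ≠ 0 := by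
    rcases lt_or_gt_of_ne hAB with h | h
    · have := div_neg_of_pos_of_neg (by positivity : 0 < 2 * C)
        (Real.log_neg (by positivity) ((div_lt_one hB).2 h))
      unfold sOpt; linarith
    · have := div_pos (by positivity : 0 < 2 * C) (Real.log_pos ((one_lt_div hB).2 h))
      unfold sOpt; linarith
  refine le_trans (le_of_eq ?_)
    (neg_rowExponent_le_rateJ hA hB hC (zeta_ne_zero hC hτ hlam h1 h2) h1 (Real.log (B / A) / 2))
  rw [rowExponent_half_log hA hB, rateI, hlog, sOpt]
  field_simp
  ring

/-! ### Ridge regression and its stability -/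

section Ridge

variable {V E : Type*} [NormedAddCommGroup E] [InnerProductSpace ℝ E]

open scoped RealInnerProductSpace

/-- The normal equation, in weak form, of the ridge regression of the responses `y i` on the
feature vectors `H i`, `i ∈ S`, with penalty `lam`. -/
def IsRidge (H : V → E) (S : Finset V) (y : V → ℝ) (lam : ℝ) (β : E) : Prop :=
  ∀ v : E, ∑ i ∈ S, (y i - ⟪H i, β⟫) * ⟪H i, v⟫ = lam * ⟪β, v⟫

variable {H H' : V → E} {S : Finset V} {y : V → ℝ} {lam : ℝ} {β β' : E}

lemma IsRidge.residual_add_penalty_le (h : IsRidge H S y lam β) :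
    ∑ i ∈ S, (y i - ⟪H i, β⟫) ^ 2 + 2 * (lam * ‖β‖ ^ 2) ≤ ∑ i ∈ S, y i ^ 2 := by
  have h1 := h β
  rw [real_inner_self_eq_norm_sq] at h1
  rw [← h1, Finset.mul_sum, ← Finset.sum_add_distrib]
  refine Finset.sum_le_sum fun i _ => ?_
  nlinarith [sq_nonneg ⟪H i, β⟫]

/-- Energy estimate for the difference of two ridge solutions: only the action of the
perturbation `H - H'` on the second solution and on its residual enters. -/
lemma IsRidge.norm_sub_le (h : IsRidge H S y lam β) (h' : IsRidge H' S y lam β')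
    (hlam : 0 < lam) {p r : ℝ} (hp0 : 0 ≤ p)
    (hp : ∑ i ∈ S, ⟪H i - H' i, β'⟫ ^ 2 ≤ p ^ 2)
    (hr : ‖∑ i ∈ S, (y i - ⟪H' i, β'⟫) • (H i - H' i)‖ ≤ r) :
    ‖β - β'‖ ≤ r / lam + p / √lam := by
  set x := β - β' with hx
  have hr0 : 0 ≤ r := (norm_nonneg _).trans hr
  have e1 := h x
  have e2 := h' x
  have e3 : ∑ i ∈ S, ((y i - ⟪H' i, β'⟫) * ⟪H i - H' i, x⟫ - ⟪H i, x⟫ * ⟪H i - H' i, β'⟫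
      - ⟪H i, x⟫ ^ 2) = lam * ‖x‖ ^ 2 := by
    rw [← real_inner_self_eq_norm_sq]
    nth_rewrite 4 [hx]
    rw [inner_sub_left, mul_sub, ← e1, ← e2, ← Finset.sum_sub_distrib]
    refine Finset.sum_congr rfl fun i _ => ?_
    have : ⟪H i, x⟫ = ⟪H i, β⟫ - ⟪H i, β'⟫ := by rw [hx, inner_sub_right]
    rw [inner_sub_left, inner_sub_left, this, hx, inner_sub_right]
    ring
  have e4 : lam * ‖x‖ ^ 2 ≤ r * ‖x‖ + p ^ 2 / 4 := by
    have e5 : ∑ i ∈ S, (y i - ⟪H' i, β'⟫) * ⟪H i - H' i, x⟫ ≤ r * ‖x‖ := by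
      have : ∑ i ∈ S, (y i - ⟪H' i, β'⟫) * ⟪H i - H' i, x⟫
          = ⟪∑ i ∈ S, (y i - ⟪H' i, β'⟫) • (H i - H' i), x⟫ := by
        rw [sum_inner]; exact Finset.sum_congr rfl fun i _ => by rw [real_inner_smul_left]
      rw [this]
      exact (real_inner_le_norm _ _).trans (mul_le_mul_of_nonneg_right hr (norm_nonneg _))
    have e6 : ∑ i ∈ S, (- ⟪H i, x⟫ * ⟪H i - H' i, β'⟫ - ⟪H i, x⟫ ^ 2) ≤ p ^ 2 / 4 := by
      refine le_trans (Finset.sum_le_sum (g := fun i => ⟪H i - H' i, β'⟫ ^ 2 / 4)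
        fun i _ => ?_) ?_
      · nlinarith [sq_nonneg (⟪H i, x⟫ + ⟪H i - H' i, β'⟫ / 2)]
      · rw [← Finset.sum_div]; linarith
    rw [← e3]
    calc _ = ∑ i ∈ S, (y i - ⟪H' i, β'⟫) * ⟪H i - H' i, x⟫
          + ∑ i ∈ S, (- ⟪H i, x⟫ * ⟪H i - H' i, β'⟫ - ⟪H i, x⟫ ^ 2) := by
            rw [← Finset.sum_add_distrib]; exact Finset.sum_congr rfl fun i _ => by ring
      _ ≤ _ := add_le_add e5 e6
  by_contra hcon
  push Not at hcon
  have hs := Real.sqrt_pos.2 hlam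
  have hs2 := Real.sq_sqrt hlam.le
  have h1 : r + p * √lam < lam * ‖x‖ := by
    have := mul_lt_mul_of_pos_left hcon hlam
    have h3 : lam * (r / lam + p / √lam) = r + p * √lam := by
      rw [mul_add, mul_div_cancel₀ _ hlam.ne']
      congr 1
      rw [mul_div_assoc', div_eq_iff hs.ne']; linear_combination (-p) * hs2
    linarith
  have hx0 : 0 ≤ ‖x‖ := norm_nonneg _
  have h2 : p < √lam * ‖x‖ := by
    have : p / √lam < ‖x‖ := lt_of_le_of_lt (by have := div_nonneg hr0 hlam.le; linarith) hcon
    rwa [div_lt_iff₀ hs, mul_comm] at this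
  nlinarith [mul_le_mul_of_nonneg_left h1.le hx0, mul_nonneg hp0 hx0,
    mul_le_mul_of_nonneg_left h2.le hp0, sq_nonneg p, mul_pos hs hs]

/-- A perturbation of rank one, `H i - H' i = u i • z`. -/
lemma IsRidge.norm_sub_le_of_rank_one (h : IsRidge H S y lam β) (h' : IsRidge H' S y lam β')
    (hlam : 0 < lam) {u : V → ℝ} {z : E} {U Y : ℝ} (hU : 0 ≤ U) (hY : 0 ≤ Y)
    (hH : ∀ i ∈ S, H i - H' i = u i • z)
    (hu : ∑ i ∈ S, u i ^ 2 ≤ U ^ 2) (hy : ∑ i ∈ S, y i ^ 2 ≤ Y ^ 2) :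
    ‖β - β'‖ ≤ 2 / lam * (U * ‖z‖ * Y) := by
  have hz := norm_nonneg z
  have hs := Real.sqrt_pos.2 hlam
  have hs2 := Real.sq_sqrt hlam.le
  have hen := h'.residual_add_penalty_le
  have hres : ∑ i ∈ S, (y i - ⟪H' i, β'⟫) ^ 2 ≤ Y ^ 2 := by
    have : 0 ≤ lam * ‖β'‖ ^ 2 := by positivity
    linarith
  have hβ : ‖β'‖ ≤ Y / √lam := by
    rw [le_div_iff₀ hs]
    refine abs_le_of_sq_le_sq' ?_ hY |>.2
    have : 0 ≤ ∑ i ∈ S, (y i - ⟪H' i, β'⟫) ^ 2 := Finset.sum_nonneg fun i _ => sq_nonneg _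
    have h0 : 0 ≤ lam * ‖β'‖ ^ 2 := by positivity
    rw [mul_pow, hs2]; linarith
  have key := h.norm_sub_le h' hlam (p := U * ‖z‖ * (Y / √lam)) (r := U * ‖z‖ * Y)
    (by positivity) ?_ ?_
  · refine key.trans (le_of_eq ?_)
    have : U * ‖z‖ * (Y / √lam) / √lam = U * ‖z‖ * Y / lam := by
      rw [mul_div_assoc', div_div, ← sq, hs2]
    rw [this]; ring
  · calc ∑ i ∈ S, ⟪H i - H' i, β'⟫ ^ 2 = (∑ i ∈ S, u i ^ 2) * ⟪z, β'⟫ ^ 2 := by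
          rw [Finset.sum_mul]
          exact Finset.sum_congr rfl fun i hi => by
            rw [hH i hi, real_inner_smul_left, mul_pow]
      _ ≤ U ^ 2 * (‖z‖ * (Y / √lam)) ^ 2 := by
          refine mul_le_mul hu ?_ (sq_nonneg _) (sq_nonneg _)
          rw [← sq_abs]
          refine pow_le_pow_left₀ (abs_nonneg _) ((abs_real_inner_le_norm _ _).trans ?_) 2
          exact mul_le_mul_of_nonneg_left hβ hz
      _ = _ := by ring
  · have : ∑ i ∈ S, (y i - ⟪H' i, β'⟫) • (H i - H' i)
        = (∑ i ∈ S, (y i - ⟪H' i, β'⟫) * u i) • z := by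
      rw [Finset.sum_smul]
      exact Finset.sum_congr rfl fun i hi => by rw [hH i hi, smul_smul]
    rw [this, norm_smul, Real.norm_eq_abs]
    have h2 : |∑ i ∈ S, (y i - ⟪H' i, β'⟫) * u i| ≤ Y * U := by
      refine abs_le_of_sq_le_sq ?_ (by positivity)
      refine (Finset.sum_mul_sq_le_sq_mul_sq _ _ _).trans ?_
      rw [mul_pow]
      exact mul_le_mul hres hu (Finset.sum_nonneg fun _ _ => sq_nonneg _) (sq_nonneg _)
    calc _ ≤ Y * U * ‖z‖ := mul_le_mul_of_nonneg_right h2 hz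
      _ = _ := by ring

/-- Ridge regression on features `H' i = k y i μ` along one direction. -/
lemma isRidge_rank_one {k : ℝ} {μ : E} (hμ : ‖μ‖ = 1) (hlam : 0 < lam) :
    IsRidge (fun i => (k * y i) • μ) S y lam
      ((k * (∑ i ∈ S, y i ^ 2) / (k ^ 2 * (∑ i ∈ S, y i ^ 2) + lam)) • μ) := by
  intro v
  have hpos : 0 ≤ ∑ i ∈ S, y i ^ 2 := Finset.sum_nonneg fun i _ => sq_nonneg _
  have hμ' : ⟪μ, μ⟫ = 1 := by rw [real_inner_self_eq_norm_sq, hμ]; norm_num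
  simp only [real_inner_smul_left, real_inner_smul_right, hμ']
  set Q := ∑ i ∈ S, y i ^ 2 with hQ
  have hne : k ^ 2 * Q + lam ≠ 0 := by positivity
  have : ∀ i, (y i - k * Q / (k ^ 2 * Q + lam) * (k * y i * 1)) * (k * y i * ⟪μ, v⟫)
      = y i ^ 2 * ((1 - k * (k * Q / (k ^ 2 * Q + lam))) * (k * ⟪μ, v⟫)) := fun i => by ring
  rw [Finset.sum_congr rfl fun i _ => this i, ← Finset.sum_mul, ← hQ]
  field_simp
  ring

end Ridge

/-! ### Moment bounds in terms of lower integrals -/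

section Markov

variable {Ω Ω' : Type*} [MeasurableSpace Ω] [MeasurableSpace Ω'] {P : Measure Ω}

lemma measure_lt_le_of_lintegral_le {X : Ω → ℝ} (hX : Measurable X) {M t : ℝ} (ht : 0 < t)
    (h : ∫⁻ ω, ENNReal.ofReal (X ω) ∂P ≤ ENNReal.ofReal M) :
    P {ω | t < X ω} ≤ ENNReal.ofReal (M / t) := by
  have h1 := meas_ge_le_lintegral_div (μ := P) (f := fun ω => ENNReal.ofReal (X ω))
    (by fun_prop) (ε := ENNReal.ofReal t) (by simpa using ht) ENNReal.ofReal_ne_top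
  rw [ENNReal.ofReal_div_of_pos ht]
  refine le_trans (measure_mono fun ω hω => ?_) (h1.trans (ENNReal.div_le_div_right h _))
  exact ENNReal.ofReal_le_ofReal (le_of_lt hω)

lemma measure_le_le_of_lintegral_exp_le {X : Ω → ℝ} (hX : Measurable X) {M t : ℝ}
    (h : ∫⁻ ω, ENNReal.ofReal (Real.exp (X ω)) ∂P ≤ ENNReal.ofReal (Real.exp M)) :
    P {ω | t ≤ X ω} ≤ ENNReal.ofReal (Real.exp (M - t)) := by
  have h1 := meas_ge_le_lintegral_div (μ := P) (f := fun ω => ENNReal.ofReal (Real.exp (X ω)))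
    (by fun_prop) (ε := ENNReal.ofReal (Real.exp t)) (by simpa using Real.exp_pos t)
    ENNReal.ofReal_ne_top
  rw [Real.exp_sub, ENNReal.ofReal_div_of_pos (Real.exp_pos t)]
  refine le_trans (measure_mono fun ω hω => ?_) (h1.trans (ENNReal.div_le_div_right h _))
  exact ENNReal.ofReal_le_ofReal (Real.exp_le_exp.2 hω)

/-- A second moment bound from exponential moments at `± t`, by `u² ≤ exp u + exp (-u)`. -/
lemma lintegral_sq_le_of_exp {X : Ω → ℝ} (hX : Measurable X) {M t : ℝ} (ht : 0 < t) (hM : 0 ≤ M)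
    (h1 : ∫⁻ ω, ENNReal.ofReal (Real.exp (t * X ω)) ∂P ≤ ENNReal.ofReal M)
    (h2 : ∫⁻ ω, ENNReal.ofReal (Real.exp (-(t * X ω))) ∂P ≤ ENNReal.ofReal M) :
    ∫⁻ ω, ENNReal.ofReal (X ω ^ 2) ∂P ≤ ENNReal.ofReal (2 * M / t ^ 2) := by
  have key : ∀ u : ℝ, u ^ 2 ≤ Real.exp u + Real.exp (-u) := fun u => by
    have h1 : |u| ≤ Real.exp (|u| / 2) := by
      have h := Real.quadratic_le_exp_of_nonneg (div_nonneg (abs_nonneg u) zero_le_two)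
      nlinarith [sq_nonneg (|u| - 2)]
    have h2 : u ^ 2 ≤ Real.exp |u| := by
      rw [← sq_abs, show |u| = |u| / 2 + |u| / 2 by ring, Real.exp_add, ← sq, add_halves]
      exact pow_le_pow_left₀ (abs_nonneg u) h1 2
    rcases abs_cases u with ⟨h3, -⟩ | ⟨h3, -⟩
    · rw [h3] at h2; linarith [Real.exp_pos (-u)]
    · rw [h3] at h2; linarith [Real.exp_pos u]
  calc ∫⁻ ω, ENNReal.ofReal (X ω ^ 2) ∂P
      ≤ ∫⁻ ω, ENNReal.ofReal (1 / t ^ 2) * (ENNReal.ofReal (Real.exp (t * X ω))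
          + ENNReal.ofReal (Real.exp (-(t * X ω)))) ∂P := by
        refine lintegral_mono fun ω => ?_
        rw [← ENNReal.ofReal_add (Real.exp_pos _).le (Real.exp_pos _).le,
          ← ENNReal.ofReal_mul (by positivity)]
        refine ENNReal.ofReal_le_ofReal ?_
        have := key (t * X ω)
        rw [one_div, ← div_eq_inv_mul, le_div_iff₀ (by positivity)]
        linarith
    _ = ENNReal.ofReal (1 / t ^ 2) * (∫⁻ ω, ENNReal.ofReal (Real.exp (t * X ω)) ∂P
          + ∫⁻ ω, ENNReal.ofReal (Real.exp (-(t * X ω))) ∂P) := by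
        rw [lintegral_const_mul _ (by fun_prop), lintegral_add_left (by fun_prop)]
    _ ≤ ENNReal.ofReal (1 / t ^ 2) * (ENNReal.ofReal M + ENNReal.ofReal M) := by gcongr
    _ = _ := by
        rw [← ENNReal.ofReal_add hM hM, ← ENNReal.ofReal_mul (by positivity)]
        congr 1; ring

lemma measure_prod_le_of_sections {P' : Measure Ω'} [IsProbabilityMeasure P] [SFinite P']
    {S : Set (Ω × Ω')} (hS : MeasurableSet S) {ε : ENNReal}
    (h : ∀ ω, P' (Prod.mk ω ⁻¹' S) ≤ ε) : (P.prod P') S ≤ ε := by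
  rw [Measure.prod_apply hS]
  exact (lintegral_mono h).trans (by simp)

lemma measure_iUnion_fintype_le_card {ι : Type*} [Fintype ι] {S : ι → Set Ω} {r : ℝ}
    (h : ∀ i, P (S i) ≤ ENNReal.ofReal r) :
    P (⋃ i, S i) ≤ ENNReal.ofReal (Fintype.card ι * r) := by
  refine (measure_iUnion_fintype_le P S).trans ((Finset.sum_le_sum fun i _ => h i).trans ?_)
  rw [Finset.sum_const, Finset.card_univ, nsmul_eq_mul, ENNReal.ofReal_mul (by positivity)]
  simp

lemma lintegral_sum_le_card {ι : Type*} [Fintype ι] {X : ι → Ω → ℝ} (hX : ∀ i, Measurable (X i))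
    (h0 : ∀ i ω, 0 ≤ X i ω) {r : ℝ}
    (h : ∀ i, ∫⁻ ω, ENNReal.ofReal (X i ω) ∂P ≤ ENNReal.ofReal r) :
    ∫⁻ ω, ENNReal.ofReal (∑ i, X i ω) ∂P ≤ ENNReal.ofReal (Fintype.card ι * r) := by
  simp only [ENNReal.ofReal_sum_of_nonneg fun i _ => h0 i _]
  rw [lintegral_finsetSum _ fun i _ => by have := hX i; fun_prop]
  refine (Finset.sum_le_sum fun i _ => h i).trans ?_
  rw [Finset.sum_const, Finset.card_univ, nsmul_eq_mul, ENNReal.ofReal_mul (by positivity)]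
  simp

end Markov

/-! ### Product measures -/

section Pi

variable {ι : Type*} [Fintype ι] {X : ι → Type*} [∀ i, MeasurableSpace (X i)]
  {μ : ∀ i, Measure (X i)} [∀ i, IsProbabilityMeasure (μ i)]

lemma lintegral_pi_prod (f : ∀ i, X i → ENNReal) (hf : ∀ i, Measurable (f i)) :
    ∫⁻ x, ∏ i, f i (x i) ∂Measure.pi μ = ∏ i, ∫⁻ x, f i x ∂μ i := by
  have hind : iIndepFun (fun i (x : ∀ i, X i) => f i (x i)) (Measure.pi μ) :=
    iIndepFun_pi fun i => (hf i).aemeasurable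
  rw [lintegral_prod_eq_prod_lintegral_of_indepFun _ _ hind
    fun i => (hf i).comp (measurable_pi_apply i)]
  refine Finset.prod_congr rfl fun i _ => ?_
  exact (measurePreserving_eval μ i).lintegral_comp (hf i)

/-- Resampling one coordinate of a product measure preserves it. -/
lemma measurePreserving_update [DecidableEq ι] (j : ι) :
    MeasurePreserving (fun p : (∀ i, X i) × X j => Function.update p.1 j p.2)
      ((Measure.pi μ).prod (μ j)) (Measure.pi μ) := by
  refine ⟨measurable_update', Eq.symm (Measure.pi_eq fun s hs => ?_)⟩
  rw [Measure.map_apply measurable_update' (MeasurableSet.univ_pi hs)]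
  have : (fun p : (∀ i, X i) × X j => Function.update p.1 j p.2) ⁻¹' Set.univ.pi s
      = (Set.univ.pi (Function.update s j Set.univ)) ×ˢ s j := by
    ext ⟨x, w⟩
    simp only [Set.mem_preimage, Set.mem_univ_pi, Set.mem_prod]
    constructor
    · intro h
      refine ⟨fun i => ?_, by simpa using h j⟩
      rcases eq_or_ne i j with rfl | hi
      · simp
      · simpa [hi] using h i
    · rintro ⟨h, hw⟩ i
      rcases eq_or_ne i j with rfl | hi
      · simpa using hw
      · simpa [hi] using h i
  rw [this, Measure.prod_prod, Measure.pi_pi,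
    ← Finset.mul_prod_erase _ _ (Finset.mem_univ j),
    ← Finset.mul_prod_erase _ (fun i => μ i (s i)) (Finset.mem_univ j)]
  simp only [Function.update_self, measure_univ, one_mul]
  rw [mul_comm]
  congr 1
  refine Finset.prod_congr rfl fun i hi => ?_
  rw [Function.update_of_ne (Finset.ne_of_mem_erase hi)]

/-- To bound an event under a product measure, it suffices to bound it, for each value of the
other coordinates, under the law of one coordinate. -/
lemma measure_pi_le_of_update [DecidableEq ι] (j : ι) {S : Set (∀ i, X i)} (hS : MeasurableSet S)
    {ε : ENNReal} (h : ∀ x, μ j {w | Function.update x j w ∈ S} ≤ ε) : Measure.pi μ S ≤ ε := by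
  rw [← (measurePreserving_update (μ := μ) j).measure_preimage hS.nullMeasurableSet]
  exact measure_prod_le_of_sections (measurable_update' hS) h

end Pi

/-! ### Gaussian vectors -/

lemma lintegral_exp_mul_gaussian (t : ℝ) :
    ∫⁻ x, ENNReal.ofReal (Real.exp (t * x)) ∂gaussianReal 0 1
      = ENNReal.ofReal (Real.exp (t ^ 2 / 2)) := by
  rw [← ofReal_integral_eq_lintegral_ofReal (integrable_exp_mul_gaussianReal t)
    (ae_of_all _ fun _ => (Real.exp_pos _).le)]
  have := congrFun (mgf_id_gaussianReal (μ := 0) (v := 1)) t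
  simp only [mgf, id] at this
  rw [this]
  simp

/-- Tilting by `exp (x ^ 2 / 4)` turns the variance `1` into `2`, up to the factor `√2`. -/
lemma lintegral_exp_sq_gaussian :
    ∫⁻ x, ENNReal.ofReal (Real.exp (x ^ 2 / 4)) ∂gaussianReal 0 1 = ENNReal.ofReal (√2) := by
  rw [gaussianReal_of_var_ne_zero _ one_ne_zero,
    lintegral_withDensity_eq_lintegral_mul _ (measurable_gaussianPDF _ _) (by fun_prop)]
  have : ∀ x : ℝ, (gaussianPDF 0 1 * fun x => ENNReal.ofReal (Real.exp (x ^ 2 / 4))) x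
      = ENNReal.ofReal (√2) * gaussianPDF 0 2 x := fun x => by
    rw [Pi.mul_apply, gaussianPDF, gaussianPDF, ← ENNReal.ofReal_mul (gaussianPDFReal_nonneg _ _ _),
      ← ENNReal.ofReal_mul (by positivity)]
    congr 1
    simp only [gaussianPDFReal, NNReal.coe_one, NNReal.coe_ofNat, sub_zero, mul_one]
    rw [show 2 * Real.pi * 2 = 2 * (2 * Real.pi) by ring, Real.sqrt_mul (by norm_num) (2 * Real.pi),
      mul_assoc, ← Real.exp_add]
    have h2 : √2 ≠ 0 := by positivity
    have h3 : √(2 * Real.pi) ≠ 0 := by positivity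
    field_simp
    congr 1
    ring
  simp only [this]
  rw [lintegral_const_mul _ (measurable_gaussianPDF _ _),
    lintegral_gaussianPDF_eq_one _ two_ne_zero, mul_one]

lemma lintegral_exp_linear_gaussian {κ : Type*} [Fintype κ] (c : κ → ℝ) :
    ∫⁻ x : κ → ℝ, ENNReal.ofReal (Real.exp (∑ k, c k * x k))
      ∂(Measure.pi fun _ => gaussianReal 0 1)
      = ENNReal.ofReal (Real.exp (∑ k, c k ^ 2 / 2)) := by
  simp only [Real.exp_sum, ENNReal.ofReal_prod_of_nonneg fun _ _ => (Real.exp_pos _).le]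
  rw [lintegral_pi_prod (fun k x => ENNReal.ofReal (Real.exp (c k * x))) fun k => by fun_prop]
  simp only [lintegral_exp_mul_gaussian]

lemma lintegral_exp_sq_norm_gaussian {κ : Type*} [Fintype κ] :
    ∫⁻ x : κ → ℝ, ENNReal.ofReal (Real.exp (∑ k, x k ^ 2 / 4))
      ∂(Measure.pi fun _ => gaussianReal 0 1)
      ≤ ENNReal.ofReal (Real.exp (Fintype.card κ / 2)) := by
  simp only [Real.exp_sum, ENNReal.ofReal_prod_of_nonneg fun _ _ => (Real.exp_pos _).le]
  rw [lintegral_pi_prod (fun _ x => ENNReal.ofReal (Real.exp (x ^ 2 / 4))) fun k => by fun_prop]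
  simp only [lintegral_exp_sq_gaussian]
  rw [← ENNReal.ofReal_prod_of_nonneg fun _ _ => Real.sqrt_nonneg _]
  refine ENNReal.ofReal_le_ofReal ?_
  rw [Finset.prod_const, Finset.card_univ]
  have h : √2 ≤ Real.exp (1 / 2) := by
    rw [Real.sqrt_le_left (Real.exp_pos _).le, ← Real.exp_nat_mul]
    have := Real.add_one_le_exp 1
    norm_num at this ⊢
    linarith
  calc √2 ^ Fintype.card κ ≤ Real.exp (1 / 2) ^ Fintype.card κ :=
        pow_le_pow_left₀ (Real.sqrt_nonneg _) h _
    _ = _ := by rw [← Real.exp_nat_mul]; congr 1; ring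

instance (V : Type*) [Fintype V] (d : ℕ) : IsProbabilityMeasure (noiseLaw V d) := by
  unfold noiseLaw; infer_instance

lemma lintegral_exp_linear_noise {V : Type*} [Fintype V] {d : ℕ} (c : V → Fin d → ℝ) :
    ∫⁻ Z, ENNReal.ofReal (Real.exp (∑ i, ∑ k, c i k * Z i k)) ∂noiseLaw V d
      = ENNReal.ofReal (Real.exp (∑ i, ∑ k, c i k ^ 2 / 2)) := by
  rw [Real.exp_sum, ENNReal.ofReal_prod_of_nonneg fun _ _ => (Real.exp_pos _).le]
  have : ∀ Z : V → Fin d → ℝ, ENNReal.ofReal (Real.exp (∑ i, ∑ k, c i k * Z i k))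
      = ∏ i, ENNReal.ofReal (Real.exp (∑ k, c i k * Z i k)) := fun Z => by
    rw [Real.exp_sum, ENNReal.ofReal_prod_of_nonneg fun _ _ => (Real.exp_pos _).le]
  simp only [this]
  rw [noiseLaw, lintegral_pi_prod
    (fun i (z : Fin d → ℝ) => ENNReal.ofReal (Real.exp (∑ k, c i k * z k))) fun i => by fun_prop]
  simp only [lintegral_exp_linear_gaussian]

/-- A linear form in the noise has second moment at most `4` times its squared coefficients. -/
lemma lintegral_sq_linear_noise {V : Type*} [Fintype V] {d : ℕ} (c : V → Fin d → ℝ) {s : ℝ}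
    (hs : 0 < s) (hc : ∑ i, ∑ k, c i k ^ 2 ≤ s) :
    ∫⁻ Z, ENNReal.ofReal ((∑ i, ∑ k, c i k * Z i k) ^ 2) ∂noiseLaw V d
      ≤ ENNReal.ofReal (4 * s) := by
  have ht : 0 < 1 / √s := by positivity
  have hexp : Real.exp (1 / 2) ≤ 2 := by
    have h := Real.exp_one_lt_d9
    have : Real.exp (1 / 2) ^ 2 = Real.exp 1 := by rw [← Real.exp_nat_mul]; norm_num
    nlinarith [Real.exp_pos (1 / 2)]
  have key : ∀ ε : ℝ, ε ^ 2 = 1 → ∫⁻ Z, ENNReal.ofReal (Real.exp (∑ i, ∑ k,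
      (ε * (1 / √s) * c i k) * Z i k)) ∂noiseLaw V d ≤ ENNReal.ofReal 2 := fun ε hε => by
    rw [lintegral_exp_linear_noise]
    refine ENNReal.ofReal_le_ofReal (le_trans (Real.exp_le_exp.2 ?_) hexp)
    have : ∀ i k, (ε * (1 / √s) * c i k) ^ 2 / 2 = 1 / (2 * s) * c i k ^ 2 := fun i k => by
      rw [mul_pow, mul_pow, hε, div_pow, Real.sq_sqrt hs.le]; ring
    simp only [this, ← Finset.mul_sum]
    calc _ ≤ 1 / (2 * s) * s := mul_le_mul_of_nonneg_left hc (by positivity)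
      _ = 1 / 2 := by field_simp
  refine (lintegral_sq_le_of_exp (M := 2) (by fun_prop) ht (by norm_num) ?_ ?_).trans
    (ENNReal.ofReal_le_ofReal ?_)
  · convert key 1 (by norm_num) using 6 with Z
    simp only [Finset.mul_sum]
    exact Finset.sum_congr rfl fun i _ => Finset.sum_congr rfl fun k _ => by ring
  · convert key (-1) (by norm_num) using 6 with Z
    simp only [Finset.mul_sum, ← Finset.sum_neg_distrib]
    exact Finset.sum_congr rfl fun i _ => Finset.sum_congr rfl fun k _ => by ring
  · rw [div_pow, Real.sq_sqrt hs.le]; field_simp; norm_num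

/-- Gaussian tail of a linear form, in a form that is meaningful for `e = 0` as well. -/
lemma gaussian_linear_tail {κ : Type*} [Fintype κ] (e : κ → ℝ) {t : ℝ} (ht : 0 ≤ t) :
    (Measure.pi fun _ : κ => gaussianReal 0 1)
      {w | 2 * t * ∑ k, e k ^ 2 < (∑ k, e k * w k) ^ 2} ≤ ENNReal.ofReal (2 * Real.exp (-t)) := by
  set Q := ∑ k, e k ^ 2 with hQ
  have hQ0 : 0 ≤ Q := Finset.sum_nonneg fun _ _ => sq_nonneg _
  rcases hQ0.eq_or_lt with h0 | hpos
  · have he : ∀ k, e k = 0 := fun k => by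
      have := (Finset.sum_eq_zero_iff_of_nonneg (fun k _ => sq_nonneg (e k))).1 h0.symm k
        (Finset.mem_univ k)
      simpa using this
    simp [he, ← h0]
  -- Chernoff at the optimal slope `√(2 t / Q)`, for both signs
  set a := √(2 * t / Q) with ha
  have ha2 : a ^ 2 = 2 * t / Q := Real.sq_sqrt (by positivity)
  have key : ∀ ε : ℝ, ε ^ 2 = 1 → (Measure.pi fun _ : κ => gaussianReal 0 1)
      {w | 2 * t ≤ ∑ k, (ε * a * e k) * w k} ≤ ENNReal.ofReal (Real.exp (-t)) := fun ε hε => by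
    have h1 := (lintegral_exp_linear_gaussian (fun k => ε * a * e k)).le
    refine (measure_le_le_of_lintegral_exp_le (t := 2 * t) (by fun_prop) h1).trans
      (le_of_eq ?_)
    have : ∀ k, (ε * a * e k) ^ 2 / 2 = t / Q * e k ^ 2 := fun k => by
      rw [mul_pow, mul_pow, hε, ha2]; ring
    simp only [this, ← Finset.mul_sum, ← hQ]
    rw [div_mul_cancel₀ _ hpos.ne']
    congr 2; ring
  have hsub : {w : κ → ℝ | 2 * t * Q < (∑ k, e k * w k) ^ 2} ⊆
      {w | 2 * t ≤ ∑ k, (1 * a * e k) * w k} ∪ {w | 2 * t ≤ ∑ k, (-1 * a * e k) * w k} := by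
    intro w hw
    simp only [Set.mem_ofPred_eq, Set.mem_union] at hw ⊢
    have h1 : ∀ ε : ℝ, ∑ k, (ε * a * e k) * w k = ε * (a * ∑ k, e k * w k) := fun ε => by
      rw [Finset.mul_sum, Finset.mul_sum]; exact Finset.sum_congr rfl fun k _ => by ring
    rw [h1, h1]
    have h2 : (2 * t) ^ 2 ≤ (a * ∑ k, e k * w k) ^ 2 := by
      rw [mul_pow a, ha2, div_mul_eq_mul_div, le_div_iff₀ hpos]
      nlinarith
    have h3 := sq_le_sq.1 h2
    rw [abs_of_nonneg (by positivity : 0 ≤ 2 * t)] at h3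
    rcases le_abs.1 h3 with h | h
    · left; linarith
    · right; linarith
  refine (measure_mono hsub).trans ((measure_union_le _ _).trans ?_)
  refine (add_le_add (key 1 (by norm_num)) (key (-1) (by norm_num))).trans ?_
  rw [← ENNReal.ofReal_add (Real.exp_pos _).le (Real.exp_pos _).le]
  exact ENNReal.ofReal_le_ofReal (by linarith)

/-! ### The stochastic block model: exponential moments of a row -/

section SBM

/-- Balanced labels: entries `±1` with sum `0`. -/
def IsBalanced {V : Type*} [Fintype V] (y : V → ℝ) : Prop :=
  (∀ i, y i = 1 ∨ y i = -1) ∧ ∑ i, y i = 0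

lemma IsBalanced.sq_eq_one {V : Type*} [Fintype V] {y : V → ℝ} (hy : IsBalanced y) (i : V) :
    y i ^ 2 = 1 := by
  rcases hy.1 i with h | h <;> simp [h]

lemma measurable_adjOfCoins {V : Type*} : Measurable (adjOfCoins : (Sym2 V → ℝ) → V → V → ℝ) := by
  refine measurable_pi_iff.2 fun i => measurable_pi_iff.2 fun j => ?_
  unfold adjOfCoins
  by_cases h : i = j
  · simp [h]
  · simp only [h, if_false]; fun_prop

variable {V : Type*} [Fintype V] [DecidableEq V]

instance (y : V → ℝ) (α β : unitInterval) : IsProbabilityMeasure (sbmLaw y α β) :=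
  Measure.isProbabilityMeasure_map measurable_adjOfCoins.aemeasurable

/-- The properties of an adjacency matrix that hold almost surely. -/
structure IsAdjacency {V : Type*} (A : V → V → ℝ) : Prop where
  zero_or_one : ∀ i j, A i j = 0 ∨ A i j = 1
  symm : ∀ i j, A i j = A j i
  diag : ∀ i, A i i = 0

lemma ae_isAdjacency (y : V → ℝ) (α β : unitInterval) :
    ∀ᵐ A ∂sbmLaw y α β, IsAdjacency A := by
  have hmeas : MeasurableSet {A : V → V → ℝ | IsAdjacency A} := by
    have : {A : V → V → ℝ | IsAdjacency A} = (⋂ i, ⋂ j, {A | A i j = 0} ∪ {A | A i j = 1}) ∩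
        (⋂ i, ⋂ j, {A | A i j = A j i}) ∩ ⋂ i, {A | A i i = 0} := by
      ext A
      simp only [Set.mem_inter_iff, Set.mem_iInter, Set.mem_union, Set.mem_ofPred_eq]
      exact ⟨fun h => ⟨⟨h.1, h.2⟩, h.3⟩, fun h => ⟨h.1.1, h.1.2, h.2⟩⟩
    rw [this]
    refine ((MeasurableSet.iInter fun i => MeasurableSet.iInter fun j => ?_).inter
      (MeasurableSet.iInter fun i => MeasurableSet.iInter fun j => ?_)).inter
      (MeasurableSet.iInter fun i => ?_)
    · exact (measurableSet_eq_fun (by fun_prop) measurable_const).union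
        (measurableSet_eq_fun (by fun_prop) measurable_const)
    · exact measurableSet_eq_fun (by fun_prop) (by fun_prop)
    · exact measurableSet_eq_fun (by fun_prop) measurable_const
  rw [sbmLaw, ae_map_iff measurable_adjOfCoins.aemeasurable hmeas]
  have hcoin : ∀ e : Sym2 V, ∀ᵐ w ∂(Measure.pi fun e : Sym2 V =>
      bernoulliMeasure (1 : ℝ) 0 (edgeProb y α β e)), w e = 0 ∨ w e = 1 := fun e => by
    refine (measurePreserving_eval (fun e : Sym2 V =>
      bernoulliMeasure (1 : ℝ) 0 (edgeProb y α β e)) e).quasiMeasurePreserving.ae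
      (p := fun x => x = 0 ∨ x = 1) ?_
    rw [ae_iff]
    refine bernoulliMeasure_apply_of_notMem_of_notMem _ ?_ (by simp) (by simp)
    exact ((measurableSet_singleton (0 : ℝ)).union (measurableSet_singleton 1)).compl
  filter_upwards [ae_all_iff.2 hcoin] with w hw
  refine ⟨fun i j => ?_, fun i j => ?_, fun i => by simp [adjOfCoins]⟩
  · by_cases h : i = j
    · simp [adjOfCoins, h]
    · simpa [adjOfCoins, h] using hw s(i, j)
  · simp [adjOfCoins, eq_comm (a := i), Sym2.eq_swap (a := i)]

lemma lintegral_bernoulli (p : unitInterval) {f : ℝ → ENNReal} (hf : Measurable f) :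
    ∫⁻ x, f x ∂bernoulliMeasure (1 : ℝ) 0 p
      = ENNReal.ofReal p * f 1 + ENNReal.ofReal (1 - p) * f 0 := by
  rw [bernoulliMeasure_def, lintegral_add_measure, lintegral_smul_measure, lintegral_smul_measure,
    lintegral_dirac' _ hf, lintegral_dirac' _ hf, ENNReal.smul_def, ENNReal.smul_def,
    smul_eq_mul, smul_eq_mul]
  have h : ∀ r : unitInterval, ((unitInterval.toNNReal r : NNReal) : ENNReal)
      = ENNReal.ofReal r := fun r => by
    rw [← ENNReal.ofReal_coe_nnreal, unitInterval.coe_toNNReal]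
  rw [h, h, unitInterval.coe_symm_eq]

/-- The entries of a row of the adjacency matrix are independent Bernoulli variables. -/
lemma lintegral_exp_row_le (y : V → ℝ) (α β : unitInterval) (i : V) (t : V → ℝ) :
    ∫⁻ A, ENNReal.ofReal (Real.exp (∑ j, t j * A i j)) ∂sbmLaw y α β
      ≤ ENNReal.ofReal (Real.exp (∑ j ∈ Finset.univ.erase i,
          (edgeProb y α β s(i, j) : ℝ) * (Real.exp (t j) - 1))) := by
  have hinj : Function.Injective fun j : {j // j ≠ i} => s(i, (j : V)) := fun j k h => by
    have := Sym2.congr_right.1 h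
    exact Subtype.ext this
  have hind : iIndepFun (fun (j : {j // j ≠ i}) (w : Sym2 V → ℝ) =>
      ENNReal.ofReal (Real.exp (t j * w s(i, (j : V)))))
      (Measure.pi fun e : Sym2 V => bernoulliMeasure (1 : ℝ) 0 (edgeProb y α β e)) := by
    have h1 : iIndepFun (fun (e : Sym2 V) (w : Sym2 V → ℝ) => w e)
        (Measure.pi fun e : Sym2 V => bernoulliMeasure (1 : ℝ) 0 (edgeProb y α β e)) :=
      iIndepFun_pi (X := fun _ => id) fun _ => aemeasurable_id
    exact (h1.precomp hinj).comp (fun j x => ENNReal.ofReal (Real.exp (t j * x)))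
      fun j => by fun_prop
  rw [sbmLaw, lintegral_map (by fun_prop) measurable_adjOfCoins]
  have hsum : ∀ w : Sym2 V → ℝ, ENNReal.ofReal (Real.exp (∑ j, t j * adjOfCoins w i j))
      = ∏ j : {j // j ≠ i}, ENNReal.ofReal (Real.exp (t j * w s(i, (j : V)))) := fun w => by
    rw [← ENNReal.ofReal_prod_of_nonneg fun _ _ => (Real.exp_pos _).le, ← Real.exp_sum]
    congr 2
    rw [← Finset.add_sum_erase _ _ (Finset.mem_univ i), Finset.sum_subtype (p := fun j => j ≠ i) _
      (by simp)]
    simp only [adjOfCoins, if_true, mul_zero, zero_add]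
    exact Finset.sum_congr rfl fun j _ => by rw [if_neg j.2.symm]
  simp only [hsum]
  rw [lintegral_prod_eq_prod_lintegral_of_indepFun _ _ hind fun j => by fun_prop,
    Finset.sum_subtype (p := fun j => j ≠ i) _ (by simp), Real.exp_sum,
    ENNReal.ofReal_prod_of_nonneg fun _ _ => (Real.exp_pos _).le]
  refine Finset.prod_le_prod' fun j _ => ?_
  have h2 := (measurePreserving_eval (fun e : Sym2 V => bernoulliMeasure (1 : ℝ) 0
    (edgeProb y α β e)) s(i, (j : V))).lintegral_comp
    (f := fun x => ENNReal.ofReal (Real.exp (t j * x))) (by fun_prop)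
  simp only [Function.eval] at h2
  rw [h2, lintegral_bernoulli _ (by fun_prop)]
  set p := edgeProb y α β s(i, (j : V))
  have hp0 : (0 : ℝ) ≤ p := p.2.1
  have hp1 : (0 : ℝ) ≤ 1 - p := by linarith [p.2.2]
  rw [← ENNReal.ofReal_mul hp0, ← ENNReal.ofReal_mul hp1,
    ← ENNReal.ofReal_add (by positivity) (by positivity)]
  refine ENNReal.ofReal_le_ofReal ?_
  have := Real.add_one_le_exp ((p : ℝ) * (Real.exp (t j) - 1))
  simp only [mul_one, mul_zero, Real.exp_zero]
  linarith

/-- Each vertex of a balanced labelling sees `N / 2` vertices, itself included, with its own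
label, and `N / 2` with the opposite one. -/
lemma sum_edgeProb_mul {y : V → ℝ} (hy : IsBalanced y) (α β : unitInterval) (i : V) (φ : ℝ → ℝ) :
    ∑ j ∈ Finset.univ.erase i, (edgeProb y α β s(i, j) : ℝ) * φ (y i * y j)
      = (Fintype.card V : ℝ) / 2 * (α * φ 1 + β * φ (-1)) - α * φ 1 := by
  have h1 : ∀ j, (edgeProb y α β s(i, j) : ℝ) * φ (y i * y j)
      = (α * φ 1 + β * φ (-1)) / 2 + (α * φ 1 - β * φ (-1)) / 2 * y i * y j := fun j => by
    have he : (edgeProb y α β s(i, j)) = if y i = y j then α else β := by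
      simp [edgeProb]
    rw [he]
    rcases hy.1 i with h | h <;> rcases hy.1 j with h' | h' <;> norm_num [h, h'] <;> ring
  have h2 := Finset.add_sum_erase Finset.univ
    (fun j => (edgeProb y α β s(i, j) : ℝ) * φ (y i * y j)) (Finset.mem_univ i)
  have h3 : (edgeProb y α β s(i, i) : ℝ) * φ (y i * y i) = α * φ 1 := by
    rw [← sq, hy.sq_eq_one]; simp [edgeProb]
  rw [← eq_sub_iff_add_eq'] at h2
  rw [h2, h3]
  simp only [h1]
  rw [Finset.sum_add_distrib, ← Finset.mul_sum, hy.2, Finset.sum_const, Finset.card_univ]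
  simp only [nsmul_eq_mul]
  ring

variable {y : V → ℝ} {α β : unitInterval} {A B q : ℝ}

/-- The exponential moments of the statistics `∑ j, φ (y i * y j) * A i j`. The additive `1` pays
for the missing diagonal entry. -/
lemma lintegral_exp_row_balanced_le (hy : IsBalanced y)
    (hα : (Fintype.card V : ℝ) * α = q * A) (hβ : (Fintype.card V : ℝ) * β = q * B)
    (i : V) (φ : ℝ → ℝ) :
    ∫⁻ M, ENNReal.ofReal (Real.exp (∑ j, φ (y i * y j) * M i j)) ∂sbmLaw y α β
      ≤ ENNReal.ofReal (Real.exp (q * (A / 2 * (Real.exp (φ 1) - 1)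
          + B / 2 * (Real.exp (φ (-1)) - 1)) + 1)) := by
  refine (lintegral_exp_row_le y α β i fun j => φ (y i * y j)).trans
    (ENNReal.ofReal_le_ofReal (Real.exp_le_exp.2 ?_))
  rw [sum_edgeProb_mul hy α β i fun v => Real.exp (φ v) - 1]
  have h1 : (Fintype.card V : ℝ) / 2 * (α * (Real.exp (φ 1) - 1) + β * (Real.exp (φ (-1)) - 1))
      = q * (A / 2 * (Real.exp (φ 1) - 1) + B / 2 * (Real.exp (φ (-1)) - 1)) := by
    linear_combination ((Real.exp (φ 1) - 1) / 2) * hα + ((Real.exp (φ (-1)) - 1) / 2) * hβ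
  rw [h1]
  have : (0 : ℝ) ≤ α * Real.exp (φ 1) := mul_nonneg α.2.1 (Real.exp_pos _).le
  linarith [α.2.2]

/-- Chernoff bound for the degrees. The excess `3 q` is large enough for a union bound, since `N` is
at most about `exp q` in the regime of interest. -/
lemma measure_degree_gt_le (hy : IsBalanced y) (hA : 0 ≤ A) (hB : 0 ≤ B) (hq : 0 ≤ q)
    (hα : (Fintype.card V : ℝ) * α = q * A) (hβ : (Fintype.card V : ℝ) * β = q * B) :
    sbmLaw y α β (⋃ i, {M | (A + B + 3) * q ≤ ∑ j, M i j})
      ≤ ENNReal.ofReal (Fintype.card V * Real.exp (1 - 3 * q)) := by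
  refine measure_iUnion_fintype_le_card fun i => ?_
  have h := lintegral_exp_row_balanced_le hy hα hβ i fun _ => 1
  simp only [one_mul] at h
  refine (measure_le_le_of_lintegral_exp_le (by fun_prop) h).trans
    (ENNReal.ofReal_le_ofReal (Real.exp_le_exp.2 ?_))
  have he : Real.exp 1 - 1 ≤ 2 := by linarith [Real.exp_one_lt_d9]
  have : q * (A / 2 * (Real.exp 1 - 1) + B / 2 * (Real.exp 1 - 1)) ≤ q * (A + B) := by
    refine mul_le_mul_of_nonneg_left ?_ hq
    nlinarith
  linarith

/-- Concentration in mean square of the row statistics `∑ j, ψ (y i * y j) * A i j`; the cases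
`ψ = 1` and `ψ = id` are the degrees and the signed degrees. -/
lemma measure_row_deviation_le (hy : IsBalanced y) (hA : 0 ≤ A) (hB : 0 ≤ B) (hq : 1 ≤ q)
    (hα : (Fintype.card V : ℝ) * α = q * A) (hβ : (Fintype.card V : ℝ) * β = q * B)
    {ψ : ℝ → ℝ} (h1 : |ψ 1| ≤ 1) (h2 : |ψ (-1)| ≤ 1) {η : ℝ} (hη : 0 < η)
    (hN : 0 < (Fintype.card V : ℝ)) :
    sbmLaw y α β {M | η ^ 2 * Fintype.card V * q ^ 2 <
        ∑ i, (∑ j, ψ (y i * y j) * M i j - q * (A / 2 * ψ 1 + B / 2 * ψ (-1))) ^ 2}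
      ≤ ENNReal.ofReal (2 * Real.exp (A + B + 1) / (η ^ 2 * q)) := by
  have hq0 : 0 < q := by linarith
  set m := q * (A / 2 * ψ 1 + B / 2 * ψ (-1)) with hm
  -- at the slopes `± 1 / √q` the centred exponential moments stay bounded
  set t := 1 / √q with ht
  have hs : 1 ≤ √q := Real.one_le_sqrt.2 hq
  have ht0 : 0 < t := by positivity
  have ht1 : t ≤ 1 := by rw [ht, div_le_one (by linarith)]; exact hs
  have ht2 : t ^ 2 = 1 / q := by rw [ht, div_pow, Real.sq_sqrt hq0.le, one_pow]
  have hbound : ∀ ε v : ℝ, |ε| = 1 → |v| ≤ 1 →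
      Real.exp (ε * t * v) - 1 - ε * t * v ≤ t ^ 2 := fun ε v hε hv => by
    have habs : |ε * t * v| ≤ t := by
      rw [abs_mul, abs_mul, hε, abs_of_pos ht0, one_mul]
      exact mul_le_of_le_one_right ht0.le hv
    refine ((le_abs_self _).trans (Real.abs_exp_sub_one_sub_id_le (habs.trans ht1))).trans ?_
    exact sq_le_sq.2 (habs.trans (le_abs_self t))
  have hmgf : ∀ i, ∀ ε : ℝ, |ε| = 1 → ∫⁻ M, ENNReal.ofReal (Real.exp
      (ε * t * (∑ j, ψ (y i * y j) * M i j - m))) ∂sbmLaw y α β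
      ≤ ENNReal.ofReal (Real.exp (A + B + 1)) := fun i ε hε => by
    have h := lintegral_exp_row_balanced_le hy hα hβ i fun v => ε * t * ψ v
    have e1 : ∀ M : V → V → ℝ, ENNReal.ofReal (Real.exp
        (ε * t * (∑ j, ψ (y i * y j) * M i j - m)))
        = ENNReal.ofReal (Real.exp (-(ε * t * m)))
          * ENNReal.ofReal (Real.exp (∑ j, ε * t * ψ (y i * y j) * M i j)) := fun M => by
      rw [← ENNReal.ofReal_mul (Real.exp_pos _).le, ← Real.exp_add]
      congr 2
      rw [mul_sub, Finset.mul_sum]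
      simp only [mul_assoc]
      ring
    simp only [e1]
    rw [lintegral_const_mul _ (by fun_prop)]
    refine (mul_le_mul_right h _).trans ?_
    rw [← ENNReal.ofReal_mul (Real.exp_pos _).le, ← Real.exp_add]
    refine ENNReal.ofReal_le_ofReal (Real.exp_le_exp.2 ?_)
    have b1 := mul_le_mul_of_nonneg_left (hbound ε (ψ 1) hε h1) (by positivity : 0 ≤ q * (A / 2))
    have b2 := mul_le_mul_of_nonneg_left (hbound ε (ψ (-1)) hε h2)
      (by positivity : 0 ≤ q * (B / 2))
    have b3 : q * (A / 2) * t ^ 2 + q * (B / 2) * t ^ 2 = (A + B) / 2 := by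
      rw [ht2]; field_simp
    rw [hm]
    nlinarith
  have hsq : ∀ i, ∫⁻ M, ENNReal.ofReal ((∑ j, ψ (y i * y j) * M i j - m) ^ 2) ∂sbmLaw y α β
      ≤ ENNReal.ofReal (2 * Real.exp (A + B + 1) * q) := fun i => by
    refine (lintegral_sq_le_of_exp (by fun_prop) ht0 (Real.exp_pos _).le
      (by simpa using hmgf i 1 (by simp)) (by simpa using hmgf i (-1) (by simp))).trans
      (le_of_eq ?_)
    rw [ht2]; congr 1; field_simp
  refine (measure_lt_le_of_lintegral_le (by fun_prop) (by positivity)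
    (lintegral_sum_le_card (fun i => by fun_prop) (fun i M => sq_nonneg _) hsq)).trans
    (le_of_eq ?_)
  congr 1
  field_simp

end SBM

/-! ### Large deviations of the score of a vertex -/

section Score

lemma selfLoop_apply {V : Type*} [DecidableEq V] (A : V → V → ℝ) (ρ : ℝ) (i j : V) :
    selfLoop A ρ i j = A i j + if i = j then ρ else 0 := by
  simp [selfLoop, Matrix.one_apply]

variable {V : Type*} [Fintype V] [DecidableEq V]

/-- The signed score `y_i (θ (A_ρ y)_i + (A_ρ Z μ)_i)` of the vertex `i`. -/
noncomputable def score {d : ℕ} (θ ρ : ℝ) (y : V → ℝ) (A : V → V → ℝ) (μ : USphere d)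
    (Z : V → Fin d → ℝ) (i : V) : ℝ :=
  y i * (θ * ∑ j, selfLoop A ρ i j * y j
    + ∑ j, selfLoop A ρ i j * ∑ k, (μ : EuclideanSpace ℝ (Fin d)) k * Z j k)

lemma sum_sphere_sq {d : ℕ} (μ : USphere d) :
    ∑ k, (μ : EuclideanSpace ℝ (Fin d)) k ^ 2 = 1 := by
  have h := EuclideanSpace.real_norm_sq_eq (μ : EuclideanSpace ℝ (Fin d))
  rw [norm_eq_of_mem_sphere] at h
  linarith

@[fun_prop]
lemma measurable_sphere_coord {d : ℕ} (k : Fin d) :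
    Measurable fun μ : USphere d => (μ : EuclideanSpace ℝ (Fin d)) k :=
  ((EuclideanSpace.proj k : EuclideanSpace ℝ (Fin d) →L[ℝ] ℝ).continuous.measurable).comp
    measurable_subtype_coe

@[fun_prop]
lemma measurable_selfLoop {V : Type*} [DecidableEq V] (ρ : ℝ) (i j : V) :
    Measurable fun A : V → V → ℝ => selfLoop A ρ i j := by
  simp only [selfLoop_apply]; fun_prop

lemma measurable_score {d : ℕ} (θ ρ : ℝ) (y : V → ℝ) (i : V) :
    Measurable fun ω : (V → V → ℝ) × USphere d × (V → Fin d → ℝ) =>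
      score θ ρ y ω.1 ω.2.1 ω.2.2 i := by
  have h : ∀ j, Measurable fun A : V → V → ℝ => selfLoop A ρ i j := measurable_selfLoop ρ i
  have h' : ∀ k, Measurable fun μ : USphere d => (μ : EuclideanSpace ℝ (Fin d)) k :=
    measurable_sphere_coord
  unfold score
  refine Measurable.const_mul (Measurable.add (Measurable.const_mul ?_ _) ?_) _
  · exact Finset.measurable_sum _ fun j _ => ((h j).comp measurable_fst).mul_const _
  · refine Finset.measurable_sum _ fun j _ => ((h j).comp measurable_fst).mul ?_
    refine Finset.measurable_sum _ fun k _ =>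
      ((h' k).comp (measurable_fst.comp measurable_snd)).mul ?_
    exact (measurable_pi_apply k).comp ((measurable_pi_apply j).comp
      (measurable_snd.comp measurable_snd))

/-- Integrating out the noise. Since `A i j ^ 2 = A i j`, the result is again the exponential of a
row statistic, up to the contribution of the self-loop. -/
lemma lintegral_exp_score_noise {d : ℕ} {θ : ℝ} (hθ : θ ≠ 0) (ρ x : ℝ) {y : V → ℝ}
    (hy : IsBalanced y) {A : V → V → ℝ} (hA : IsAdjacency A) (μ : USphere d) (i : V) :
    ∫⁻ Z, ENNReal.ofReal (Real.exp (x / θ * score θ ρ y A μ Z i)) ∂noiseLaw V d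
      = ENNReal.ofReal (Real.exp (x * ρ + x ^ 2 / (2 * θ ^ 2) * ρ ^ 2
        + ∑ j, (x * (y i * y j) + x ^ 2 / (2 * θ ^ 2)) * A i j)) := by
  have e1 : ∀ Z : V → Fin d → ℝ, x / θ * score θ ρ y A μ Z i
      = x * (y i * ∑ j, selfLoop A ρ i j * y j) + ∑ j, ∑ k,
        (x / θ * y i * selfLoop A ρ i j * (μ : EuclideanSpace ℝ (Fin d)) k) * Z j k := fun Z => by
    unfold score
    simp only [Finset.mul_sum, mul_add]
    congr 1
    · exact Finset.sum_congr rfl fun j _ => by field_simp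
    · exact Finset.sum_congr rfl fun j _ => Finset.sum_congr rfl fun k _ => by ring
  simp only [e1, Real.exp_add (x * (y i * ∑ j, selfLoop A ρ i j * y j)),
    ENNReal.ofReal_mul (Real.exp_pos (x * (y i * ∑ j, selfLoop A ρ i j * y j))).le]
  rw [lintegral_const_mul _ (by fun_prop), lintegral_exp_linear_noise,
    ← ENNReal.ofReal_mul (Real.exp_pos _).le, ← Real.exp_add]
  congr 2
  have e2 : ∀ j, ∑ k, (x / θ * y i * selfLoop A ρ i j
      * (μ : EuclideanSpace ℝ (Fin d)) k) ^ 2 / 2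
      = x ^ 2 / (2 * θ ^ 2) * (A i j + if i = j then ρ ^ 2 else 0) := fun j => by
    have : ∀ k, (x / θ * y i * selfLoop A ρ i j * (μ : EuclideanSpace ℝ (Fin d)) k) ^ 2 / 2
        = x ^ 2 / (2 * θ ^ 2) * selfLoop A ρ i j ^ 2
          * (μ : EuclideanSpace ℝ (Fin d)) k ^ 2 := fun k => by
      rw [mul_pow, mul_pow, mul_pow, hy.sq_eq_one, div_pow]; field_simp
    simp only [this]
    rw [← Finset.mul_sum, sum_sphere_sq, mul_one, selfLoop_apply]
    congr 1
    by_cases hij : i = j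
    · subst hij; simp [hA.diag]
    · rcases hA.zero_or_one i j with h | h <;> simp [h, hij]
  simp only [e2]
  simp only [selfLoop_apply, add_mul, mul_add, Finset.sum_add_distrib, Finset.mul_sum,
    ite_mul, zero_mul, mul_ite, mul_zero, Finset.sum_ite_eq, Finset.mem_univ, if_true]
  have e3 : x * (y i * (ρ * y i)) = x * ρ := by
    linear_combination (x * ρ) * hy.sq_eq_one i
  rw [e3]
  have e4 : ∀ j, x * (y i * (A i j * y j)) = x * (y i * y j) * A i j := fun j => by ring
  simp only [e4]
  ring

/-- Chernoff bound for the score of one vertex. -/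
lemma measure_score_le {d : ℕ} [IsProbabilityMeasure (sphereLaw d)] {θ : ℝ} (hθ : 0 < θ) (ρ x : ℝ)
    {y : V → ℝ} (hy : IsBalanced y) {α β : unitInterval} {A B q : ℝ}
    (hα : (Fintype.card V : ℝ) * α = q * A) (hβ : (Fintype.card V : ℝ) * β = q * B)
    (i : V) (ε : ℝ) :
    (sbmLaw y α β).prod ((sphereLaw d).prod (noiseLaw V d))
      {ω | -(ε * q) ≤ x / θ * score θ ρ y ω.1 ω.2.1 ω.2.2 i}
      ≤ ENNReal.ofReal (Real.exp (x * ρ + x ^ 2 / (2 * θ ^ 2) * ρ ^ 2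
        + (q * (A / 2 * (Real.exp (x + x ^ 2 / (2 * θ ^ 2)) - 1)
          + B / 2 * (Real.exp (-x + x ^ 2 / (2 * θ ^ 2)) - 1)) + 1) + ε * q)) := by
  have hmeas := measurable_score (d := d) θ ρ y i
  refine (measure_le_le_of_lintegral_exp_le (M := x * ρ + x ^ 2 / (2 * θ ^ 2) * ρ ^ 2
        + (q * (A / 2 * (Real.exp (x + x ^ 2 / (2 * θ ^ 2)) - 1)
          + B / 2 * (Real.exp (-x + x ^ 2 / (2 * θ ^ 2)) - 1)) + 1))
    (hmeas.const_mul _) ?_).trans (le_of_eq (by rw [sub_neg_eq_add]))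
  have hm2 : Measurable fun ω : (V → V → ℝ) × USphere d × (V → Fin d → ℝ) =>
      ENNReal.ofReal (Real.exp (x / θ * score θ ρ y ω.1 ω.2.1 ω.2.2 i)) := by fun_prop
  rw [lintegral_prod _ hm2.aemeasurable]
  have h1 : ∀ᵐ A' ∂sbmLaw y α β, ∫⁻ ω : USphere d × (V → Fin d → ℝ),
      ENNReal.ofReal (Real.exp (x / θ * score θ ρ y A' ω.1 ω.2 i))
        ∂((sphereLaw d).prod (noiseLaw V d))
      = ENNReal.ofReal (Real.exp (x * ρ + x ^ 2 / (2 * θ ^ 2) * ρ ^ 2)) *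
        ENNReal.ofReal (Real.exp (∑ j, (x * (y i * y j) + x ^ 2 / (2 * θ ^ 2)) * A' i j)) := by
    filter_upwards [ae_isAdjacency y α β] with A' hA'
    have hm3 : Measurable fun ω : USphere d × (V → Fin d → ℝ) =>
        ENNReal.ofReal (Real.exp (x / θ * score θ ρ y A' ω.1 ω.2 i)) := by
      have := hmeas.comp (measurable_prodMk_left (β := USphere d × (V → Fin d → ℝ)) (x := A'))
      simp only [Function.comp_def] at this
      fun_prop
    rw [lintegral_prod _ hm3.aemeasurable]
    simp only [lintegral_exp_score_noise hθ.ne' ρ x hy hA', lintegral_const, measure_univ, mul_one]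
    rw [Real.exp_add (x * ρ + _), ENNReal.ofReal_mul (Real.exp_pos _).le]
  rw [lintegral_congr_ae h1, lintegral_const_mul _ (by fun_prop),
    Real.exp_add (x * ρ + _), ENNReal.ofReal_mul (Real.exp_pos _).le]
  gcongr
  have := lintegral_exp_row_balanced_le hy hα hβ i fun v => x * v + x ^ 2 / (2 * θ ^ 2)
  simpa using this

end Score

/-! ### Gaussian events -/

section Noise

variable {V : Type*} [Fintype V] {d : ℕ}

/-- The projections of the rows of the noise on a unit vector. -/
lemma measure_noise_mul_vec_gt_le (μ : USphere d) {t : ℝ} (ht : 0 < t)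
    (hN : 0 < (Fintype.card V : ℝ)) :
    noiseLaw V d {Z | t * Fintype.card V
        < ∑ i, (∑ k, (μ : EuclideanSpace ℝ (Fin d)) k * Z i k) ^ 2} ≤ ENNReal.ofReal (4 / t) := by
  classical
  have h : ∀ i, ∫⁻ Z, ENNReal.ofReal ((∑ k, (μ : EuclideanSpace ℝ (Fin d)) k * Z i k) ^ 2)
      ∂noiseLaw V d ≤ ENNReal.ofReal 4 := fun i => by
    have h1 := lintegral_sq_linear_noise (V := V)
      (fun j k => if j = i then (μ : EuclideanSpace ℝ (Fin d)) k else 0) one_pos (by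
        rw [Finset.sum_eq_single i (by intro j _ hj; simp [hj]) (by simp)]
        simp [sum_sphere_sq])
    rw [mul_one] at h1
    convert h1 using 6 with Z
    rw [Finset.sum_eq_single i (by intro j _ hj; simp [hj]) (by simp)]
    simp
  refine (measure_lt_le_of_lintegral_le (by fun_prop) (by positivity)
    (lintegral_sum_le_card (fun i => by fun_prop) (fun i M => sq_nonneg _) h)).trans (le_of_eq ?_)
  congr 1
  field_simp

/-- The image of a fixed vector under the transposed noise matrix. -/
lemma measure_vec_mul_noise_gt_le (u : V → ℝ) {t : ℝ} (ht : 0 < t) (hd : 0 < d) :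
    noiseLaw V d {Z | t * d * ∑ i, u i ^ 2 < ∑ k, (∑ i, u i * Z i k) ^ 2}
      ≤ ENNReal.ofReal (4 / t) := by
  have hQ0 : 0 ≤ ∑ i, u i ^ 2 := Finset.sum_nonneg fun _ _ => sq_nonneg _
  rcases hQ0.eq_or_lt with h0 | hpos
  · have he : ∀ k, u k = 0 := fun k => by
      have := (Finset.sum_eq_zero_iff_of_nonneg (fun k _ => sq_nonneg (u k))).1 h0.symm k
        (Finset.mem_univ k)
      simpa using this
    simp [he]
  have h : ∀ k, ∫⁻ Z, ENNReal.ofReal ((∑ i, u i * Z i k) ^ 2)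
      ∂noiseLaw V d ≤ ENNReal.ofReal (4 * ∑ i, u i ^ 2) := fun k => by
    have h1 := lintegral_sq_linear_noise (V := V) (fun i l => if l = k then u i else 0) hpos (by
      simp)
    convert h1 using 6 with Z
    simp
  have hd' : (0 : ℝ) < d := by exact_mod_cast hd
  refine (measure_lt_le_of_lintegral_le (by fun_prop) (by positivity)
    (lintegral_sum_le_card (fun i => by fun_prop) (fun i M => sq_nonneg _) h)).trans (le_of_eq ?_)
  congr 1
  rw [Fintype.card_fin]
  field_simp

lemma measure_noise_row_ge_le {t : ℝ} :
    noiseLaw V d (⋃ j, {Z | 4 * (d + t) ≤ ∑ k, Z j k ^ 2})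
      ≤ ENNReal.ofReal (Fintype.card V * Real.exp (-t)) := by
  refine measure_iUnion_fintype_le_card fun j => ?_
  have h1 := (measurePreserving_eval (fun _ : V => Measure.pi fun _ : Fin d => gaussianReal 0 1)
    j).measure_preimage (s := {z | 4 * (d + t) ≤ ∑ k, z k ^ 2})
    (measurableSet_le measurable_const (by fun_prop)).nullMeasurableSet
  change noiseLaw V d _ = _ at h1
  rw [show {Z : V → Fin d → ℝ | 4 * (d + t) ≤ ∑ k, Z j k ^ 2}
    = Function.eval j ⁻¹' {z | 4 * (d + t) ≤ ∑ k, z k ^ 2} from rfl, h1]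
  have h2 := measure_le_le_of_lintegral_exp_le (t := d + t) (by fun_prop)
    (lintegral_exp_sq_norm_gaussian (κ := Fin d))
  refine le_trans (measure_mono fun z hz => ?_) (h2.trans (ENNReal.ofReal_le_ofReal ?_))
  · simp only [Set.mem_ofPred_eq] at hz ⊢
    rw [← Finset.sum_div]; linarith
  · rw [Fintype.card_fin]
    refine Real.exp_le_exp.2 ?_
    have : (0 : ℝ) ≤ d := by positivity
    linarith

/-- Leave-one-out: a vector that is computed without the `j`-th noise row is independent of it,
so that its product with that row has Gaussian tails. -/
lemma measure_leave_one_out_le [DecidableEq V] {e : (V → Fin d → ℝ) → Fin d → ℝ}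
    (he : Measurable e) {t : ℝ} (ht : 0 ≤ t) :
    noiseLaw V d (⋃ j, {Z | 2 * t * ∑ k, e (Function.update Z j 0) k ^ 2
        < (∑ k, e (Function.update Z j 0) k * Z j k) ^ 2})
      ≤ ENNReal.ofReal (Fintype.card V * (2 * Real.exp (-t))) := by
  refine measure_iUnion_fintype_le_card fun j => ?_
  have hu : Measurable fun Z : V → Fin d → ℝ => e (Function.update Z j 0) :=
    he.comp (measurable_update'.comp (measurable_id.prodMk measurable_const))
  have hu' : ∀ k, Measurable fun Z : V → Fin d → ℝ => e (Function.update Z j 0) k :=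
    fun k => (measurable_pi_apply k).comp hu
  refine measure_pi_le_of_update j (measurableSet_lt (by fun_prop) (by fun_prop)) fun Z => ?_
  simp only [Set.mem_ofPred_eq, Function.update_idem, Function.update_self]
  exact gaussian_linear_tail _ ht

end Noise

/-! ### The ridge solution on convolved features -/

section Convolved

variable {V E : Type*} [Fintype V] [NormedAddCommGroup E] [InnerProductSpace ℝ E]

open scoped RealInnerProductSpace

/-- Schur's test for a matrix whose absolute row and column sums are at most `D`. -/
lemma sum_sq_mulVec_le {M : V → V → ℝ} {D : ℝ} (hrow : ∀ i, ∑ j, |M i j| ≤ D)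
    (hcol : ∀ j, ∑ i, |M i j| ≤ D) (x : V → ℝ) :
    ∑ i, (∑ j, M i j * x j) ^ 2 ≤ D ^ 2 * ∑ j, x j ^ 2 := by
  have h1 : ∀ i, (∑ j, M i j * x j) ^ 2 ≤ D * ∑ j, |M i j| * x j ^ 2 := fun i => by
    have h2 := Finset.sum_mul_sq_le_sq_mul_sq Finset.univ (fun j => √|M i j|)
      (fun j => √|M i j| * |x j|)
    have e1 : ∀ j, √|M i j| * (√|M i j| * |x j|) = |M i j * x j| := fun j => by
      rw [← mul_assoc, Real.mul_self_sqrt (abs_nonneg _), abs_mul]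
    have e2 : ∀ j, (√|M i j| * |x j|) ^ 2 = |M i j| * x j ^ 2 := fun j => by
      rw [mul_pow, Real.sq_sqrt (abs_nonneg _), sq_abs]
    simp only [e1, e2, Real.sq_sqrt (abs_nonneg _)] at h2
    have h3 : (∑ j, M i j * x j) ^ 2 ≤ (∑ j, |M i j * x j|) ^ 2 :=
      sq_le_sq.2 ((Finset.abs_sum_le_sum_abs _ _).trans (le_abs_self _))
    exact h3.trans (h2.trans (mul_le_mul_of_nonneg_right (hrow i)
      (Finset.sum_nonneg fun j _ => by positivity)))
  rcases isEmpty_or_nonempty V with hV | ⟨⟨v⟩⟩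
  · simp
  have hD : 0 ≤ D := (Finset.sum_nonneg fun j _ => abs_nonneg _).trans (hrow v)
  calc _ ≤ ∑ i, D * ∑ j, |M i j| * x j ^ 2 := Finset.sum_le_sum fun i _ => h1 i
    _ = D * ∑ j, (∑ i, |M i j|) * x j ^ 2 := by
        rw [← Finset.mul_sum, Finset.sum_comm]; simp only [Finset.sum_mul]
    _ ≤ D * ∑ j, D * x j ^ 2 := mul_le_mul_of_nonneg_left (Finset.sum_le_sum fun j _ =>
        mul_le_mul_of_nonneg_right (hcol j) (sq_nonneg _)) hD
    _ = _ := by rw [← Finset.mul_sum]; ring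

/-- The rows `L (θ (M y)_i μ + ∑ j, M i j z_j)` of the convolved features. -/
noncomputable def convRow (L θ : ℝ) (M : V → V → ℝ) (y : V → ℝ) (μ : E) (z : V → E) (i : V) : E :=
  L • ((θ * ∑ j, M i j * y j) • μ + ∑ j, M i j • z j)

variable {L θ : ℝ} {M : V → V → ℝ} {y : V → ℝ} {μ : E} {z : V → E} {S : Finset V} {lam : ℝ}

lemma convRow_inner (v : E) (i : V) : ⟪convRow L θ M y μ z i, v⟫
    = L * ((θ * ∑ j, M i j * y j) * ⟪μ, v⟫ + ∑ j, M i j * ⟪z j, v⟫) := by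
  simp only [convRow, real_inner_smul_left, inner_add_left, sum_inner]

/-- Deleting the noise of one vertex moves the ridge solution only a little. -/
lemma norm_ridge_sub_leave_one_out_le [DecidableEq V] {D : ℝ} (hD : 0 ≤ D)
    (hcol : ∀ j, ∑ i, |M i j| ≤ D) (hy : ∀ i, y i ^ 2 = 1) (hlam : 0 < lam) {β β' : E} (j : V)
    (h : IsRidge (convRow L θ M y μ z) S y lam β)
    (h' : IsRidge (convRow L θ M y μ (Function.update z j 0)) S y lam β') :
    ‖β - β'‖ ≤ 2 / lam * (|L| * D * ‖z j‖ * √(Fintype.card V)) := by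
  refine h.norm_sub_le_of_rank_one h' hlam (u := fun i => L * M i j) (z := z j)
    (by positivity) (by positivity) (fun i _ => ?_) ?_ ?_
  · have : ∑ k, M i k • z k - ∑ k, M i k • Function.update z j 0 k = M i j • z j := by
      rw [← Finset.sum_sub_distrib, Finset.sum_eq_single j
        (by intro k _ hk; rw [Function.update_of_ne hk, sub_self]) (by simp)]
      simp
    rw [convRow, convRow, ← smul_sub, add_sub_add_left_eq_sub, this, smul_smul]
  · calc ∑ i ∈ S, (L * M i j) ^ 2 ≤ ∑ i, (L * M i j) ^ 2 :=
          Finset.sum_le_univ_sum_of_nonneg fun _ => sq_nonneg _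
      _ = |L| ^ 2 * ∑ i, |M i j| ^ 2 := by
          simp only [mul_pow, Finset.mul_sum, sq_abs]
      _ ≤ |L| ^ 2 * (∑ i, |M i j|) ^ 2 := by
          gcongr; exact Finset.sum_sq_le_sq_sum_of_nonneg fun _ _ => abs_nonneg _
      _ ≤ |L| ^ 2 * D ^ 2 := by
          gcongr; exact hcol j
      _ = _ := by ring
  · rw [Real.sq_sqrt (by positivity)]
    refine (Finset.sum_le_univ_sum_of_nonneg fun _ => sq_nonneg _).trans (le_of_eq ?_)
    simp [hy]

/-- Comparison of the ridge solution with `√N ζ μ`, the ridge solution for the features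
`(κ / √N) y_i μ`. The hypotheses measure how far the convolved features are from those, in the two
directions that enter the energy estimate. -/
lemma norm_ridge_sub_limit_le {D κ τ ω : ℝ} (hrow : ∀ i, ∑ j, |M i j| ≤ D)
    (hcol : ∀ j, ∑ i, |M i j| ≤ D) (hy : ∀ i, y i ^ 2 = 1) (hμ : ‖μ‖ = 1) (hlam : 0 < lam)
    (hN : 0 < (Fintype.card V : ℝ)) (hS : (S.card : ℝ) = τ * Fintype.card V)
    (hω : 0 ≤ ω)
    (h1 : ∑ i, (L * θ * ∑ j, M i j * y j - κ / √(Fintype.card V) * y i) ^ 2 ≤ ω ^ 2)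
    (h2 : L ^ 2 * D ^ 2 * ∑ j, ⟪z j, μ⟫ ^ 2 ≤ ω ^ 2)
    (h3 : |L| * ‖∑ j, (∑ i ∈ S, y i * M i j) • z j‖ ≤ √(Fintype.card V) * ω)
    {β : E} (h : IsRidge (convRow L θ M y μ z) S y lam β) :
    ‖β - (√(Fintype.card V) * (κ * τ / (κ ^ 2 * τ + lam))) • μ‖ ≤
      √(Fintype.card V) * (ω * (2 * |1 - κ * (κ * τ / (κ ^ 2 * τ + lam))| / lam
        + 2 * |κ * τ / (κ ^ 2 * τ + lam)| / √lam)) := by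
  set N : ℝ := (Fintype.card V : ℝ) with hNdef
  set ζ := κ * τ / (κ ^ 2 * τ + lam) with hζ
  have hs : 0 < √N := Real.sqrt_pos.2 hN
  have hs2 : √N ^ 2 = N := Real.sq_sqrt hN.le
  have hSy : ∑ i ∈ S, y i ^ 2 = τ * N := by simp [hy, hS]
  have h0 := isRidge_rank_one (S := S) (y := y) (k := κ / √N) hμ hlam
  have hβ0 : κ / √N * (τ * N) / ((κ / √N) ^ 2 * (τ * N) + lam) = √N * ζ := by
    have e1 : κ / √N * (τ * N) = √N * (κ * τ) := by
      rw [div_mul_eq_mul_div, div_eq_iff hs.ne']; linear_combination (-κ * τ) * hs2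
    have e2 : (κ / √N) ^ 2 * (τ * N) = κ ^ 2 * τ := by
      rw [div_pow, hs2]; field_simp
    rw [e1, e2, hζ]; ring
  rw [hSy, hβ0] at h0
  set w : V → ℝ := fun i => L * θ * ∑ j, M i j * y j - κ / √N * y i with hw
  have hμμ : ⟪μ, μ⟫ = 1 := by rw [real_inner_self_eq_norm_sq, hμ]; norm_num
  have hdiff : ∀ i, convRow L θ M y μ z i - (κ / √N * y i) • μ
      = w i • μ + L • ∑ j, M i j • z j := fun i => by
    rw [convRow, smul_add, smul_smul, hw, sub_smul, ← mul_assoc]; abel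
  have hres : ∀ i, y i - ⟪(κ / √N * y i) • μ, (√N * ζ) • μ⟫ = (1 - κ * ζ) * y i := fun i => by
    rw [real_inner_smul_left, real_inner_smul_right, hμμ]; field_simp
  refine (h.norm_sub_le h0 hlam (p := √N * |ζ| * (2 * ω))
    (r := |1 - κ * ζ| * (2 * (√N * ω))) (by positivity) ?_ ?_).trans (le_of_eq (by ring))
  · have e1 : ∀ i, ⟪convRow L θ M y μ z i - (κ / √N * y i) • μ, (√N * ζ) • μ⟫ ^ 2
        = N * ζ ^ 2 * (w i + L * ∑ j, M i j * ⟪z j, μ⟫) ^ 2 := fun i => by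
      rw [hdiff, real_inner_smul_right, inner_add_left, real_inner_smul_left, real_inner_smul_left,
        sum_inner, hμμ, mul_pow, mul_pow, hs2, mul_one]
      simp only [real_inner_smul_left]
    simp only [e1]
    rw [← Finset.mul_sum]
    have e2 : ∑ i ∈ S, (w i + L * ∑ j, M i j * ⟪z j, μ⟫) ^ 2 ≤ 4 * ω ^ 2 := by
      calc _ ≤ ∑ i, (w i + L * ∑ j, M i j * ⟪z j, μ⟫) ^ 2 :=
            Finset.sum_le_univ_sum_of_nonneg fun _ => sq_nonneg _
        _ ≤ ∑ i, (2 * w i ^ 2 + 2 * (L ^ 2 * (∑ j, M i j * ⟪z j, μ⟫) ^ 2)) :=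
            Finset.sum_le_sum fun i _ => by
              nlinarith [sq_nonneg (w i - L * ∑ j, M i j * ⟪z j, μ⟫)]
        _ = 2 * ∑ i, w i ^ 2 + 2 * (L ^ 2 * ∑ i, (∑ j, M i j * ⟪z j, μ⟫) ^ 2) := by
            rw [Finset.sum_add_distrib, Finset.mul_sum, Finset.mul_sum, Finset.mul_sum]
        _ ≤ _ := by
            have := mul_le_mul_of_nonneg_left (sum_sq_mulVec_le hrow hcol fun j => ⟪z j, μ⟫)
              (sq_nonneg L)
            linarith
    calc _ ≤ N * ζ ^ 2 * (4 * ω ^ 2) := by gcongr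
      _ = _ := by rw [mul_pow, mul_pow, hs2, sq_abs]; ring
  · have e1 : ∑ i ∈ S, (y i - ⟪(κ / √N * y i) • μ, (√N * ζ) • μ⟫) •
        (convRow L θ M y μ z i - (κ / √N * y i) • μ)
        = (1 - κ * ζ) • ((∑ i ∈ S, y i * w i) • μ
          + L • ∑ j, (∑ i ∈ S, y i * M i j) • z j) := by
      simp only [hres, hdiff, Finset.sum_smul, smul_add, Finset.smul_sum, smul_smul,
        Finset.sum_add_distrib]
      congr 1
      · exact Finset.sum_congr rfl fun i _ => by rw [mul_assoc]
      · rw [Finset.sum_comm]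
        exact Finset.sum_congr rfl fun i _ => Finset.sum_congr rfl fun j _ => by
          congr 1; ring
    rw [e1, norm_smul, Real.norm_eq_abs]
    refine mul_le_mul_of_nonneg_left ?_ (abs_nonneg _)
    refine (norm_add_le _ _).trans ?_
    rw [norm_smul, norm_smul, hμ, mul_one, Real.norm_eq_abs, Real.norm_eq_abs]
    have e2 : |∑ i ∈ S, y i * w i| ≤ √N * ω := by
      refine abs_le_of_sq_le_sq ?_ (by positivity)
      refine (Finset.sum_mul_sq_le_sq_mul_sq _ _ _).trans ?_
      rw [mul_pow, hs2]
      refine mul_le_mul ?_ ((Finset.sum_le_univ_sum_of_nonneg fun _ => sq_nonneg _).trans h1)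
        (Finset.sum_nonneg fun _ _ => sq_nonneg _) hN.le
      refine (Finset.sum_le_univ_sum_of_nonneg fun _ => sq_nonneg _).trans (le_of_eq ?_)
      simp [hy, hNdef]
    linarith

/-- The prediction at a vertex is `√N ζ ⟪H i, μ⟫` up to a small error. The noise rows that enter
`H i` are correlated with `β`; each is handled by comparison with the ridge solution `βj j` that
leaves it out, for which `hloo` is a Gaussian tail bound. -/
lemma abs_prediction_sub_le {D R T ω₁ ω₂ : ℝ} (hrow : ∀ i, ∑ j, |M i j| ≤ D)
    (hy : ∀ i, y i ^ 2 = 1) (hμ : ‖μ‖ = 1) (hθ : 0 ≤ θ) (hT : 0 ≤ T)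
    {β β₀ : E} {βj : V → E}
    (h1 : ‖β - β₀‖ ≤ ω₁) (h2 : ∀ j, ‖β - βj j‖ ≤ ω₂) (hR : ∀ j, ‖z j‖ ≤ R)
    (hloo : ∀ j, |⟪z j, βj j - β₀⟫| ≤ T * ‖βj j - β₀‖) (i : V) :
    |⟪convRow L θ M y μ z i, β⟫ - ⟪convRow L θ M y μ z i, β₀⟫|
      ≤ |L| * (D * (θ * ω₁ + (T * (ω₁ + ω₂) + R * ω₂))) := by
  have hω₁ : 0 ≤ ω₁ := (norm_nonneg _).trans h1
  have hz : ∀ j, |⟪z j, β - β₀⟫| ≤ T * (ω₁ + ω₂) + R * ω₂ := fun j => by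
    have e : ⟪z j, β - β₀⟫ = ⟪z j, βj j - β₀⟫ + ⟪z j, β - βj j⟫ := by
      rw [← inner_add_right]; congr 1; abel
    rw [e]
    refine (abs_add_le _ _).trans (add_le_add ((hloo j).trans ?_) ?_)
    · refine mul_le_mul_of_nonneg_left ?_ hT
      have e2 : βj j - β₀ = (β - β₀) - (β - βj j) := by abel
      rw [e2]
      exact (norm_sub_le _ _).trans (add_le_add h1 (h2 j))
    · exact (abs_real_inner_le_norm _ _).trans
        (mul_le_mul (hR j) (h2 j) (norm_nonneg _) ((norm_nonneg _).trans (hR j)))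
  have hC : 0 ≤ T * (ω₁ + ω₂) + R * ω₂ := (abs_nonneg _).trans (hz i)
  have hyabs : ∀ j, |y j| = 1 := fun j => by
    rw [← sq_eq_sq₀ (abs_nonneg _) zero_le_one, sq_abs, hy, one_pow]
  rw [← inner_sub_right, convRow_inner, abs_mul]
  refine mul_le_mul_of_nonneg_left ?_ (abs_nonneg _)
  refine (abs_add_le _ _).trans ?_
  rw [mul_add]
  refine add_le_add ?_ ?_
  · rw [abs_mul, abs_mul, abs_of_nonneg hθ]
    have e1 : |∑ j, M i j * y j| ≤ D :=
      (Finset.abs_sum_le_sum_abs _ _).trans (le_trans (le_of_eq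
        (Finset.sum_congr rfl fun j _ => by rw [abs_mul, hyabs, mul_one])) (hrow i))
    have e2 : |⟪μ, β - β₀⟫| ≤ ω₁ :=
      (abs_real_inner_le_norm _ _).trans (by rw [hμ, one_mul]; exact h1)
    calc _ ≤ θ * D * ω₁ := mul_le_mul (mul_le_mul_of_nonneg_left e1 hθ) e2 (abs_nonneg _)
          (mul_nonneg hθ ((abs_nonneg _).trans e1))
      _ = _ := by ring
  · refine (Finset.abs_sum_le_sum_abs _ _).trans ?_
    calc ∑ j, |M i j * ⟪z j, β - β₀⟫| ≤ ∑ j, |M i j| * (T * (ω₁ + ω₂) + R * ω₂) :=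
          Finset.sum_le_sum fun j _ => by
            rw [abs_mul]; exact mul_le_mul_of_nonneg_left (hz j) (abs_nonneg _)
      _ ≤ _ := by
          rw [← Finset.sum_mul]; exact mul_le_mul_of_nonneg_right (hrow i) hC

end Convolved

/-! ### The estimator in terms of convolved features -/

section Estimator

open scoped RealInnerProductSpace

variable {n m d : ℕ}

/-- The revealed vertices. -/
def revealed (n m : ℕ) : Finset (Vtx n m) := Finset.univ.map Function.Embedding.inl

lemma sum_revealed {R : Type*} [AddCommMonoid R] (f : Vtx n m → R) :
    ∑ i ∈ revealed n m, f i = ∑ i, f (Sum.inl i) := by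
  simp [revealed]

lemma sketchL_mul_apply (H : Matrix (Vtx n m) (Fin d) ℝ) (i : Fin n) (k : Fin d) :
    (sketchL n m * H) i k = H (Sum.inl i) k := by
  simp [sketchL, Matrix.mul_apply]

lemma sketchL_mulVec (y : Vtx n m → ℝ) (i : Fin n) :
    (sketchL n m *ᵥ y) i = y (Sum.inl i) := by
  simp [sketchL, Matrix.mulVec, dotProduct]

lemma sketchU_mulVec (y : Vtx n m → ℝ) (i : Fin m) :
    (sketchU n m *ᵥ y) i = y (Sum.inr i) := by
  simp [sketchU, Matrix.mulVec, dotProduct]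

lemma posDef_gram_add {ι : Type*} [Fintype ι] (T : Matrix ι (Fin d) ℝ) {lam : ℝ}
    (hlam : 0 < lam) : (Tᵀ * T + lam • (1 : Matrix (Fin d) (Fin d) ℝ)).PosDef := by
  have h1 : (Tᵀ * T).PosSemidef := by
    have := Matrix.posSemidef_conjTranspose_mul_self T
    rwa [Matrix.conjTranspose_eq_transpose_of_trivial] at this
  exact (Matrix.PosDef.one.smul hlam).posSemidef_add h1

lemma isRidge_ridgeCoef (H : Matrix (Vtx n m) (Fin d) ℝ) {lam : ℝ} (hlam : 0 < lam)
    (y : Vtx n m → ℝ) :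
    IsRidge (fun i => WithLp.toLp 2 (H i)) (revealed n m) y lam
      (WithLp.toLp 2 (ridgeCoef H lam y)) := by
  set T := sketchL n m * H with hT
  set yL := sketchL n m *ᵥ y with hyL
  have hG : Hᵀ * ((sketchL n m)ᵀ * sketchL n m) * H = Tᵀ * T := by
    rw [hT, Matrix.transpose_mul]; simp only [Matrix.mul_assoc]
  have hv : Hᵀ *ᵥ (((sketchL n m)ᵀ * sketchL n m) *ᵥ y) = Tᵀ *ᵥ yL := by
    rw [hT, hyL, Matrix.transpose_mul]; simp only [← Matrix.mulVec_mulVec]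
  have hdef : ridgeCoef H lam y
      = (Tᵀ * T + lam • (1 : Matrix (Fin d) (Fin d) ℝ))⁻¹ *ᵥ (Tᵀ *ᵥ yL) := by
    rw [ridgeCoef, hG, hv]
  set β := ridgeCoef H lam y with hβ
  have hne : (Tᵀ * T + lam • (1 : Matrix (Fin d) (Fin d) ℝ)) *ᵥ β = Tᵀ *ᵥ yL := by
    rw [hdef, Matrix.mulVec_mulVec, Matrix.mul_nonsing_inv _
      (posDef_gram_add T hlam).det_pos.ne'.isUnit, Matrix.one_mulVec]
  intro v
  have h1 : (WithLp.ofLp v) ⬝ᵥ (Tᵀ *ᵥ (yL - T *ᵥ β)) = lam * (WithLp.ofLp v ⬝ᵥ β) := by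
    rw [Matrix.mulVec_sub, ← hne, Matrix.add_mulVec, Matrix.mulVec_mulVec, add_sub_cancel_left,
      Matrix.smul_mulVec, Matrix.one_mulVec, dotProduct_smul, smul_eq_mul]
  rw [Matrix.mulVec_transpose, dotProduct_comm, ← Matrix.dotProduct_mulVec] at h1
  rw [sum_revealed, EuclideanSpace.inner_eq_star_dotProduct]
  simp only [EuclideanSpace.inner_eq_star_dotProduct, star_trivial]
  rw [← h1]
  refine Finset.sum_congr rfl fun i _ => ?_
  have e1 : ∀ w : Fin d → ℝ, (T *ᵥ w) i = w ⬝ᵥ H (Sum.inl i) := fun w => by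
    rw [dotProduct_comm]
    simp only [Matrix.mulVec, dotProduct, hT, sketchL_mul_apply]
  rw [Pi.sub_apply, e1, e1, hyL, sketchL_mulVec]

/-- The scalar factor `(N q)^{-1/2} δ⁻¹` of the convolution, `δ` the average degree of `A_ρ`. -/
noncomputable def convScale {V : Type*} [Fintype V] [DecidableEq V] (A : V → V → ℝ) (ρ q : ℝ) :
    ℝ :=
  1 / √((Fintype.card V : ℝ) * q) * ((1 / (Fintype.card V : ℝ)) * ∑ i, ∑ j, selfLoop A ρ i j)⁻¹

/-- The noise rows as vectors of the Euclidean space. -/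
def noiseRow {V : Type*} (Z : V → Fin d → ℝ) (j : V) : EuclideanSpace ℝ (Fin d) :=
  WithLp.toLp 2 (Z j)

lemma conv_eq {V : Type*} [Fintype V] [DecidableEq V] (A : V → V → ℝ) (ρ q θ : ℝ)
    (y : V → ℝ) (μ : USphere d) (Z : V → Fin d → ℝ) (i : V) :
    WithLp.toLp 2 (conv A ρ q (features θ y μ Z) i) = convRow (convScale A ρ q) θ (selfLoop A ρ) y
      (μ : EuclideanSpace ℝ (Fin d)) (noiseRow Z) i := by
  have : Nonempty V := ⟨i⟩
  ext k
  have hinv : ∀ δ : ℝ, (Matrix.diagonal fun _ : V => δ)⁻¹ = Matrix.diagonal fun _ => δ⁻¹ :=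
    fun δ => by
      rcases eq_or_ne δ 0 with rfl | hδ
      · rw [inv_zero, show (Matrix.diagonal fun _ : V => (0 : ℝ)) = 0 from Matrix.diagonal_zero,
          Matrix.inv_zero]
      · exact Matrix.inv_eq_right_inv (by simp [Matrix.diagonal_mul_diagonal, hδ])
  change conv A ρ q (features θ y μ Z) i k = _
  rw [conv, avgDegree, hinv, Matrix.smul_apply, Matrix.mul_assoc, Matrix.diagonal_mul]
  simp only [convRow, convScale, features, noiseRow, smul_eq_mul, PiLp.smul_apply, PiLp.add_apply,
    WithLp.ofLp_sum, Finset.sum_apply, Matrix.mul_apply, Matrix.of_apply, WithLp.ofLp_smul,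
    Pi.smul_apply]
  rw [← mul_assoc]
  congr 1
  simp only [mul_add, Finset.sum_add_distrib, Finset.mul_sum, Finset.sum_mul]
  congr 1
  exact Finset.sum_congr rfl fun j _ => by ring

/-- The ridge coefficients as a function of the sample. -/
noncomputable def sampleCoef (θ q ρ lam : ℝ) (y : Vtx n m → ℝ) (A : Vtx n m → Vtx n m → ℝ)
    (μ : USphere d) (Z : Vtx n m → Fin d → ℝ) : EuclideanSpace ℝ (Fin d) :=
  WithLp.toLp 2 (ridgeCoef (conv A ρ q (features θ y μ Z)) lam y)

lemma isRidge_sampleCoef {lam : ℝ} (hlam : 0 < lam) (θ q ρ : ℝ) (y : Vtx n m → ℝ)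
    (A : Vtx n m → Vtx n m → ℝ) (μ : USphere d) (Z : Vtx n m → Fin d → ℝ) :
    IsRidge (convRow (convScale A ρ q) θ (selfLoop A ρ) y (μ : EuclideanSpace ℝ (Fin d))
      (noiseRow Z)) (revealed n m) y lam (sampleCoef θ q ρ lam y A μ Z) := by
  have h := isRidge_ridgeCoef (conv A ρ q (features θ y μ Z)) hlam y
  simp only [conv_eq] at h
  exact h

lemma yLRR_eq (θ q ρ lam : ℝ) (ω : Sample n m d) (i : Fin m) :
    yLRR θ q ρ lam ω i = ⟪convRow (convScale ω.2.1 ρ q) θ (selfLoop ω.2.1 ρ)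
      (labels ω.1.1 ω.1.2) (ω.2.2.1 : EuclideanSpace ℝ (Fin d)) (noiseRow ω.2.2.2) (Sum.inr i),
      sampleCoef θ q ρ lam (labels ω.1.1 ω.1.2) ω.2.1 ω.2.2.1 ω.2.2.2⟫ := by
  rw [← conv_eq, sampleCoef, EuclideanSpace.inner_eq_star_dotProduct, star_trivial,
    dotProduct_comm]
  simp only [yLRR, sketchU_mulVec]
  rfl

lemma measurable_matrix_inv {Ω ι : Type*} [MeasurableSpace Ω] [Fintype ι] [DecidableEq ι]
    {G : Ω → Matrix ι ι ℝ} (hG : ∀ k l, Measurable fun ω => G ω k l) (k l : ι) :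
    Measurable fun ω => (G ω)⁻¹ k l := by
  have hdet : ∀ {G : Ω → Matrix ι ι ℝ}, (∀ k l, Measurable fun ω => G ω k l) →
      Measurable fun ω => (G ω).det := fun {G} hG => by
    simp only [Matrix.det_apply]
    exact Finset.measurable_sum _ fun σ _ =>
      (Finset.measurable_prod _ fun i _ => hG _ _).const_smul _
  simp only [Matrix.inv_def, Ring.inverse_eq_inv', Matrix.smul_apply, smul_eq_mul,
    Matrix.adjugate_apply]
  refine (hdet hG).inv.mul (hdet fun i j => ?_)
  by_cases h : i = l
  · subst h; simp
  · simp only [Matrix.updateRow_ne h]; exact hG i j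

lemma measurable_sampleCoef (θ q ρ lam : ℝ) (y : Vtx n m → ℝ) (k : Fin d) :
    Measurable fun ω : (Vtx n m → Vtx n m → ℝ) × USphere d × (Vtx n m → Fin d → ℝ) =>
      sampleCoef θ q ρ lam y ω.1 ω.2.1 ω.2.2 k := by
  have hself : ∀ i j, Measurable fun ω : (Vtx n m → Vtx n m → ℝ) × USphere d ×
      (Vtx n m → Fin d → ℝ) => selfLoop ω.1 ρ i j := fun i j =>
    (measurable_selfLoop ρ i j).comp measurable_fst
  have hμ : ∀ k, Measurable fun ω : (Vtx n m → Vtx n m → ℝ) × USphere d ×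
      (Vtx n m → Fin d → ℝ) => (ω.2.1 : EuclideanSpace ℝ (Fin d)) k := fun k =>
    (measurable_sphere_coord k).comp (measurable_fst.comp measurable_snd)
  have hH : ∀ i l, Measurable fun ω : (Vtx n m → Vtx n m → ℝ) × USphere d ×
      (Vtx n m → Fin d → ℝ) => conv ω.1 ρ q (features θ y ω.2.1 ω.2.2) i l := fun i l => by
    have : ∀ ω : (Vtx n m → Vtx n m → ℝ) × USphere d × (Vtx n m → Fin d → ℝ),
        conv ω.1 ρ q (features θ y ω.2.1 ω.2.2) i l = convScale ω.1 ρ q *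
          ((θ * ∑ j, selfLoop ω.1 ρ i j * y j) * (ω.2.1 : EuclideanSpace ℝ (Fin d)) l
            + ∑ j, selfLoop ω.1 ρ i j * ω.2.2 j l) := fun ω => by
      have h := congrArg (fun v : EuclideanSpace ℝ (Fin d) => v l)
        (conv_eq ω.1 ρ q θ y ω.2.1 ω.2.2 i)
      simpa only [convRow, noiseRow, smul_eq_mul, PiLp.smul_apply, PiLp.add_apply, WithLp.ofLp_sum,
        Finset.sum_apply, WithLp.ofLp_smul, Pi.smul_apply] using h
    simp only [this, convScale]
    fun_prop
  have hG : ∀ l l', Measurable fun ω : (Vtx n m → Vtx n m → ℝ) × USphere d ×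
      (Vtx n m → Fin d → ℝ) => ((conv ω.1 ρ q (features θ y ω.2.1 ω.2.2))ᵀ *
        ((sketchL n m)ᵀ * sketchL n m) * conv ω.1 ρ q (features θ y ω.2.1 ω.2.2)
        + lam • (1 : Matrix (Fin d) (Fin d) ℝ)) l l' := fun l l' => by
    simp only [Matrix.add_apply, Matrix.mul_apply, Matrix.transpose_apply]
    fun_prop
  have hinv := measurable_matrix_inv hG
  simp only [sampleCoef, ridgeCoef, Matrix.mulVec, dotProduct]
  refine Finset.measurable_sum _ fun l _ => (hinv k l).mul ?_
  exact Finset.measurable_sum _ fun i _ => (hH i l).mul_const _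

end Estimator

/-! ### Consequences of concentrated degrees -/

section Degrees

variable {V : Type*} [Fintype V] [DecidableEq V] {A : V → V → ℝ} {y : V → ℝ}
  {a b s q η : ℝ}

lemma sum_selfLoop (A : V → V → ℝ) (ρ : ℝ) (i : V) :
    ∑ j, selfLoop A ρ i j = ∑ j, A i j + ρ := by
  simp [selfLoop_apply, Finset.sum_add_distrib]

lemma IsAdjacency.sum_abs_selfLoop_le (hA : IsAdjacency A) {D ρ : ℝ} (i : V)
    (h : ∑ j, A i j ≤ D) : ∑ j, |selfLoop A ρ i j| ≤ D + |ρ| := by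
  calc ∑ j, |selfLoop A ρ i j| ≤ ∑ j, (A i j + if i = j then |ρ| else 0) :=
        Finset.sum_le_sum fun j _ => by
          have h0 : |A i j| = A i j := by rcases hA.zero_or_one i j with h | h <;> simp [h]
          rw [selfLoop_apply]
          refine (abs_add_le _ _).trans (le_of_eq ?_)
          rw [h0]; split_ifs <;> simp
    _ = ∑ j, A i j + |ρ| := by simp [Finset.sum_add_distrib]
    _ ≤ _ := by linarith

lemma IsAdjacency.selfLoop_symm {V : Type*} [DecidableEq V] {A : V → V → ℝ}
    (hA : IsAdjacency A) (ρ : ℝ) (i j : V) :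
    selfLoop A ρ i j = selfLoop A ρ j i := by
  rw [selfLoop_apply, selfLoop_apply, hA.symm i j]; simp [eq_comm]

/-- Mean square concentration of the degrees controls the average degree, by Cauchy–Schwarz. -/
lemma abs_avgDegree_sub_le (hN : 0 < (Fintype.card V : ℝ)) (hq : 0 ≤ q) (hη : 0 ≤ η)
    (h : ∑ i, (∑ j, A i j - q * (a / 2 + b / 2)) ^ 2 ≤ η ^ 2 * Fintype.card V * q ^ 2) :
    |(1 / (Fintype.card V : ℝ)) * ∑ i, ∑ j, selfLoop A (s * q) i j - q * ((a + b + 2 * s) / 2)|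
      ≤ η * q := by
  set N : ℝ := (Fintype.card V : ℝ) with hNdef
  have e1 : (1 / N) * ∑ i, ∑ j, selfLoop A (s * q) i j - q * ((a + b + 2 * s) / 2)
      = (1 / N) * ∑ i, (∑ j, A i j - q * (a / 2 + b / 2)) := by
    simp only [sum_selfLoop, Finset.sum_add_distrib, Finset.sum_sub_distrib, Finset.sum_const,
      Finset.card_univ, nsmul_eq_mul, ← hNdef]
    field_simp
    ring
  rw [e1]
  refine abs_le_of_sq_le_sq ?_ (by positivity)
  have h2 := Finset.sum_mul_sq_le_sq_mul_sq Finset.univ (fun _ : V => (1 : ℝ))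
    (fun i => ∑ j, A i j - q * (a / 2 + b / 2))
  simp only [one_mul, one_pow, Finset.sum_const, Finset.card_univ, nsmul_eq_mul, mul_one,
    ← hNdef] at h2
  rw [mul_pow, div_pow, one_pow, one_div, inv_mul_le_iff₀ (by positivity)]
  calc _ ≤ N * (η ^ 2 * N * q ^ 2) := h2.trans (mul_le_mul_of_nonneg_left h hN.le)
    _ = _ := by ring

lemma abs_le_and_abs_inv_sub_le {δ p : ℝ} (hp : p ≠ 0) (hq : 0 < q) (hη : η ≤ |p| / 2)
    (h : |δ - q * p| ≤ η * q) :
    |p| * q / 2 ≤ |δ| ∧ |q / δ - 1 / p| ≤ 2 * η / p ^ 2 := by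
  have hp' : 0 < |p| := abs_pos.2 hp
  have h1 : |p| * q / 2 ≤ |δ| := by
    have h2 : |q * p| - |δ| ≤ |δ - q * p| := by
      rw [abs_sub_comm]; exact abs_sub_abs_le_abs_sub _ _
    rw [abs_mul, abs_of_pos hq] at h2
    nlinarith
  refine ⟨h1, ?_⟩
  have hδ : 0 < |δ| := lt_of_lt_of_le (by positivity) h1
  have e : q / δ - 1 / p = -(δ - q * p) / (δ * p) := by
    field_simp [abs_pos.1 hδ]; ring
  have hη0 : 0 ≤ η * q := (abs_nonneg _).trans h
  rw [e, abs_div, abs_neg, abs_mul, div_le_iff₀ (by positivity), ← sq_abs p]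
  refine h.trans ?_
  rw [div_mul_eq_mul_div, le_div_iff₀ (by positivity)]
  have h3 := mul_le_mul_of_nonneg_left h1 (by
    have : 0 ≤ η := nonneg_of_mul_nonneg_left hη0 hq
    positivity : 0 ≤ 2 * η * |p|)
  nlinarith

/-- The deviation of the signal part of the convolved features from its limit. -/
lemma sum_sq_signal_sub_le {L θ C ℓ : ℝ} (hy : ∀ i, y i ^ 2 = 1)
    (hN : 0 < (Fintype.card V : ℝ)) (hq : 0 < q) (hC : 0 < C) (hη : 0 ≤ η)
    (hp : a + b + 2 * s ≠ 0) (hℓ : ℓ = 2 / |(a + b + 2 * s) / 2|)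
    (hL : L ^ 2 * (Fintype.card V) * q ^ 3 ≤ ℓ ^ 2)
    (hLq : |L * √(Fintype.card V) * √q * q| ≤ ℓ)
    (hLp : |L * √(Fintype.card V) * √q * q - 1 / ((a + b + 2 * s) / 2)|
      ≤ 2 * η / ((a + b + 2 * s) / 2) ^ 2)
    (hθ : |θ / √q - √C| ≤ η) (hθ2 : θ ^ 2 ≤ 2 * C * q)
    (h : ∑ i, (∑ j, y i * y j * A i j - q * (a / 2 - b / 2)) ^ 2
      ≤ η ^ 2 * Fintype.card V * q ^ 2) :
    ∑ i, (L * θ * ∑ j, selfLoop A (s * q) i j * y j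
        - kappa a b C s / √(Fintype.card V) * y i) ^ 2
      ≤ (η * (2 * √C * ℓ + 2 * (|(a - b + 2 * s) / 2| *
        (ℓ + √C * (2 / ((a + b + 2 * s) / 2) ^ 2))))) ^ 2 := by
  set N : ℝ := (Fintype.card V : ℝ) with hNdef
  set p := (a + b + 2 * s) / 2 with hpdef
  set r := (a - b + 2 * s) / 2 with hrdef
  have hp0 : p ≠ 0 := by rw [hpdef]; exact div_ne_zero hp two_ne_zero
  have hs : 0 < √N := Real.sqrt_pos.2 hN
  have hs2 : √N ^ 2 = N := Real.sq_sqrt hN.le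
  have hsq : 0 < √q := Real.sqrt_pos.2 hq
  have hκ : kappa a b C s = √C * (r / p) := by
    rw [kappa, hrdef, hpdef, div_div_div_cancel_right₀ two_ne_zero]
  set D := √N * (L * θ * (q * r)) - kappa a b C s with hD
  have hDle : |D| ≤ η * (|r| * (ℓ + √C * (2 / p ^ 2))) := by
    have e : D = r * ((θ / √q - √C) * (L * √N * √q * q)
        + √C * (L * √N * √q * q - 1 / p)) := by
      rw [hD, hκ]; field_simp; ring
    rw [e, abs_mul]
    have h1 : |(θ / √q - √C) * (L * √N * √q * q)| ≤ η * ℓ := by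
      rw [abs_mul]; exact mul_le_mul hθ hLq (abs_nonneg _) hη
    have h2 : |√C * (L * √N * √q * q - 1 / p)| ≤ √C * (2 * η / p ^ 2) := by
      rw [abs_mul, abs_of_nonneg (Real.sqrt_nonneg C)]
      exact mul_le_mul_of_nonneg_left hLp (Real.sqrt_nonneg C)
    calc _ ≤ |r| * (η * ℓ + √C * (2 * η / p ^ 2)) :=
          mul_le_mul_of_nonneg_left ((abs_add_le _ _).trans (add_le_add h1 h2)) (abs_nonneg _)
      _ = _ := by ring
  have hw : ∀ i, (L * θ * ∑ j, selfLoop A (s * q) i j * y j - kappa a b C s / √N * y i) ^ 2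
      ≤ 2 * (L * θ) ^ 2 * (∑ j, y i * y j * A i j - q * (a / 2 - b / 2)) ^ 2
        + 2 * D ^ 2 / N := fun i => by
    have e1 : ∑ j, selfLoop A (s * q) i j * y j
        = y i * (∑ j, y i * y j * A i j - q * (a / 2 - b / 2)) + y i * (q * r) := by
      simp only [selfLoop_apply, add_mul, ite_mul, zero_mul, Finset.sum_add_distrib,
        Finset.sum_ite_eq, Finset.mem_univ, if_true]
      have : ∑ j, A i j * y j = y i * ∑ j, y i * y j * A i j := by
        rw [Finset.mul_sum]
        exact Finset.sum_congr rfl fun j _ => by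
          linear_combination (-A i j * y j) * hy i
      rw [this, hrdef]; ring
    have e2 : L * θ * ∑ j, selfLoop A (s * q) i j * y j - kappa a b C s / √N * y i
        = y i * (L * θ * (∑ j, y i * y j * A i j - q * (a / 2 - b / 2)) + D / √N) := by
      rw [e1, hD]; field_simp; ring
    have e3 : 2 * D ^ 2 / N = 2 * (D / √N) ^ 2 := by rw [div_pow, hs2]; ring
    rw [e2, mul_pow, hy, one_mul, e3]
    nlinarith [sq_nonneg (L * θ * (∑ j, y i * y j * A i j - q * (a / 2 - b / 2)) - D / √N)]
  have hℓ0 : 0 ≤ ℓ := by rw [hℓ]; positivity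
  have hLθ : (L * θ) ^ 2 * (N * q ^ 2) ≤ 2 * C * ℓ ^ 2 := by
    calc (L * θ) ^ 2 * (N * q ^ 2) = (L ^ 2 * N * q ^ 2) * θ ^ 2 := by ring
      _ ≤ (L ^ 2 * N * q ^ 2) * (2 * C * q) := by gcongr
      _ = 2 * C * (L ^ 2 * N * q ^ 3) := by ring
      _ ≤ _ := by gcongr
  have hD2 : D ^ 2 ≤ (η * (|r| * (ℓ + √C * (2 / p ^ 2)))) ^ 2 := by
    rw [← sq_abs D]; exact pow_le_pow_left₀ (abs_nonneg _) hDle 2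
  calc _ ≤ ∑ i, (2 * (L * θ) ^ 2 * (∑ j, y i * y j * A i j - q * (a / 2 - b / 2)) ^ 2
        + 2 * D ^ 2 / N) := Finset.sum_le_sum fun i _ => hw i
    _ = 2 * (L * θ) ^ 2 * ∑ i, (∑ j, y i * y j * A i j - q * (a / 2 - b / 2)) ^ 2
        + 2 * D ^ 2 := by
        rw [Finset.sum_add_distrib, ← Finset.mul_sum, Finset.sum_const, Finset.card_univ,
          nsmul_eq_mul, ← hNdef]
        field_simp
    _ ≤ 2 * (L * θ) ^ 2 * (η ^ 2 * N * q ^ 2) + 2 * D ^ 2 := by gcongr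
    _ = 2 * η ^ 2 * ((L * θ) ^ 2 * (N * q ^ 2)) + 2 * D ^ 2 := by ring
    _ ≤ 2 * η ^ 2 * (2 * C * ℓ ^ 2) + 2 * (η * (|r| * (ℓ + √C * (2 / p ^ 2)))) ^ 2 := by gcongr
    _ ≤ _ := by
        have hc := Real.sq_sqrt hC.le
        have h0 : 0 ≤ √C * ℓ * (|r| * (ℓ + √C * (2 / p ^ 2))) := by positivity
        have e : (η * (2 * √C * ℓ + 2 * (|r| * (ℓ + √C * (2 / p ^ 2))))) ^ 2
            = 4 * η ^ 2 * (√C ^ 2 * ℓ ^ 2) + 4 * (η * (|r| * (ℓ + √C * (2 / p ^ 2)))) ^ 2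
              + 8 * η ^ 2 * (√C * ℓ * (|r| * (ℓ + √C * (2 / p ^ 2)))) := by ring
        rw [e, hc]
        have h5 := sq_nonneg (η * (|r| * (ℓ + √C * (2 / p ^ 2))))
        have h6 := mul_nonneg (sq_nonneg η) h0
        linarith

end Degrees

/-! ### Good samples and exact recovery -/

section Good

open scoped RealInnerProductSpace

variable {n m d : ℕ}

/-- The coordinates of the deviation of the ridge solution from its limit `√N ζ μ`. -/
noncomputable def looDev (θ q ρ lam ζ : ℝ) (y : Vtx n m → ℝ) (A : Vtx n m → Vtx n m → ℝ)
    (μ : USphere d) (Z : Vtx n m → Fin d → ℝ) (k : Fin d) : ℝ :=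
  (sampleCoef θ q ρ lam y A μ Z
    - (√(Fintype.card (Vtx n m)) * ζ) • (μ : EuclideanSpace ℝ (Fin d))) k

/-- The conditions on `(A, μ, Z)` under which the estimator recovers the labels: the degrees and
signed degrees concentrate in mean square, the noise has the expected size in the relevant
directions, the leave-one-out solutions are nearly orthogonal to the noise row that they leave out,
and all signed scores lie, by a margin `ε`, on the side opposite to `x`. -/
structure IsGood (y : Vtx n m → ℝ) (a b q θ ρ lam ζ η ε x : ℝ)
    (A : Vtx n m → Vtx n m → ℝ) (μ : USphere d) (Z : Vtx n m → Fin d → ℝ) : Prop where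
  adj : IsAdjacency A
  degree_le : ∀ i, ∑ j, A i j ≤ (a + b + 3) * q
  degree_dev : ∑ i, (∑ j, A i j - q * (a / 2 + b / 2)) ^ 2
    ≤ η ^ 2 * Fintype.card (Vtx n m) * q ^ 2
  signed_dev : ∑ i, (∑ j, y i * y j * A i j - q * (a / 2 - b / 2)) ^ 2
    ≤ η ^ 2 * Fintype.card (Vtx n m) * q ^ 2
  row_le : ∀ j, ∑ k, Z j k ^ 2 ≤ 4 * (d + 2 * Real.log (Fintype.card (Vtx n m)))
  proj_le : ∑ i, (∑ k, (μ : EuclideanSpace ℝ (Fin d)) k * Z i k) ^ 2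
    ≤ √q * Fintype.card (Vtx n m)
  label_le : ∑ k, (∑ j, (∑ i ∈ revealed n m, y i * selfLoop A ρ i j) * Z j k) ^ 2
    ≤ √q * d * ∑ j, (∑ i ∈ revealed n m, y i * selfLoop A ρ i j) ^ 2
  loo_le : ∀ j, (∑ k, looDev θ q ρ lam ζ y A μ (Function.update Z j 0) k * Z j k) ^ 2
    ≤ 2 * (2 * Real.log (Fintype.card (Vtx n m))) *
      ∑ k, looDev θ q ρ lam ζ y A μ (Function.update Z j 0) k ^ 2
  score_lt : ∀ i, x / θ * score θ ρ y A μ Z i < -(ε * q)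

lemma real_inner_eq_sum (u v : EuclideanSpace ℝ (Fin d)) : ⟪u, v⟫ = ∑ k, u k * v k := by
  rw [EuclideanSpace.inner_eq_star_dotProduct, star_trivial, dotProduct_comm]; rfl

lemma noiseRow_update (Z : Vtx n m → Fin d → ℝ) (j : Vtx n m) :
    noiseRow (Function.update Z j 0) = Function.update (noiseRow Z) j 0 := by
  ext i k
  rcases eq_or_ne i j with rfl | h
  · simp [noiseRow]
  · simp [noiseRow, h]

set_option maxHeartbeats 1000000 in
/-- On a good sample the prediction at a vertex is, up to a relative error of order `η`, a multiple
of its score. -/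
lemma exists_prediction_error_const (a b C s τ lam : ℝ) (hC : 0 < C)
    (hlam : 0 < lam) (hp : a + b + 2 * s ≠ 0) (ha : 0 < a) (hb : 0 < b) :
    ∃ K > 0, ∀ (η : ℝ), 0 < η → η ≤ |(a + b + 2 * s) / 2| / 2 →
      ∀ (n m d : ℕ) (q θ ε x : ℝ) (y : Vtx n m → ℝ) (A : Vtx n m → Vtx n m → ℝ) (μ : USphere d)
        (Z : Vtx n m → Fin d → ℝ),
        0 < (Fintype.card (Vtx n m) : ℝ) → (n : ℝ) = τ * Fintype.card (Vtx n m) → 1 ≤ q → 0 < θ →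
        (∀ i, y i ^ 2 = 1) →
        |θ / √q - √C| ≤ η → θ ^ 2 ≤ 2 * C * q → 1 ≤ η ^ 2 * √q →
        (d : ℝ) ≤ η ^ 2 * √q * Fintype.card (Vtx n m) →
        4 * (d + 2 * Real.log (Fintype.card (Vtx n m))) ≤ η ^ 2 * (Fintype.card (Vtx n m)) * q →
        4 * (d + 2 * Real.log (Fintype.card (Vtx n m)))
          ≤ η * (√(Fintype.card (Vtx n m)) * √q * θ) →
        2 * (2 * Real.log (Fintype.card (Vtx n m))) * C ≤ 36 * θ ^ 2 →
        IsGood y a b q θ (s * q) lam (zeta a b C τ lam s) η ε x A μ Z →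
        convScale A (s * q) q ≠ 0 ∧
        ∀ i, |⟪convRow (convScale A (s * q) q) θ (selfLoop A (s * q)) y
              (μ : EuclideanSpace ℝ (Fin d)) (noiseRow Z) i, sampleCoef θ q (s * q) lam y A μ Z⟫
            - √(Fintype.card (Vtx n m)) * zeta a b C τ lam s * (convScale A (s * q) q * (y i *
              score θ (s * q) y A μ Z i))|
          ≤ |convScale A (s * q) q| * (√(Fintype.card (Vtx n m)) * q * θ * (η * K)) := by
  set p := (a + b + 2 * s) / 2 with hpdef
  have hp0 : p ≠ 0 := div_ne_zero hp two_ne_zero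
  set ℓ := 2 / |p| with hℓ
  have hℓ0 : 0 < ℓ := by have := abs_pos.2 hp0; positivity
  set ζ := zeta a b C τ lam s with hζ
  set κ := kappa a b C s with hκ
  set k₀ := a + b + 3 + |s| with hk₀
  have hk₀0 : 0 < k₀ := by have := abs_nonneg s; positivity
  set c₁ := 2 * √C * ℓ + 2 * (|(a - b + 2 * s) / 2| * (ℓ + √C * (2 / p ^ 2))) with hc₁
  have hc₁0 : 0 ≤ c₁ := by positivity
  set c₂ := c₁ + ℓ * k₀ with hc₂
  set c₃ := c₂ * (2 * |1 - κ * ζ| / lam + 2 * |ζ| / √lam) with hc₃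
  have hc₂0 : 0 ≤ c₂ := by positivity
  have hc₃0 : 0 ≤ c₃ := by positivity
  set c₄ := 2 / lam * (ℓ * k₀) with hc₄
  have hc₄0 : 0 < c₄ := by positivity
  set cT := 6 / √C with hcT
  refine ⟨k₀ * (c₃ + (cT * (c₃ + c₄) + c₄)), by positivity, ?_⟩
  intro η hη0 hη n m d q θ ε x y A μ Z hN hn hq hθ0 hy hθ hθ2 h1 h2 h3 h4 h5 hg
  set N : ℝ := (Fintype.card (Vtx n m) : ℝ) with hNdef
  have hq0 : 0 < q := by linarith
  have hs : 0 < √N := Real.sqrt_pos.2 hN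
  have hs2 : √N ^ 2 = N := Real.sq_sqrt hN.le
  have hsq : 0 < √q := Real.sqrt_pos.2 hq0
  have hsq2 : √q ^ 2 = q := Real.sq_sqrt hq0.le
  set L := convScale A (s * q) q with hL
  -- the scale `L` of the convolution
  set δ := (1 / N) * ∑ i, ∑ j, selfLoop A (s * q) i j with hδ
  have hδp : |δ - q * p| ≤ η * q := abs_avgDegree_sub_le hN hq0.le hη0.le hg.degree_dev
  obtain ⟨hδ1, hδ2⟩ := abs_le_and_abs_inv_sub_le hp0 hq0 hη hδp
  have hLδ : L * √N * √q = δ⁻¹ := by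
    rw [hL, convScale, ← hδ, ← hNdef, Real.sqrt_mul hN.le]; field_simp
  have hδpos : 0 < |δ| := lt_of_lt_of_le (by have := abs_pos.2 hp0; positivity) hδ1
  refine ⟨fun hL0 => ?_, fun i => ?_⟩
  · rw [hL0, zero_mul, zero_mul, eq_comm, inv_eq_zero] at hLδ
    simp [hLδ] at hδpos
  have hLq : |L * √N * √q * q| ≤ ℓ := by
    have hpp := abs_pos.2 hp0
    rw [hLδ, abs_mul, abs_inv, abs_of_pos hq0, hℓ, inv_mul_le_iff₀ hδpos, mul_div_assoc',
      le_div_iff₀ hpp]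
    linarith
  have hLq' : |L| * (√N * √q * q) ≤ ℓ := by
    rw [abs_mul, abs_mul, abs_mul, abs_of_pos hs, abs_of_pos hsq, abs_of_pos hq0] at hLq
    linarith
  have hL2 : L ^ 2 * N * q ^ 3 ≤ ℓ ^ 2 := by
    have e : L ^ 2 * N * q ^ 3 = (L * √N * √q * q) ^ 2 := by
      rw [mul_pow, mul_pow, mul_pow, hs2, hsq2]; ring
    rw [e, ← sq_abs]
    exact pow_le_pow_left₀ (abs_nonneg _) hLq 2
  -- row and column sums
  have hrow : ∀ i, ∑ j, |selfLoop A (s * q) i j| ≤ k₀ * q := fun i => by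
    refine (hg.adj.sum_abs_selfLoop_le i (hg.degree_le i)).trans (le_of_eq ?_)
    rw [abs_mul, abs_of_pos hq0]; ring
  have hcol : ∀ j, ∑ i, |selfLoop A (s * q) i j| ≤ k₀ * q := fun j => by
    simp only [hg.adj.selfLoop_symm (s * q) _ j]; exact hrow j
  have hμ : ‖(μ : EuclideanSpace ℝ (Fin d))‖ = 1 := norm_eq_of_mem_sphere μ
  have hridge := isRidge_sampleCoef hlam θ q (s * q) y A μ Z
  -- the global comparison
  have hω : 0 ≤ η * c₂ := by positivity
  have e1 : ∑ i, (L * θ * ∑ j, selfLoop A (s * q) i j * y j - κ / √N * y i) ^ 2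
      ≤ (η * c₂) ^ 2 := by
    refine (sum_sq_signal_sub_le hy hN hq0 hC hη0.le hp hℓ hL2 hLq ?_ hθ hθ2
      hg.signed_dev).trans (pow_le_pow_left₀ (by positivity) ?_ 2)
    · have : L * √N * √q * q - 1 / ((a + b + 2 * s) / 2) = q / δ - 1 / p := by
        rw [hLδ, ← hpdef, inv_mul_eq_div]
      rw [← hNdef, this]; exact hδ2
    · refine mul_le_mul_of_nonneg_left ?_ hη0.le
      rw [← hpdef, ← hc₁, hc₂]; have : 0 ≤ ℓ * k₀ := by positivity
      linarith
  have hsm : (η * (ℓ * k₀)) ^ 2 ≤ (η * c₂) ^ 2 := by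
    refine pow_le_pow_left₀ (by positivity) (mul_le_mul_of_nonneg_left ?_ hη0.le) 2
    rw [hc₂]; linarith
  have e2 : L ^ 2 * (k₀ * q) ^ 2 * ∑ j, ⟪noiseRow Z j, (μ : EuclideanSpace ℝ (Fin d))⟫ ^ 2
      ≤ (η * c₂) ^ 2 := by
    have hproj : ∑ j, ⟪noiseRow Z j, (μ : EuclideanSpace ℝ (Fin d))⟫ ^ 2 ≤ √q * N := by
      refine le_trans (le_of_eq ?_) hg.proj_le
      refine Finset.sum_congr rfl fun j _ => ?_
      rw [real_inner_comm, real_inner_eq_sum]; rfl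
    refine le_trans ?_ hsm
    calc _ ≤ L ^ 2 * (k₀ * q) ^ 2 * (√q * N) := by gcongr
      _ ≤ L ^ 2 * (k₀ * q) ^ 2 * (√q * N) * (η ^ 2 * √q) :=
          le_mul_of_one_le_right (by positivity) h1
      _ = (L ^ 2 * N * q ^ 2 * √q ^ 2) * (η * k₀) ^ 2 := by ring
      _ = (L ^ 2 * N * q ^ 3) * (η * k₀) ^ 2 := by rw [hsq2]; ring
      _ ≤ ℓ ^ 2 * (η * k₀) ^ 2 := by gcongr
      _ = _ := by ring
  have e3 : |L| * ‖∑ j, (∑ i ∈ revealed n m, y i * selfLoop A (s * q) i j) • noiseRow Z j‖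
      ≤ √N * (η * c₂) := by
    set u : Vtx n m → ℝ := fun j => ∑ i ∈ revealed n m, y i * selfLoop A (s * q) i j with hu
    have hu2 : ∑ j, u j ^ 2 ≤ (k₀ * q) ^ 2 * N := by
      have := sum_sq_mulVec_le (M := fun i j => selfLoop A (s * q) i j) hrow hcol
        (fun i => if i ∈ revealed n m then y i else 0)
      have e : ∀ j, ∑ i, selfLoop A (s * q) j i * (if i ∈ revealed n m then y i else 0) = u j :=
        fun j => by
          simp only [mul_ite, mul_zero]
          rw [← Finset.sum_filter, Finset.filter_mem_eq_inter, Finset.univ_inter]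
          exact Finset.sum_congr rfl fun i _ => by
            rw [mul_comm, hg.adj.selfLoop_symm (s * q) j i]
      simp only [e] at this
      refine this.trans (mul_le_mul_of_nonneg_left ?_ (sq_nonneg _))
      calc _ ≤ ∑ i : Vtx n m, (1 : ℝ) := Finset.sum_le_sum fun i _ => by
            split_ifs
            · exact (hy i).le
            · norm_num
        _ = N := by simp [hNdef]
    have hnorm : ‖∑ j, u j • noiseRow Z j‖ ^ 2 ≤ √q * d * ∑ j, u j ^ 2 := by
      refine le_trans (le_of_eq ?_) hg.label_le
      rw [EuclideanSpace.real_norm_sq_eq]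
      simp [hu, noiseRow]
    refine abs_le_of_sq_le_sq' ?_ (by positivity) |>.2
    rw [mul_pow, sq_abs, mul_pow, hs2]
    calc _ ≤ L ^ 2 * (√q * d * ((k₀ * q) ^ 2 * N)) := by
          gcongr; exact hnorm.trans (by gcongr)
      _ ≤ L ^ 2 * (√q * (η ^ 2 * √q * N) * ((k₀ * q) ^ 2 * N)) := by gcongr
      _ = (L ^ 2 * N * q ^ 2 * √q ^ 2) * (N * (η * k₀) ^ 2) := by ring
      _ = (L ^ 2 * N * q ^ 3) * (N * (η * k₀) ^ 2) := by rw [hsq2]; ring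
      _ ≤ ℓ ^ 2 * (N * (η * k₀) ^ 2) := by gcongr
      _ = N * (η * (ℓ * k₀)) ^ 2 := by ring
      _ ≤ _ := by gcongr
  have hcard : ((revealed n m).card : ℝ) = τ * N := by
    rw [← hn]; simp [revealed]
  have hζ' : ζ = κ * τ / (κ ^ 2 * τ + lam) := rfl
  have hmain := norm_ridge_sub_limit_le hrow hcol hy hμ hlam hN hcard hω e1 e2 e3 hridge
  rw [← hζ', ← hNdef] at hmain
  have hmain' : ‖sampleCoef θ q (s * q) lam y A μ Z
      - (√N * ζ) • (μ : EuclideanSpace ℝ (Fin d))‖ ≤ √N * (η * c₃) := by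
    refine hmain.trans (le_of_eq ?_); rw [hc₃]; ring
  -- the leave-one-out comparison
  set R := √(4 * (d + 2 * Real.log N)) with hR
  have hlogN : 0 ≤ Real.log N := by rw [hNdef]; exact Real.log_natCast_nonneg _
  have hR2 : R ^ 2 = 4 * (d + 2 * Real.log N) := Real.sq_sqrt (by positivity)
  have hR0 : 0 ≤ R := Real.sqrt_nonneg _
  have hzR : ∀ j, ‖noiseRow Z j‖ ≤ R := fun j => by
    refine Real.le_sqrt_of_sq_le ?_
    rw [EuclideanSpace.real_norm_sq_eq]
    exact hg.row_le j
  set T := √(2 * (2 * Real.log N)) with hT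
  have hT0 : 0 ≤ T := Real.sqrt_nonneg _
  have hloo1 : ∀ j, ‖sampleCoef θ q (s * q) lam y A μ Z
      - sampleCoef θ q (s * q) lam y A μ (Function.update Z j 0)‖ ≤ c₄ * R / √q := fun j => by
    have hj := isRidge_sampleCoef hlam θ q (s * q) y A μ (Function.update Z j 0)
    rw [noiseRow_update] at hj
    refine (norm_ridge_sub_leave_one_out_le (by positivity) hcol hy hlam j hridge hj).trans ?_
    rw [← hNdef, le_div_iff₀ hsq]
    calc _ ≤ 2 / lam * (|L| * (k₀ * q) * R * √N) * √q := by
          gcongr; exact hzR j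
      _ = 2 / lam * ((|L| * (√N * √q * q)) * k₀) * R := by ring
      _ ≤ 2 / lam * (ℓ * k₀) * R := by gcongr
  have hloo2 : ∀ j, |⟪noiseRow Z j, sampleCoef θ q (s * q) lam y A μ (Function.update Z j 0)
      - (√N * ζ) • (μ : EuclideanSpace ℝ (Fin d))⟫|
      ≤ T * ‖sampleCoef θ q (s * q) lam y A μ (Function.update Z j 0)
        - (√N * ζ) • (μ : EuclideanSpace ℝ (Fin d))‖ := fun j => by
    refine abs_le_of_sq_le_sq ?_ (by positivity)
    rw [mul_pow, hT, Real.sq_sqrt (by positivity), EuclideanSpace.real_norm_sq_eq,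
      real_inner_comm, real_inner_eq_sum]
    exact hg.loo_le j
  have herr := abs_prediction_sub_le (L := L) (i := i) hrow hy hμ hθ0.le hT0 hmain' hloo1 hzR hloo2
  have hval : ⟪convRow L θ (selfLoop A (s * q)) y (μ : EuclideanSpace ℝ (Fin d)) (noiseRow Z) i,
      (√N * ζ) • (μ : EuclideanSpace ℝ (Fin d))⟫
      = √N * ζ * (L * (y i * score θ (s * q) y A μ Z i)) := by
    rw [real_inner_smul_right]
    refine congrArg (√N * ζ * ·) ((convRow_inner (M := selfLoop A (s * q)) _ i).trans ?_)
    rw [real_inner_self_eq_norm_sq, hμ, score,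
      ← mul_assoc (y i), ← sq, hy, one_mul, one_pow, mul_one]
    have : ∀ j, ⟪noiseRow Z j, (μ : EuclideanSpace ℝ (Fin d))⟫
        = ∑ k, (μ : EuclideanSpace ℝ (Fin d)) k * Z j k := fun j => by
      rw [real_inner_comm, real_inner_eq_sum]; rfl
    simp only [this]
  rw [hval] at herr
  refine herr.trans (mul_le_mul_of_nonneg_left ?_ (abs_nonneg _))
  -- the error terms are of relative order `η`
  have hT' : T ≤ cT * θ := by
    rw [hT, hcT]
    refine Real.sqrt_le_iff.2 ⟨by positivity, ?_⟩
    rw [mul_pow, div_pow, Real.sq_sqrt hC.le, div_mul_eq_mul_div, le_div_iff₀ hC]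
    linarith
  have hRs : R / √q ≤ √N * η := by
    rw [div_le_iff₀ hsq]
    refine abs_le_of_sq_le_sq' ?_ (by positivity) |>.2
    rw [mul_pow, mul_pow, hs2, hsq2, hR2]; linarith
  have hRR : R * (R / √q) ≤ √N * η * θ := by
    rw [mul_div_assoc', ← sq, hR2, div_le_iff₀ hsq]; linarith
  have f1 : T * (√N * (η * c₃) + c₄ * R / √q) ≤ cT * θ * (√N * η * (c₃ + c₄)) := by
    refine mul_le_mul hT' ?_ (by positivity) (by positivity)
    have := mul_le_mul_of_nonneg_left hRs hc₄0.le
    rw [mul_div_assoc]; linarith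
  have f2 : R * (c₄ * R / √q) ≤ √N * η * θ * c₄ := by
    have := mul_le_mul_of_nonneg_left hRR hc₄0.le
    calc _ = c₄ * (R * (R / √q)) := by ring
      _ ≤ _ := this
      _ = _ := by ring
  calc _ ≤ k₀ * q * (θ * (√N * (η * c₃)) + (cT * θ * (√N * η * (c₃ + c₄))
        + √N * η * θ * c₄)) := by gcongr
    _ = _ := by ring

/-- If all signed predictions have the same strict sign, there is no mismatch. -/
lemma mismatch_sign_eq_zero {y v : Fin m → ℝ} {c : ℝ} (hy : ∀ i, y i = 1 ∨ y i = -1)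
    (h : ∀ i, 0 < c * (y i * v i)) : mismatch y (fun i => Real.sign (v i)) = 0 := by
  have hsign : (∀ i, y i = Real.sign (v i)) ∨ ∀ i, y i = -Real.sign (v i) := by
    rcases lt_trichotomy c 0 with hc | hc | hc
    · right
      intro i
      have h1 : y i * v i < 0 := by
        have := h i
        by_contra hcon
        nlinarith
      rcases hy i with hi | hi
      · rw [hi, one_mul] at h1; rw [Real.sign_of_neg h1, hi, neg_neg]
      · rw [hi] at h1; rw [Real.sign_of_pos (by linarith), hi]
    · right; intro i; have := h i; simp [hc] at this
    · left
      intro i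
      have h1 : 0 < y i * v i := (mul_pos_iff_of_pos_left hc).1 (h i)
      rcases hy i with hi | hi
      · rw [hi, one_mul] at h1; rw [Real.sign_of_pos h1, hi]
      · rw [hi] at h1; rw [Real.sign_of_neg (by linarith), hi]
  unfold mismatch
  rcases hsign with h' | h'
  · simp [h']
  · simp [h']

/-- A good sample is recovered exactly. -/
lemma IsGood.mismatch_eq_zero {yL : Fin n → ℤ} {yU : Fin m → ℤ} {a b q θ ρ lam ζ η ε x K : ℝ}
    {A : Vtx n m → Vtx n m → ℝ} {μ : USphere d} {Z : Vtx n m → Fin d → ℝ}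
    (hg : IsGood (labels yL yU) a b q θ ρ lam ζ η ε x A μ Z)
    (hy : ∀ i, labels yL yU i = 1 ∨ labels yL yU i = -1) (hN : 0 < (Fintype.card (Vtx n m) : ℝ))
    (hq : 0 < q) (hθ : 0 < θ) (hL : convScale A ρ q ≠ 0) (hζ : ζ ≠ 0)
    (hK : |x| * (η * K) ≤ |ζ| * ε)
    (herr : ∀ i, |⟪convRow (convScale A ρ q) θ (selfLoop A ρ) (labels yL yU)
              (μ : EuclideanSpace ℝ (Fin d)) (noiseRow Z) i,
              sampleCoef θ q ρ lam (labels yL yU) A μ Z⟫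
            - √(Fintype.card (Vtx n m)) * ζ * (convScale A ρ q * (labels yL yU i *
              score θ ρ (labels yL yU) A μ Z i))|
          ≤ |convScale A ρ q| * (√(Fintype.card (Vtx n m)) * q * θ * (η * K))) :
    mismatch (fun i => (yU i : ℝ))
      (fun i => Real.sign (yLRR θ q ρ lam ((yL, yU), A, μ, Z) i)) = 0 := by
  set N : ℝ := (Fintype.card (Vtx n m) : ℝ) with hNdef
  set y := labels yL yU with hydef
  set L := convScale A ρ q with hLdef
  have hs : 0 < √N := Real.sqrt_pos.2 hN
  -- since `x * G < 0`, this factor makes the leading term `√N ζ L G` positive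
  refine mismatch_sign_eq_zero (c := -(x * ζ * L)) (fun i => hy (Sum.inr i)) fun i => ?_
  rw [yLRR_eq]
  set v := ⟪convRow L θ (selfLoop A ρ) y (μ : EuclideanSpace ℝ (Fin d)) (noiseRow Z) (Sum.inr i),
    sampleCoef θ q ρ lam y A μ Z⟫ with hv
  set G := score θ ρ y A μ Z (Sum.inr i) with hG
  have hyi : y (Sum.inr i) ^ 2 = 1 := by rcases hy (Sum.inr i) with h | h <;> simp [h]
  have hyabs : |y (Sum.inr i)| = 1 := by rcases hy (Sum.inr i) with h | h <;> simp [h]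
  have h1 : x * G < -(ε * q * θ) := by
    have := hg.score_lt (Sum.inr i)
    rw [div_mul_eq_mul_div, div_lt_iff₀ hθ] at this
    linarith
  set E := v - √N * ζ * (L * (y (Sum.inr i) * G)) with hE
  have hEle : |E| ≤ |L| * (√N * q * θ * (η * K)) := herr (Sum.inr i)
  change 0 < -(x * ζ * L) * (y (Sum.inr i) * v)
  have e1 : -(x * ζ * L) * (y (Sum.inr i) * v)
      = √N * (ζ * L) ^ 2 * (-(x * G)) - x * ζ * L * (y (Sum.inr i) * E) := by
    have : v = E + √N * ζ * (L * (y (Sum.inr i) * G)) := by rw [hE]; ring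
    rw [this]
    linear_combination (-(x * ζ * L) * √N * ζ * L * G) * hyi
  have e2 : x * ζ * L * (y (Sum.inr i) * E) ≤ √N * (ζ * L) ^ 2 * (ε * q * θ) := by
    refine (le_abs_self _).trans ?_
    rw [abs_mul, abs_mul, abs_mul, abs_mul, hyabs, one_mul]
    calc _ ≤ |x| * |ζ| * |L| * (|L| * (√N * q * θ * (η * K))) := by gcongr
      _ = |ζ| * |L| ^ 2 * √N * q * θ * (|x| * (η * K)) := by ring
      _ ≤ |ζ| * |L| ^ 2 * √N * q * θ * (|ζ| * ε) := by gcongr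
      _ = |ζ| ^ 2 * |L| ^ 2 * √N * (ε * q * θ) := by ring
      _ = _ := by rw [sq_abs, sq_abs]; ring
  have e3 : 0 < √N * (ζ * L) ^ 2 := by positivity
  rw [e1]
  nlinarith

end Good

/-! ### The probability of a good sample -/

section Probability

variable {n m d : ℕ}

lemma measure_triple_le {V : Type*} [Fintype V] {P : Measure (V → V → ℝ)}
    [IsProbabilityMeasure P] [IsProbabilityMeasure (sphereLaw d)]
    {S : Set ((V → V → ℝ) × USphere d × (V → Fin d → ℝ))} (hS : MeasurableSet S) {ε : ENNReal}
    (h : ∀ A μ, noiseLaw V d {Z | (A, μ, Z) ∈ S} ≤ ε) :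
    P.prod ((sphereLaw d).prod (noiseLaw V d)) S ≤ ε :=
  measure_prod_le_of_sections hS fun A =>
    measure_prod_le_of_sections (measurable_prodMk_left hS) fun μ => h A μ

lemma measure_fst_le {Ω Ω' : Type*} [MeasurableSpace Ω] [MeasurableSpace Ω'] {P : Measure Ω}
    {P' : Measure Ω'} [SFinite P'] [IsProbabilityMeasure P'] {S : Set Ω} {ε : ENNReal}
    (h : P S ≤ ε) : P.prod P' {ω | ω.1 ∈ S} ≤ ε := by
  have : {ω : Ω × Ω' | ω.1 ∈ S} = S ×ˢ Set.univ := by ext; simp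
  rw [this, Measure.prod_prod, measure_univ, mul_one]
  exact h

lemma measurable_looDev (θ q ρ lam ζ : ℝ) (y : Vtx n m → ℝ) (k : Fin d) :
    Measurable fun ω : (Vtx n m → Vtx n m → ℝ) × USphere d × (Vtx n m → Fin d → ℝ) =>
      looDev θ q ρ lam ζ y ω.1 ω.2.1 ω.2.2 k := by
  have h1 := measurable_sampleCoef (d := d) θ q ρ lam y k
  have h2 : Measurable fun ω : (Vtx n m → Vtx n m → ℝ) × USphere d × (Vtx n m → Fin d → ℝ) =>
      (ω.2.1 : EuclideanSpace ℝ (Fin d)) k :=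
    (measurable_sphere_coord k).comp (measurable_fst.comp measurable_snd)
  exact h1.sub (h2.const_mul _)

section Events

lemma measurable_triple_coord {V : Type*} (k : Fin d) :
    Measurable fun ω : (V → V → ℝ) × USphere d × (V → Fin d → ℝ) =>
      (ω.2.1 : EuclideanSpace ℝ (Fin d)) k :=
  (measurable_sphere_coord k).comp (measurable_fst.comp measurable_snd)

variable {V : Type*} [Fintype V] {P : Measure (V → V → ℝ)}
  [IsProbabilityMeasure P] [IsProbabilityMeasure (sphereLaw d)]

lemma measure_loo_event_le [DecidableEq V]
    {f : (V → V → ℝ) → USphere d → (V → Fin d → ℝ) → Fin d → ℝ}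
    (hf : ∀ k, Measurable fun ω : (V → V → ℝ) × USphere d × (V → Fin d → ℝ) =>
      f ω.1 ω.2.1 ω.2.2 k) {t : ℝ} (ht : 0 ≤ t) :
    P.prod ((sphereLaw d).prod (noiseLaw V d))
      {ω | ∃ j, 2 * t * ∑ k, f ω.1 ω.2.1 (Function.update ω.2.2 j 0) k ^ 2 <
        (∑ k, f ω.1 ω.2.1 (Function.update ω.2.2 j 0) k * ω.2.2 j k) ^ 2}
      ≤ ENNReal.ofReal (Fintype.card V * (2 * Real.exp (-t))) := by
  have hupd : ∀ j, Measurable fun ω : (V → V → ℝ) × USphere d × (V → Fin d → ℝ) =>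
      (ω.1, ω.2.1, Function.update ω.2.2 j (0 : Fin d → ℝ)) := fun j =>
    measurable_fst.prodMk ((measurable_fst.comp measurable_snd).prodMk
      (measurable_update'.comp ((measurable_snd.comp measurable_snd).prodMk measurable_const)))
  have hdev : ∀ j k, Measurable fun ω : (V → V → ℝ) × USphere d × (V → Fin d → ℝ) =>
      f ω.1 ω.2.1 (Function.update ω.2.2 j 0) k := fun j k => (hf k).comp (hupd j)
  refine measure_triple_le ?_ fun A μ => ?_
  · simp only [Set.ofPred_exists]
    exact MeasurableSet.iUnion fun j => measurableSet_lt (by fun_prop) (by fun_prop)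
  · have he : Measurable fun Z : V → Fin d → ℝ => f A μ Z :=
      measurable_pi_iff.2 fun k => (hf k).comp
        (measurable_const.prodMk (measurable_const.prodMk measurable_id))
    refine le_trans (measure_mono fun Z hZ => ?_) (measure_leave_one_out_le he ht)
    obtain ⟨j, hj⟩ := hZ
    exact Set.mem_iUnion.2 ⟨j, hj⟩

lemma measure_row_event_le {t : ℝ} :
    P.prod ((sphereLaw d).prod (noiseLaw V d))
      {ω | ∃ j, 4 * (d + t) ≤ ∑ k, ω.2.2 j k ^ 2}
      ≤ ENNReal.ofReal (Fintype.card V * Real.exp (-t)) := by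
  refine measure_triple_le ?_ fun A μ => ?_
  · simp only [Set.ofPred_exists]
    exact MeasurableSet.iUnion fun j => measurableSet_le measurable_const (by fun_prop)
  · refine le_trans (measure_mono fun Z hZ => ?_) measure_noise_row_ge_le
    obtain ⟨j, hj⟩ := hZ
    exact Set.mem_iUnion.2 ⟨j, hj⟩

lemma measure_proj_event_le {t : ℝ} (ht : 0 < t) (hN : 0 < (Fintype.card V : ℝ)) :
    P.prod ((sphereLaw d).prod (noiseLaw V d))
      {ω | t * Fintype.card V <
        ∑ i, (∑ k, (ω.2.1 : EuclideanSpace ℝ (Fin d)) k * ω.2.2 i k) ^ 2}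
      ≤ ENNReal.ofReal (4 / t) := by
  have hμ := measurable_triple_coord (d := d) (V := V)
  exact measure_triple_le (measurableSet_lt (by fun_prop) (by fun_prop)) fun A μ =>
    measure_noise_mul_vec_gt_le μ ht hN

lemma measure_label_event_le {u : (V → V → ℝ) → V → ℝ} (hu : ∀ j, Measurable fun A => u A j)
    {t : ℝ} (ht : 0 < t) (hd : 0 < d) :
    P.prod ((sphereLaw d).prod (noiseLaw V d))
      {ω | t * d * ∑ j, u ω.1 j ^ 2 < ∑ k, (∑ j, u ω.1 j * ω.2.2 j k) ^ 2}
      ≤ ENNReal.ofReal (4 / t) := by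
  have hu' : ∀ j, Measurable fun ω : (V → V → ℝ) × USphere d × (V → Fin d → ℝ) => u ω.1 j :=
    fun j => (hu j).comp measurable_fst
  exact measure_triple_le (measurableSet_lt (by fun_prop) (by fun_prop)) fun A μ =>
    measure_vec_mul_noise_gt_le (u A) ht hd

end Events

/-- The failure probability of the good event, for fixed labels. -/
lemma measure_not_isGood_le [IsProbabilityMeasure (sphereLaw d)] (hd : 0 < d)
    {y : Vtx n m → ℝ} (hy : IsBalanced y) {α β : unitInterval} {a b q θ : ℝ} (ρ lam ζ : ℝ)
    {η : ℝ} (ε x : ℝ) (ha : 0 ≤ a) (hb : 0 ≤ b) (hq : 1 ≤ q) (hθ : 0 < θ) (hη : 0 < η)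
    (hN : 0 < (Fintype.card (Vtx n m) : ℝ))
    (hα : (Fintype.card (Vtx n m) : ℝ) * α = q * a)
    (hβ : (Fintype.card (Vtx n m) : ℝ) * β = q * b) :
    (sbmLaw y α β).prod ((sphereLaw d).prod (noiseLaw (Vtx n m) d))
      {ω | ¬ IsGood y a b q θ ρ lam ζ η ε x ω.1 ω.2.1 ω.2.2}
    ≤ ENNReal.ofReal (Fintype.card (Vtx n m) * Real.exp (1 - 3 * q))
      + ENNReal.ofReal (2 * Real.exp (a + b + 1) / (η ^ 2 * q))
      + ENNReal.ofReal (2 * Real.exp (a + b + 1) / (η ^ 2 * q))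
      + ENNReal.ofReal (3 / Fintype.card (Vtx n m))
      + ENNReal.ofReal (4 / √q) + ENNReal.ofReal (4 / √q)
      + ENNReal.ofReal (Fintype.card (Vtx n m) * Real.exp (x * ρ + x ^ 2 / (2 * θ ^ 2) * ρ ^ 2
        + (q * (a / 2 * (Real.exp (x + x ^ 2 / (2 * θ ^ 2)) - 1)
          + b / 2 * (Real.exp (-x + x ^ 2 / (2 * θ ^ 2)) - 1)) + 1) + ε * q)) := by
  set N : ℝ := (Fintype.card (Vtx n m) : ℝ) with hNdef
  set P := (sbmLaw y α β).prod ((sphereLaw d).prod (noiseLaw (Vtx n m) d)) with hP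
  have hq0 : 0 < q := by linarith
  have hsq : 0 < √q := Real.sqrt_pos.2 hq0
  have hlog : 0 ≤ 2 * Real.log N := by
    have : 0 ≤ Real.log N := by rw [hNdef]; exact Real.log_natCast_nonneg _
    positivity
  have hexp : N * Real.exp (-(2 * Real.log N)) = 1 / N := by
    rw [Real.exp_neg, two_mul, Real.exp_add, Real.exp_log hN]; field_simp
  have s0 : P {ω | ω.1 ∈ {A | ¬ IsAdjacency A}} ≤ 0 :=
    measure_fst_le (le_of_eq (ae_iff.1 (ae_isAdjacency y α β)))
  have s1 : P {ω | ω.1 ∈ _} ≤ _ := measure_fst_le (measure_degree_gt_le hy ha hb hq0.le hα hβ)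
  have s2 : P {ω | ω.1 ∈ _} ≤ _ := measure_fst_le
    (measure_row_deviation_le hy ha hb hq hα hβ (ψ := fun _ => 1) (by simp) (by simp) hη hN)
  have s3 : P {ω | ω.1 ∈ _} ≤ _ := measure_fst_le
    (measure_row_deviation_le hy ha hb hq hα hβ (ψ := id) (by simp) (by simp) hη hN)
  have s4 : P _ ≤ _ := measure_row_event_le (t := 2 * Real.log N)
  have s5 : P _ ≤ _ := measure_proj_event_le hsq hN
  have s6 : P _ ≤ _ := measure_label_event_le
    (u := fun A j => ∑ i ∈ revealed n m, y i * selfLoop A ρ i j)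
    (fun j => Finset.measurable_sum _ fun i _ => (measurable_selfLoop ρ i j).const_mul _) hsq hd
  have s7 : P _ ≤ _ := measure_loo_event_le (V := Vtx n m)
    (measurable_looDev (d := d) θ q ρ lam ζ y) hlog
  have s8 : P (⋃ i, {ω | -(ε * q) ≤ x / θ * score θ ρ y ω.1 ω.2.1 ω.2.2 i}) ≤ _ :=
    measure_iUnion_fintype_le_card fun i => measure_score_le hθ ρ x hy hα hβ i ε
  rw [← hNdef, hexp] at s4
  rw [← hNdef, mul_left_comm N, hexp] at s7
  have hunion : ∀ {S T : Set ((Vtx n m → Vtx n m → ℝ) × USphere d × (Vtx n m → Fin d → ℝ))}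
      {r r' : ENNReal}, P S ≤ r → P T ≤ r' → P (S ∪ T) ≤ r + r' := fun h h' =>
    (measure_union_le _ _).trans (add_le_add h h')
  have s47 := hunion s4 s7
  rw [← ENNReal.ofReal_add (by positivity) (by positivity),
    show 1 / N + 2 * (1 / N) = 3 / N by ring] at s47
  have h := hunion (hunion (hunion (hunion (hunion (hunion (hunion s0 s1) s2) s3) s47) s5) s6) s8
  rw [zero_add] at h
  refine (measure_mono fun ω hω => ?_).trans h
  by_contra hcon
  simp only [Set.mem_union, Set.mem_ofPred_eq, Set.mem_iUnion, not_or, not_not, not_exists, not_le,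
    not_lt] at hcon
  obtain ⟨⟨⟨⟨⟨⟨⟨c0, c1⟩, c2⟩, c3⟩, c4, c7⟩, c5⟩, c6⟩, c8⟩ := hcon
  refine hω ⟨c0, fun i => (c1 i).le, ?_, ?_, fun j => (c4 j).le, c5, c6, c7, c8⟩
  · simpa using c2
  · simpa [sub_eq_add_neg] using c3

end Probability

/-! ### Averaging over the labels -/

section Averaging

lemma isProbabilityMeasure_sphereLaw {d : ℕ} (hd : 0 < d) :
    IsProbabilityMeasure (sphereLaw d) := by
  have : Nonempty (Fin d) := ⟨⟨0, hd⟩⟩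
  refine ⟨?_⟩
  rw [sphereLaw, Measure.smul_apply, smul_eq_mul]
  refine ENNReal.inv_mul_cancel ?_ (measure_ne_top _ _)
  rw [Measure.measure_univ_ne_zero]
  exact Measure.toSphere_ne_zero _

lemma finite_balanced (n : ℕ) :
    {y : Fin n → ℤ | (∀ i, y i = 1 ∨ y i = -1) ∧ ∑ i, y i = 0}.Finite := by
  refine (Set.Finite.pi (t := fun _ : Fin n => ({1, -1} : Set ℤ)) fun _ =>
    Set.toFinite _).subset fun y hy => ?_
  simpa [Set.mem_pi] using hy.1

lemma nonempty_balanced {n : ℕ} (hn : Even n) :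
    {y : Fin n → ℤ | (∀ i, y i = 1 ∨ y i = -1) ∧ ∑ i, y i = 0}.Nonempty := by
  refine ⟨fun i => (-1) ^ (i : ℕ), fun i => neg_one_pow_eq_or ℤ _, ?_⟩
  rw [Fin.sum_univ_eq_sum_range fun i => (-1 : ℤ) ^ i, neg_one_geom_sum, if_pos hn]

lemma isProbabilityMeasure_balancedLaw {n : ℕ} (hn : Even n) :
    IsProbabilityMeasure (balancedLaw n) :=
  isProbabilityMeasure_uniformOn (finite_balanced n) (nonempty_balanced hn)

lemma ae_balancedLaw (n : ℕ) :
    ∀ᵐ y ∂balancedLaw n, (∀ i, y i = 1 ∨ y i = -1) ∧ ∑ i, y i = 0 :=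
  ae_cond_mem (finite_balanced n).measurableSet

lemma isBalanced_labels {n m : ℕ} {yL : Fin n → ℤ} {yU : Fin m → ℤ}
    (hL : (∀ i, yL i = 1 ∨ yL i = -1) ∧ ∑ i, yL i = 0)
    (hU : (∀ i, yU i = 1 ∨ yU i = -1) ∧ ∑ i, yU i = 0) : IsBalanced (labels yL yU) := by
  refine ⟨?_, ?_⟩
  · rintro (i | i)
    · rcases hL.1 i with h | h <;> simp [labels, h]
    · rcases hU.1 i with h | h <;> simp [labels, h]
  · rw [Fintype.sum_sum_type]
    simp only [labels, Sum.elim_inl, Sum.elim_inr]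
    have h1 : (∑ i, (yL i : ℝ)) = 0 := by exact_mod_cast hL.2
    have h2 : (∑ i, (yU i : ℝ)) = 0 := by exact_mod_cast hU.2
    rw [h1, h2, add_zero]

/-- A mixture over a countable space: an event is unlikely if it is so for almost every value of
the mixing variable. No measurability of the event is needed. -/
lemma bind_dirac_prod_le {X Ω : Type*} [MeasurableSpace X] [MeasurableSpace Ω] [Countable X]
    [MeasurableSingletonClass X] {P : Measure X} [IsProbabilityMeasure P] {κ : X → Measure Ω}
    [∀ x, SFinite (κ x)] {S : Set (X × Ω)} {r : ENNReal}
    (h : ∀ᵐ x ∂P, κ x {ω | (x, ω) ∈ S} ≤ r) :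
    (P.bind fun x => (Measure.dirac x).prod (κ x)) S ≤ r := by
  set T : X → Set Ω := fun x => toMeasurable (κ x) {ω | (x, ω) ∈ S} with hT
  have hU : MeasurableSet (⋃ x, ({x} : Set X) ×ˢ T x) :=
    MeasurableSet.iUnion fun x => (measurableSet_singleton x).prod (measurableSet_toMeasurable _ _)
  have hsub : S ⊆ ⋃ x, ({x} : Set X) ×ˢ T x := fun p hp => by
    refine Set.mem_iUnion.2 ⟨p.1, rfl, ?_⟩
    exact subset_toMeasurable _ _ hp
  refine (measure_mono hsub).trans ?_
  rw [Measure.bind_apply hU (Measurable.of_discrete).aemeasurable]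
  calc _ ≤ ∫⁻ _, r ∂P := by
        refine lintegral_mono_ae (h.mono fun x hx => ?_)
        rw [Measure.dirac_prod, Measure.map_apply measurable_prodMk_left hU]
        have : Prod.mk x ⁻¹' (⋃ x, ({x} : Set X) ×ˢ T x) = T x := by
          ext ω; simp
        rw [this, hT, measure_toMeasurable]
        exact hx
    _ = r := by simp

/-- Exact recovery with high probability, uniformly in the labels, implies it on average. -/
lemma one_sub_le_exactProb {n m d : ℕ} (hn : Even n) (hm : Even m) (hd : 0 < d)
    {α β : unitInterval} {θ q ρ lam : ℝ} {r : ENNReal}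
    (h : ∀ (yL : Fin n → ℤ) (yU : Fin m → ℤ), IsBalanced (labels yL yU) →
      (sbmLaw (labels yL yU) α β).prod ((sphereLaw d).prod (noiseLaw (Vtx n m) d))
        {ω | mismatch (fun i => (yU i : ℝ))
          (fun i => Real.sign (yLRR θ q ρ lam ((yL, yU), ω) i)) ≠ 0} ≤ r) :
    1 - r ≤ exactProb n m d α β θ q ρ lam ∧ exactProb n m d α β θ q ρ lam ≤ 1 := by
  have := isProbabilityMeasure_sphereLaw hd
  have := isProbabilityMeasure_balancedLaw hn
  have := isProbabilityMeasure_balancedLaw hm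
  have hprob : csbmLaw n m d α β Set.univ = 1 := by
    rw [csbmLaw, Measure.bind_apply MeasurableSet.univ (Measurable.of_discrete).aemeasurable]
    simp
  have hae : ∀ᵐ y ∂(balancedLaw n).prod (balancedLaw m), IsBalanced (labels y.1 y.2) := by
    filter_upwards [Measure.quasiMeasurePreserving_fst.ae (ae_balancedLaw n),
      Measure.quasiMeasurePreserving_snd.ae (ae_balancedLaw m)] with y h1 h2
    exact isBalanced_labels h1 h2
  have hfail : csbmLaw n m d α β
      {ω | mismatch (fun i => (ω.1.2 i : ℝ)) (fun i => Real.sign (yLRR θ q ρ lam ω i)) = 0}ᶜ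
      ≤ r :=
    bind_dirac_prod_le (hae.mono fun y hy => h y.1 y.2 hy)
  refine ⟨?_, (measure_mono (Set.subset_univ _)).trans hprob.le⟩
  rw [tsub_le_iff_right, ← hprob]
  refine le_trans ?_ (add_le_add_right hfail _)
  rw [← Set.union_compl_self {ω : Sample n m d | mismatch (fun i => (ω.1.2 i : ℝ))
    (fun i => Real.sign (yLRR θ q ρ lam ω i)) = 0}]
  exact measure_union_le _ _

end Averaging

/-! ### The asymptotic regime -/

section Regime

variable {τ c : ℝ} {n m d : ℕ → ℕ} {q θ : ℕ → ℝ}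

lemma card_vtx (n m : ℕ) : (Fintype.card (Vtx n m) : ℝ) = n + m := by simp

lemma card_pos_of_ratio (hτ0 : 0 < τ) {n m : ℕ} (h : (n : ℝ) / ((n : ℝ) + (m : ℝ)) = τ) :
    0 < (Fintype.card (Vtx n m) : ℝ) := by
  rw [card_vtx]
  have h0 : (0 : ℝ) ≤ (n : ℝ) + m := by positivity
  rcases h0.eq_or_lt with h1 | h1
  · rw [← h1, div_zero] at h; linarith
  · exact h1

lemma revealed_eq_of_ratio (hτ0 : 0 < τ) {n m : ℕ} (h : (n : ℝ) / ((n : ℝ) + (m : ℝ)) = τ) :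
    (n : ℝ) = τ * Fintype.card (Vtx n m) := by
  have hN := card_pos_of_ratio hτ0 h
  rw [card_vtx] at hN ⊢
  rw [div_eq_iff hN.ne'] at h
  exact h

lemma unrevealed_eq_of_ratio (hτ0 : 0 < τ) {n m : ℕ} (h : (n : ℝ) / ((n : ℝ) + (m : ℝ)) = τ) :
    (m : ℝ) = (1 - τ) * Fintype.card (Vtx n m) := by
  have h1 := revealed_eq_of_ratio hτ0 h
  have h2 := card_vtx n m
  linarith

lemma tendsto_card_vtx (hm_top : Tendsto m atTop atTop) :
    Tendsto (fun k => (Fintype.card (Vtx (n k) (m k)) : ℝ)) atTop atTop := by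
  refine tendsto_atTop_mono (fun k => ?_) ((tendsto_natCast_atTop_atTop (R := ℝ)).comp hm_top)
  rw [card_vtx]
  simp

/-- The union bound over the vertices costs a factor `N`, that is `exp (-q)` up to a small power. -/
lemma tendsto_card_mul_exp (hτ0 : 0 < τ) (hτ1 : τ < 1)
    (hτ : ∀ k, (n k : ℝ) / ((n k : ℝ) + (m k : ℝ)) = τ) (hq_top : Tendsto q atTop atTop)
    (hq_log : ∀ ε > 0, ∀ᶠ k in atTop, (1 - ε) * Real.log (m k) ≤ q k) {γ : ℝ} (hγ : 0 < γ) (C : ℝ) :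
    Tendsto (fun k => (Fintype.card (Vtx (n k) (m k)) : ℝ) * Real.exp (C - (1 + γ) * q k))
      atTop (𝓝 0) := by
  have h1 : 0 < 1 - τ := by linarith
  have hlim : Tendsto (fun k => Real.exp C / (1 - τ) * Real.exp (-(γ / 2 * q k))) atTop (𝓝 0) := by
    have : Tendsto (fun k => Real.exp (-(γ / 2 * q k))) atTop (𝓝 0) :=
      Real.tendsto_exp_neg_atTop_nhds_zero.comp (hq_top.const_mul_atTop (by positivity))
    simpa using this.const_mul (Real.exp C / (1 - τ))
  refine squeeze_zero' (Eventually.of_forall fun k => by positivity) ?_ hlim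
  have hε : 0 < (γ / 2) / (1 + γ / 2) := by positivity
  filter_upwards [hq_log _ hε] with k hk
  have hN := card_pos_of_ratio hτ0 (hτ k)
  have hm := unrevealed_eq_of_ratio hτ0 (hτ k)
  have hmpos : (0 : ℝ) < m k := by rw [hm]; positivity
  have h2 : Real.log (m k) ≤ (1 + γ / 2) * q k := by
    have e : (1 - γ / 2 / (1 + γ / 2)) = 1 / (1 + γ / 2) := by field_simp; ring
    rw [e, one_div, inv_mul_le_iff₀ (by positivity)] at hk
    exact hk
  have h3 : (Fintype.card (Vtx (n k) (m k)) : ℝ) = m k / (1 - τ) := by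
    rw [hm]; field_simp
  rw [h3]
  have h4 : (m k : ℝ) ≤ Real.exp ((1 + γ / 2) * q k) := by
    rw [← Real.exp_log hmpos]; exact Real.exp_le_exp.2 h2
  calc _ ≤ Real.exp ((1 + γ / 2) * q k) / (1 - τ) * Real.exp (C - (1 + γ) * q k) := by gcongr
    _ = 1 / (1 - τ) * (Real.exp ((1 + γ / 2) * q k) * Real.exp (C - (1 + γ) * q k)) := by ring
    _ = 1 / (1 - τ) * (Real.exp C * Real.exp (-(γ / 2 * q k))) := by
        rw [← Real.exp_add, ← Real.exp_add]; congr 2; ring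
    _ = _ := by ring

lemma log_le_two_mul_sqrt {N : ℝ} (hN : 0 < N) : Real.log N ≤ 2 * √N := by
  have h := Real.log_le_sub_one_of_pos (Real.sqrt_pos.2 hN)
  rw [Real.log_sqrt hN.le] at h
  linarith

lemma tendsto_theta_sq_div (hc : 0 < c) (hq_top : Tendsto q atTop atTop)
    (hθq : (fun k => θ k ^ 2) ~[atTop] fun k => c * q k) :
    Tendsto (fun k => θ k ^ 2 / q k) atTop (𝓝 c) := by
  have hq0 : ∀ᶠ k in atTop, 0 < q k := hq_top.eventually_gt_atTop 0
  have h := (isEquivalent_iff_tendsto_one (hq0.mono fun k hk => by positivity)).1 hθq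
  have h2 := h.const_mul c
  rw [mul_one] at h2
  refine h2.congr' (hq0.mono fun k hk => ?_)
  simp only [Pi.div_apply]
  field_simp

/-- The numerical conditions of the deterministic analysis hold eventually. -/
lemma eventually_regime (hτ0 : 0 < τ) (hτ1 : τ < 1) (hc : 0 < c)
    (hτ : ∀ k, (n k : ℝ) / ((n k : ℝ) + (m k : ℝ)) = τ)
    (hm_top : Tendsto m atTop atTop) (hq_top : Tendsto q atTop atTop)
    (hq_log : ∀ ε > 0, ∀ᶠ k in atTop, (1 - ε) * Real.log (m k) ≤ q k)
    (hθ : ∀ᶠ k in atTop, 0 < θ k)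
    (hθq : (fun k => θ k ^ 2) ~[atTop] fun k => c * q k)
    (hdq : (fun k => (d k : ℝ)) =O[atTop] fun k => √(((n k : ℝ) + (m k : ℝ)) * q k))
    {η : ℝ} (hη : 0 < η) :
    ∀ᶠ k in atTop, |θ k / √(q k) - √c| ≤ η ∧ θ k ^ 2 ≤ 2 * c * q k ∧ 1 ≤ η ^ 2 * √(q k) ∧
      (d k : ℝ) ≤ η ^ 2 * √(q k) * Fintype.card (Vtx (n k) (m k)) ∧
      4 * (d k + 2 * Real.log (Fintype.card (Vtx (n k) (m k))))
        ≤ η ^ 2 * (Fintype.card (Vtx (n k) (m k))) * q k ∧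
      4 * (d k + 2 * Real.log (Fintype.card (Vtx (n k) (m k))))
        ≤ η * (√(Fintype.card (Vtx (n k) (m k))) * √(q k) * θ k) ∧
      2 * (2 * Real.log (Fintype.card (Vtx (n k) (m k)))) * c ≤ 36 * θ k ^ 2 := by
  obtain ⟨K, hK0, hK⟩ := hdq.exists_pos
  rw [IsBigOWith] at hK
  have hN_top := tendsto_card_vtx (n := n) hm_top
  have hsN : Tendsto (fun k => √(Fintype.card (Vtx (n k) (m k)) : ℝ)) atTop atTop :=
    Real.tendsto_sqrt_atTop.comp hN_top
  have hsq : Tendsto (fun k => √(q k)) atTop atTop := Real.tendsto_sqrt_atTop.comp hq_top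
  have hlim := tendsto_theta_sq_div hc hq_top hθq
  have hsqrt : Tendsto (fun k => √(θ k ^ 2 / q k)) atTop (𝓝 √c) :=
    (Real.continuous_sqrt.tendsto c).comp hlim
  have hc2 : c / 2 < c := by linarith
  have hc3 : c < 2 * c := by linarith
  filter_upwards [hK, hθ, hq_top.eventually_ge_atTop 1, hlim.eventually_le_const hc3,
    hlim.eventually_const_le hc2, hsqrt (Metric.closedBall_mem_nhds _ hη),
    hsq.eventually_ge_atTop (1 / η ^ 2), hsN.eventually_ge_atTop 1,
    hsN.eventually_ge_atTop (K / η ^ 2), hsN.eventually_ge_atTop (32 / η ^ 2),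
    hsq.eventually_ge_atTop (8 * K / η ^ 2), hsq.eventually_ge_atTop (8 * K / (η * (√c / 2))),
    hsq.eventually_ge_atTop (32 / (η * (√c / 2))), hq_log (1 / 2) (by norm_num),
    hq_top.eventually_ge_atTop (-Real.log (1 - τ))]
    with k hd hθ0 hq1 hu hl hs e1 e2 e3 e4 e5 e6 e7 e8 e9
  have hNpos := card_pos_of_ratio hτ0 (hτ k)
  have hm := unrevealed_eq_of_ratio hτ0 (hτ k)
  rw [← card_vtx, Real.norm_of_nonneg (by positivity), Real.norm_of_nonneg (Real.sqrt_nonneg _),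
    Real.sqrt_mul hNpos.le] at hd
  set N : ℝ := (Fintype.card (Vtx (n k) (m k)) : ℝ) with hNdef
  have hq0 : 0 < q k := by linarith
  have hsq0 : 0 < √(q k) := Real.sqrt_pos.2 hq0
  have hsq1 : 1 ≤ √(q k) := Real.one_le_sqrt.2 hq1
  have hsq2 : √(q k) * √(q k) = q k := Real.mul_self_sqrt hq0.le
  have hsN0 : 0 < √N := Real.sqrt_pos.2 hNpos
  have hsN2 : √N * √N = N := Real.mul_self_sqrt hNpos.le
  have hlog := log_le_two_mul_sqrt hNpos
  have hsc : 0 < √c := Real.sqrt_pos.2 hc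
  have hη2 : 0 < η ^ 2 := by positivity
  have hθ' : √(θ k ^ 2 / q k) = θ k / √(q k) := by
    rw [Real.sqrt_div (sq_nonneg _), Real.sqrt_sq hθ0.le]
  rw [div_le_iff₀ hq0] at hu
  rw [le_div_iff₀ hq0] at hl
  rw [div_le_iff₀ (by positivity)] at e1 e3 e4 e5 e6 e7
  have hθl : √c / 2 * √(q k) ≤ θ k := by
    refine abs_le_of_sq_le_sq' ?_ hθ0.le |>.2
    rw [mul_pow, div_pow, Real.sq_sqrt hc.le, Real.sq_sqrt hq0.le]
    have : 0 ≤ c * q k := by positivity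
    linarith
  refine ⟨?_, hu, by linarith, ?_, ?_, ?_, ?_⟩
  · have h0 : dist √(θ k ^ 2 / q k) √c ≤ η := hs
    rwa [hθ', Real.dist_eq] at h0
  · calc (d k : ℝ) ≤ K * (√N * √(q k)) := hd
      _ ≤ (√N * η ^ 2) * (√N * √(q k)) := by gcongr
      _ = η ^ 2 * √(q k) * (√N * √N) := by ring
      _ = _ := by rw [hsN2]
  · have f1 : 8 * (K * (√N * √(q k))) ≤ η ^ 2 * N * q k := by
      calc 8 * (K * (√N * √(q k))) = (8 * K) * (1 * √N * √(q k)) := by ring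
        _ ≤ (√(q k) * η ^ 2) * (√N * √N * √(q k)) := by gcongr
        _ = η ^ 2 * (√N * √N) * (√(q k) * √(q k)) := by ring
        _ = _ := by rw [hsN2, hsq2]
    have f2 : 32 * √N ≤ η ^ 2 * N * q k := by
      calc 32 * √N ≤ (√N * η ^ 2) * √N := by gcongr
        _ = η ^ 2 * (√N * √N) * 1 := by ring
        _ ≤ η ^ 2 * (√N * √N) * q k := by gcongr
        _ = _ := by rw [hsN2]
    linarith
  · have f0 : η * (√N * √(q k) * (√c / 2 * √(q k))) ≤ η * (√N * √(q k) * θ k) := by gcongr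
    have f1 : 8 * (K * (√N * √(q k))) ≤ η * (√N * √(q k) * (√c / 2 * √(q k))) := by
      calc 8 * (K * (√N * √(q k))) = (8 * K) * (√N * √(q k)) := by ring
        _ ≤ (√(q k) * (η * (√c / 2))) * (√N * √(q k)) := by gcongr
        _ = _ := by ring
    have f2 : 32 * √N ≤ η * (√N * √(q k) * (√c / 2 * √(q k))) := by
      calc 32 * √N ≤ (√(q k) * (η * (√c / 2))) * √N := by gcongr
        _ = (√(q k) * (η * (√c / 2))) * √N * 1 := by ring
        _ ≤ (√(q k) * (η * (√c / 2))) * √N * √(q k) := by gcongr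
        _ = _ := by ring
    linarith
  · have h1 : 0 < 1 - τ := by linarith
    have h2 : Real.log (m k) = Real.log (1 - τ) + Real.log N := by
      rw [hm, Real.log_mul h1.ne' hNpos.ne']
    have h3 : Real.log N ≤ 3 * q k := by linarith
    have h4 : Real.log N * c ≤ 3 * q k * c := mul_le_mul_of_nonneg_right h3 hc.le
    linarith

end Regime

/-! ### Exact recovery -/

section Recovery

variable {a b τ c lam : ℝ} {n m d : ℕ → ℕ} {α β : ℕ → unitInterval} {q θ ρ : ℕ → ℝ}

/-- The normalized exponent of the Chernoff bound for one score converges to `rowExponent`: the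
correction `x ^ 2 / (2 θ ^ 2)` vanishes and `q / θ ^ 2` tends to `1 / c`. -/
lemma tendsto_chernoff_exponent (hc : 0 < c) (hq_top : Tendsto q atTop atTop)
    (hθq : (fun k => θ k ^ 2) ~[atTop] fun k => c * q k) (A B s x : ℝ) :
    Tendsto (fun k => s * x + s ^ 2 * x ^ 2 / (2 * (θ k ^ 2 / q k))
      + (A / 2 * (Real.exp (x + x ^ 2 / (2 * θ k ^ 2)) - 1)
        + B / 2 * (Real.exp (-x + x ^ 2 / (2 * θ k ^ 2)) - 1))) atTop
      (𝓝 (rowExponent A B c s x)) := by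
  have h1 := tendsto_theta_sq_div hc hq_top hθq
  have hθ_top : Tendsto (fun k => 2 * θ k ^ 2) atTop atTop :=
    (hθq.symm.tendsto_atTop (hq_top.const_mul_atTop hc)).const_mul_atTop two_pos
  have h2 : Tendsto (fun k => x ^ 2 / (2 * θ k ^ 2)) atTop (𝓝 0) :=
    tendsto_const_nhds.div_atTop hθ_top
  have h3 : ∀ v : ℝ, Tendsto (fun k => Real.exp (v + x ^ 2 / (2 * θ k ^ 2)) - 1) atTop
      (𝓝 (Real.exp v - 1)) := fun v => by
    have := (Real.continuous_exp.tendsto _).comp (h2.const_add v)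
    rw [add_zero] at this
    exact this.sub_const 1
  have h4 := (tendsto_const_nhds (x := s ^ 2 * x ^ 2)).div (h1.const_mul 2) (by positivity)
  have h5 := (h4.const_add (s * x)).add
    (((h3 x).const_mul (A / 2)).add ((h3 (-x)).const_mul (B / 2)))
  refine h5.congr' ?_ |>.trans (le_of_eq ?_)
  · exact Eventually.of_forall fun k => rfl
  · unfold rowExponent; congr 1; ring

/-- Exact recovery for the self-loop `ρ = s q` above the threshold `J = 1`. -/
theorem tendsto_exactProb (ha : 0 < a) (hb : 0 < b)
    (hτ0 : 0 < τ) (hτ1 : τ < 1) (hc : 0 < c) (hlam : 0 < lam)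
    (hn : ∀ k, Even (n k)) (hm : ∀ k, Even (m k))
    (hτ : ∀ k, (n k : ℝ) / ((n k : ℝ) + (m k : ℝ)) = τ)
    (hm_top : Tendsto m atTop atTop) (hq_top : Tendsto q atTop atTop)
    (hq_log : ∀ ε > 0, ∀ᶠ k in atTop, (1 - ε) * Real.log (m k) ≤ q k)
    (hα : ∀ᶠ k in atTop, (α k : ℝ) = a * q k / m k)
    (hβ : ∀ᶠ k in atTop, (β k : ℝ) = b * q k / m k)
    (hθ : ∀ᶠ k in atTop, 0 < θ k)
    (hθq : (fun k => θ k ^ 2) ~[atTop] fun k => c * q k)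
    (hqd : q =O[atTop] fun k => (d k : ℝ))
    (hdq : (fun k => (d k : ℝ)) =O[atTop] fun k => √(((n k : ℝ) + (m k : ℝ)) * q k))
    (s : ℝ) (hρ : ∀ᶠ k in atTop, ρ k = s * q k)
    (hp : a / (1 - τ) + b / (1 - τ) + 2 * s ≠ 0)
    (hJ : 1 < rateJ (a / (1 - τ)) (b / (1 - τ)) c
      (zeta (a / (1 - τ)) (b / (1 - τ)) c τ lam s) s) :
    Tendsto (fun k => exactProb (n k) (m k) (d k) (α k) (β k) (θ k) (q k) (ρ k) lam)
      atTop (𝓝 1) := by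
  have hτ' : 0 < 1 - τ := by linarith
  set A := a / (1 - τ) with hAdef
  set B := b / (1 - τ) with hBdef
  have hA : 0 < A := div_pos ha hτ'
  have hB : 0 < B := div_pos hb hτ'
  obtain ⟨x, hx⟩ := exists_rowExponent_lt hc hJ
  -- the slack below `-1` is shared by the margin of the scores, the convergence of the exponent,
  -- and the decay that is left after the union bound
  obtain ⟨γ, hγ, hγx⟩ : ∃ γ > 0, rowExponent A B c s x + γ < -(1 + γ) :=
    ⟨(-1 - rowExponent A B c s x) / 4, by linarith, by linarith⟩
  have hD : A - B + 2 * s ≠ 0 := fun h => by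
    have := mul_lt_of_rowExponent_lt hA hB hc hx
    rw [h, mul_zero] at this
    exact lt_irrefl _ this
  set ζ := zeta A B c τ lam s with hζdef
  have hζ : ζ ≠ 0 := zeta_ne_zero hc hτ0 hlam hp hD
  obtain ⟨K, hK, hpred⟩ := exists_prediction_error_const A B c s τ lam hc hlam hp hA hB
  obtain ⟨η, hη, hη1, hη2⟩ : ∃ η > 0, η ≤ |(A + B + 2 * s) / 2| / 2 ∧ |x| * (η * K) ≤ |ζ| * γ := by
    have hζ' : 0 < |ζ| := abs_pos.2 hζ
    have hp' : 0 < |(A + B + 2 * s) / 2| := abs_pos.2 (div_ne_zero hp two_ne_zero)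
    refine ⟨min (|(A + B + 2 * s) / 2| / 2) (|ζ| * γ / ((|x| + 1) * K)), by positivity,
      min_le_left _ _, ?_⟩
    have h0 : 0 < (|x| + 1) * K := by positivity
    calc |x| * (min (|(A + B + 2 * s) / 2| / 2) (|ζ| * γ / ((|x| + 1) * K)) * K)
        ≤ (|x| + 1) * (|ζ| * γ / ((|x| + 1) * K) * K) := by
          gcongr
          · linarith
          · exact min_le_right _ _
      _ = |ζ| * γ := by field_simp
  set N : ℕ → ℝ := fun k => (Fintype.card (Vtx (n k) (m k)) : ℝ) with hNdef
  have hN_top : Tendsto N atTop atTop := tendsto_card_vtx hm_top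
  have hsq_top : Tendsto (fun k => √(q k)) atTop atTop := Real.tendsto_sqrt_atTop.comp hq_top
  set r : ℕ → ENNReal := fun k => ENNReal.ofReal (N k * Real.exp (1 - 3 * q k))
    + ENNReal.ofReal (2 * Real.exp (A + B + 1) / (η ^ 2 * q k))
    + ENNReal.ofReal (2 * Real.exp (A + B + 1) / (η ^ 2 * q k))
    + ENNReal.ofReal (3 / N k) + ENNReal.ofReal (4 / √(q k)) + ENNReal.ofReal (4 / √(q k))
    + ENNReal.ofReal (N k * Real.exp (1 - (1 + γ) * q k)) with hr
  have hr0 : Tendsto r atTop (𝓝 0) := by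
    have key : ∀ {f : ℕ → ℝ}, Tendsto f atTop (𝓝 0) →
        Tendsto (fun k => ENNReal.ofReal (f k)) atTop (𝓝 0) := fun h => by
      simpa using ENNReal.tendsto_ofReal h
    have t1 := key (tendsto_card_mul_exp hτ0 hτ1 hτ hq_top hq_log (γ := 2) two_pos 1)
    have t2 := key ((tendsto_const_nhds (x := 2 * Real.exp (A + B + 1))).div_atTop
      (hq_top.const_mul_atTop (r := η ^ 2) (by positivity)))
    have t3 := key ((tendsto_const_nhds (x := (3 : ℝ))).div_atTop hN_top)
    have t4 := key ((tendsto_const_nhds (x := (4 : ℝ))).div_atTop hsq_top)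
    have t5 := key (tendsto_card_mul_exp hτ0 hτ1 hτ hq_top hq_log hγ 1)
    rw [show (1 : ℝ) + 2 = 3 by norm_num] at t1
    have := (((((t1.add t2).add t2).add t3).add t4).add t4).add t5
    simpa only [add_zero] using this
  have hlow : Tendsto (fun k => 1 - r k) atTop (𝓝 1) := by
    have := ENNReal.Tendsto.sub (tendsto_const_nhds (x := (1 : ENNReal))) hr0
      (Or.inl ENNReal.one_ne_top)
    simpa using this
  have hd : ∀ᶠ k in atTop, 0 < d k := by
    obtain ⟨C, hC⟩ := hqd.bound
    filter_upwards [hC, hq_top.eventually_gt_atTop 0] with k hk hq0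
    rw [Nat.pos_iff_ne_zero]
    intro h0
    rw [h0, Nat.cast_zero, norm_zero, mul_zero, norm_le_zero_iff] at hk
    exact hq0.ne' hk
  have hmain : ∀ᶠ k in atTop,
      1 - r k ≤ exactProb (n k) (m k) (d k) (α k) (β k) (θ k) (q k) (ρ k) lam ∧
      exactProb (n k) (m k) (d k) (α k) (β k) (θ k) (q k) (ρ k) lam ≤ 1 := by
    have hexp := ((tendsto_chernoff_exponent hc hq_top hθq A B s x).add_const γ).eventually_lt_const
      hγx
    filter_upwards [hα, hβ, hθ, hρ, hd, hq_top.eventually_ge_atTop 1, hexp,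
      eventually_regime hτ0 hτ1 hc hτ hm_top hq_top hq_log hθ hθq hdq hη]
      with k hαk hβk hθk hρk hdk hqk hek hreg
    obtain ⟨c1, c2, c3, c4, c5, c6, c7⟩ := hreg
    have hNk := card_pos_of_ratio hτ0 (hτ k)
    have hmk := unrevealed_eq_of_ratio hτ0 (hτ k)
    have hqk0 : 0 < q k := by linarith
    have hα' : (Fintype.card (Vtx (n k) (m k)) : ℝ) * α k = q k * A := by
      rw [hαk, hmk, hAdef]; field_simp
    have hβ' : (Fintype.card (Vtx (n k) (m k)) : ℝ) * β k = q k * B := by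
      rw [hβk, hmk, hBdef]; field_simp
    have hsph := isProbabilityMeasure_sphereLaw hdk
    refine one_sub_le_exactProb (hn k) (hm k) hdk fun yL yU hy => ?_
    refine le_trans (measure_mono ?_) ((measure_not_isGood_le hdk hy (ρ k) lam ζ γ x hA.le hB.le
      hqk hθk hη hNk hα' hβ').trans ?_)
    · intro ω hω hg
      refine hω ?_
      rw [hρk] at hg ⊢
      obtain ⟨hL, herr⟩ := hpred η hη hη1 (n k) (m k) (d k) (q k) (θ k) γ x (labels yL yU) ω.1 ω.2.1
        ω.2.2 hNk (revealed_eq_of_ratio hτ0 (hτ k)) hqk hθk hy.sq_eq_one c1 c2 c3 c4 c5 c6 c7 hg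
      exact hg.mismatch_eq_zero hy.1 hNk hqk0 hθk hL hζ hη2 herr
    · refine add_le_add_right (ENNReal.ofReal_le_ofReal ?_) _
      refine mul_le_mul_of_nonneg_left (Real.exp_le_exp.2 ?_) hNk.le
      rw [hρk]
      have e1 : x * (s * q k) + x ^ 2 / (2 * θ k ^ 2) * (s * q k) ^ 2
          + (q k * (A / 2 * (Real.exp (x + x ^ 2 / (2 * θ k ^ 2)) - 1)
            + B / 2 * (Real.exp (-x + x ^ 2 / (2 * θ k ^ 2)) - 1)) + 1) + γ * q k
          = 1 + q k * (s * x + s ^ 2 * x ^ 2 / (2 * (θ k ^ 2 / q k))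
            + (A / 2 * (Real.exp (x + x ^ 2 / (2 * θ k ^ 2)) - 1)
              + B / 2 * (Real.exp (-x + x ^ 2 / (2 * θ k ^ 2)) - 1)) + γ) := by
        have e2 : s ^ 2 * x ^ 2 / (2 * (θ k ^ 2 / q k)) = x ^ 2 / (2 * θ k ^ 2) * s ^ 2 * q k := by
          field_simp
        rw [e2]; ring
      rw [e1]
      have := mul_le_mul_of_nonneg_left hek.le hqk0.le
      linarith
  exact tendsto_of_tendsto_of_tendsto_of_le_of_le' hlow tendsto_const_nhds
    (hmain.mono fun _ h => h.1) (hmain.mono fun _ h => h.2)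

end Recovery

end GraphRidge

open GraphRidge in
theorem theorem5
    (a b τ c lam : ℝ) (ha : 0 < a) (hb : 0 < b) (hab : a ≠ b)
    (hτ0 : 0 < τ) (hτ1 : τ < 1) (hc : 0 < c) (hlam : 0 < lam)
    (n m d : ℕ → ℕ) (α β : ℕ → unitInterval) (q θ ρ : ℕ → ℝ)
    -- balanced labels exist; the training ratio is `τ`; the asymptotic regime
    (hn : ∀ k, Even (n k)) (hm : ∀ k, Even (m k))
    (hτ : ∀ k, (n k : ℝ) / ((n k : ℝ) + (m k : ℝ)) = τ)
    (hm_top : Tendsto m atTop atTop)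
    (hq_top : Tendsto q atTop atTop)
    (hq_log : ∀ ε > 0, ∀ᶠ k in atTop, (1 - ε) * Real.log (m k) ≤ q k)
    (hα : ∀ᶠ k in atTop, (α k : ℝ) = a * q k / m k)
    (hβ : ∀ᶠ k in atTop, (β k : ℝ) = b * q k / m k)
    (hθ : ∀ᶠ k in atTop, 0 < θ k)
    (hcτ : ∀ᶠ k in atTop,
      c = θ k ^ 4 * (q k * (θ k ^ 2 + (1 - τ) * d k / m k))⁻¹)
    -- the assumptions of the theorem itself
    (hρ : ρ =O[atTop] q)
    (hθq : (fun k => θ k ^ 2) ~[atTop] fun k => c * q k)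
    (hqd : q =O[atTop] fun k => (d k : ℝ))
    (hdq : (fun k => (d k : ℝ)) =O[atTop] fun k => √(((n k : ℝ) + (m k : ℝ)) * q k)) :
    -- (a)
    ((∀ᶠ k in atTop, ρ k = 0) →
      1 < rateI (a / (1 - τ)) (b / (1 - τ)) 0 →
      Tendsto (fun k => exactProb (n k) (m k) (d k) (α k) (β k) (θ k) (q k) (ρ k) lam)
        atTop (𝓝 1)) ∧
    -- (b)
    ((∀ᶠ k in atTop, ρ k = sOpt (a / (1 - τ)) (b / (1 - τ)) c * q k) →
      a / (1 - τ) + b / (1 - τ) + 2 * sOpt (a / (1 - τ)) (b / (1 - τ)) c ≠ 0 →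
      1 < rateI (a / (1 - τ)) (b / (1 - τ)) c →
      Tendsto (fun k => exactProb (n k) (m k) (d k) (α k) (β k) (θ k) (q k) (ρ k) lam)
        atTop (𝓝 1)) ∧
    -- (c)
    (∀ s : ℝ, (∀ᶠ k in atTop, ρ k = s * q k) →
      a / (1 - τ) + b / (1 - τ) + 2 * s ≠ 0 →
      1 < rateJ (a / (1 - τ)) (b / (1 - τ)) c
        (zeta (a / (1 - τ)) (b / (1 - τ)) c τ lam s) s →
      Tendsto (fun k => exactProb (n k) (m k) (d k) (α k) (β k) (θ k) (q k) (ρ k) lam)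
        atTop (𝓝 1)) ∧
    -- the rate `J` is at most `I`, and the recovery region in (c) lies in the optimal region
    (∀ s A B C : ℝ, 0 < A → 0 < B → 0 < C → A + B + 2 * s ≠ 0 →
      rateJ A B C (zeta A B C τ lam s) s ≤ rateI A B C) ∧
    (∀ s : ℝ,
      {p : ℝ × ℝ × ℝ | 0 < p.1 ∧ 0 < p.2.1 ∧ 0 < p.2.2 ∧ p.1 + p.2.1 + 2 * s ≠ 0 ∧
        1 < rateJ p.1 p.2.1 p.2.2 (zeta p.1 p.2.1 p.2.2 τ lam s) s} ⊆
      {p : ℝ × ℝ × ℝ | 0 < p.1 ∧ 0 < p.2.1 ∧ 0 < p.2.2 ∧ 1 < rateI p.1 p.2.1 p.2.2}) := by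
  have hτ' : 0 < 1 - τ := by linarith
  have hA : 0 < a / (1 - τ) := div_pos ha hτ'
  have hB : 0 < b / (1 - τ) := div_pos hb hτ'
  have hAB : a / (1 - τ) ≠ b / (1 - τ) := fun h => hab ((div_left_inj' hτ'.ne').1 h)
  have main := tendsto_exactProb (lam := lam) ha hb hτ0 hτ1 hc hlam hn hm hτ hm_top hq_top hq_log
    hα hβ hθ hθq hqd hdq (ρ := ρ)
  refine ⟨fun hρ0 hI => ?_, fun hρs hp hI => ?_, main, fun s A B C hA hB hC _ =>
    rateJ_le_rateI hA hB hC, fun s p hp => ?_⟩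
  · exact main 0 (by simpa using hρ0) (by positivity)
      (hI.trans_le (rateI_zero_le_rateJ hA hB hc hAB hτ0 hlam))
  · exact main _ hρs hp (hI.trans_le (rateI_le_rateJ_sOpt hA hB hc hAB hτ0 hlam hp))
  · obtain ⟨h1, h2, h3, -, h4⟩ := hp
    exact ⟨h1, h2, h3, h4.trans_le (rateJ_le_rateI h1 h2 h3)⟩
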